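/- Let $a\le b\le c$ and $d$ be positive integers, and let $Q\in\mathbb{C}[x,y,z]$ be weighted homogeneous of degree $d$ with respect to the weights $|x|=a$, $|y|=b$, $|z|=c$, such that the surface $X=\{Q=0\}\subset\mathbb{C}^3$ has an isolated singularity at the origin. Assume that $X$ is not of Kleinian type $A$, that is, not isomorphic to a surface $x^m+y^2+z^2=0$ with $m\ge 2$. Let $\mathcal{O}_{\widehat X}=\mathbb{C}[[x,y,z]]/(Q)$, with the Poisson bracket $\{x,y\}=Q_z$, $\{y,z\}=Q_x$, $\{z,x\}=Q_y$ and with the weight action of $\mathbb{C}^*$, in which $w$ multiplies an element of weight $m$ by $w^m$. Let $V=\langle x,y\rangle\subset\mathcal{O}_{\widehat X}$ and $\mathbb{P}^1=\mathbb{P}(V)$, with $[\alpha:\beta]$ the line spanned by $\alpha x+\beta y$ and with the induced $\mathbb{C}^*$-action $w\cdot[\alpha:\beta]=[w^a\alpha:w^b\beta]$. For integers $n,m$ let $\mathcal{O}(n)_m$ be the line bundle $\mathcal{O}(n)$ on $\mathbb{P}^1$ with the $\mathbb{C}^*$-equivariant structure for which $w$ acts on the fiber over $[1:0]$ by $w^m$.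 For a $\mathbb{C}^*$-equivariant pro-vector bundle $U\cong\prod_i\mathcal{O}(p_i)_{q_i}$ on $\mathbb{P}^1$ in which each $\mathcal{O}(p)_q$ occurs a finite number of times, put $\chi_{\mathbb{C}^*}(U)=\sum_i s^{p_i}t^{q_i}$. **Theorem.** One has $d>c$, and there is a graded (closed) complement $\mathcal{O}^0_{\widehat X}$ to $V$ in $\mathcal{O}_{\widehat X}$ that contains all Poisson brackets. For every such complement, let $Y$ be the $\mathbb{C}^*$-equivariant quotient of the trivial pro-bundle with fiber $\mathcal{O}^0_{\widehat X}$ on $\mathbb{P}^1$ whose fiber over $[\alpha:\beta]$ is $$\mathcal{O}^0_{\widehat X}/\{\alpha x+\beta y,\mathcal{O}_{\widehat X}\},$$ and let $\widetilde Y=Y\oplus\mathcal{O}(0)_a\oplus\mathcal{O}(0)_b$. Then $\widetilde Y$ is isomorphic to a direct product of equivariant line bundles $\mathcal{O}(p_i)_{q_i}$, the number of times that each $\mathcal{O}(p)_q$ occurs is finite and the same in all such decompositions, and $$\chi_{\mathbb{C}^*}(\widetilde Y)=\frac{(1-t^{d-a})(1-t^{d-b})(1-t^{d-c})}{(1-t^a)(1-t^b)(1-t^c)(1-t^{d-a}s)},$$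 where the right-hand side is expanded as a power series in $s$ and $t$. -/

import Mathlib

open scoped LinearAlgebra.Projectivization Topology

noncomputable section

/-! ### The projective line with its torus action -/

namespace EquivP1

/-- The plane `V = ⟨x, y⟩`; the vector `v` stands for `αx + βy` with `α = v 0`, `β = v 1`. -/
abbrev Plane : Type := Fin 2 → ℂ

/-- The projective line of lines in the plane `V`, as a set of closed points. -/
abbrev P1 : Type := ℙ ℂ Plane

/-- The action of `w ∈ ℂˣ` on the plane: `(α, β) ↦ (w ^ a α, w ^ b β)`. -/
def torus (a b : ℕ) (w : ℂˣ) : Plane →ₗ[ℂ] Plane where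
  toFun v := ![(w : ℂ) ^ a * v 0, (w : ℂ) ^ b * v 1]
  map_add' u v := by ext i; fin_cases i <;> simp [mul_add]
  map_smul' r v := by ext i; fin_cases i <;> simp <;> ring

theorem torus_torus_inv (a b : ℕ) (w : ℂˣ) (v : Plane) :
    torus a b w (torus a b w⁻¹ v) = v := by
  ext i; fin_cases i <;> simp [torus]

theorem torus_inv_torus (a b : ℕ) (w : ℂˣ) (v : Plane) :
    torus a b w⁻¹ (torus a b w v) = v := by
  ext i; fin_cases i <;> simp [torus]

theorem torus_injective (a b : ℕ) (w : ℂˣ) : Function.Injective (torus a b w) :=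
  Function.LeftInverse.injective (torus_inv_torus a b w)

/-- The induced action of `w ∈ ℂˣ` on the projective line. -/
def actP (a b : ℕ) (w : ℂˣ) (p : P1) : P1 :=
  Projectivization.map (torus a b w) (torus_injective a b w) p

theorem torus_mem_actP (a b : ℕ) (w : ℂˣ) (p : P1) {v : Plane} (hv : v ∈ p.submodule) :
    torus a b w v ∈ (actP a b w p).submodule := by
  induction p using Projectivization.ind with
  | h u hu =>
    rw [Projectivization.submodule_mk, Submodule.mem_span_singleton] at hv
    obtain ⟨r, rfl⟩ := hv
    rw [actP, Projectivization.map_mk, Projectivization.submodule_mk, map_smul]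
    exact Submodule.smul_mem _ _ (Submodule.mem_span_singleton_self _)

/-- Zariski open subsets of the projective line: the empty set and the cofinite sets. -/
def IsZariskiOpen (U : Set P1) : Prop := U = ∅ ∨ Uᶜ.Finite

/-- A function on the cone of nonzero vectors is regular and homogeneous of degree `n` over
`U ⊆ ℙ¹`: near every point of `U` it is a quotient `P / D` of two forms whose degrees differ
by `n`, where `D` does not vanish at that point. -/
def IsRegularOfDegree (n : ℤ) (U : Set P1) (f : {v : Plane // v ≠ 0} → ℂ) : Prop :=
  ∀ p ∈ U, ∃ (i j : ℕ) (P D : MvPolynomial (Fin 2) ℂ),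
    P.IsHomogeneous i ∧ D.IsHomogeneous j ∧ (i : ℤ) - j = n ∧
    (∀ v ∈ p.submodule, v ≠ 0 → MvPolynomial.eval v D ≠ 0) ∧
    ∀ v : {v : Plane // v ≠ 0}, Projectivization.mk' ℂ v ∈ U →
      MvPolynomial.eval v.1 D ≠ 0 → f v = MvPolynomial.eval v.1 P / MvPolynomial.eval v.1 D

/-! ### Equivariant families of topological vector spaces over the projective line -/

/-- The data by which a `ℂˣ`-equivariant pro-vector bundle on the projective line is given:
a topological vector space (with `ℂ` discrete) over every closed point, linear maps
`E_p → E_{w p}` for `w ∈ ℂˣ`, and, for every open `U`, the regular sections over `U` (a section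
is a function on all points; regularity over `U` concerns its values at the points of `U`).
Such data are a pro-vector bundle once they are isomorphic, in the sense of `Iso`, to a product
of the line bundles `lineBundle`. -/
structure EquivFamily (a b : ℕ) where
  Fiber : P1 → Type
  [addCommGroup : ∀ p, AddCommGroup (Fiber p)]
  [module : ∀ p, Module ℂ (Fiber p)]
  [topology : ∀ p, TopologicalSpace (Fiber p)]
  act : ∀ (w : ℂˣ) (p : P1), Fiber p →ₗ[ℂ] Fiber (actP a b w p)
  IsRegular : Set P1 → (∀ p, Fiber p) → Prop

attribute [instance] EquivFamily.addCommGroup EquivFamily.module EquivFamily.topology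

namespace EquivFamily

variable {a b : ℕ}

/-- Isomorphisms: fibrewise linear homeomorphisms that commute with the action of `ℂˣ` and
identify the regular sections over every open set. -/
structure Iso (E F : EquivFamily a b) where
  toEquiv : ∀ p, E.Fiber p ≃ₗ[ℂ] F.Fiber p
  continuous_toFun : ∀ p, Continuous (toEquiv p)
  continuous_invFun : ∀ p, Continuous (toEquiv p).symm
  equivariant : ∀ (w : ℂˣ) (p : P1) (x : E.Fiber p),
    toEquiv (actP a b w p) (E.act w p x) = F.act w p (toEquiv p x)
  regular_iff : ∀ (U : Set P1), IsZariskiOpen U → ∀ s : ∀ p, E.Fiber p,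
    E.IsRegular U s ↔ F.IsRegular U (fun p => toEquiv p (s p))

/-- The direct sum of two families. -/
def sum (E F : EquivFamily a b) : EquivFamily a b where
  Fiber p := E.Fiber p × F.Fiber p
  act w p := (E.act w p).prodMap (F.act w p)
  IsRegular U s := E.IsRegular U (fun p => (s p).1) ∧ F.IsRegular U (fun p => (s p).2)

/-- The direct product of an indexed collection of families, with the product topology on the
fibres. -/
def prod {ι : Type} (E : ι → EquivFamily a b) : EquivFamily a b where
  Fiber p := ∀ i, (E i).Fiber p
  act w p := LinearMap.pi fun i => (E i).act w p ∘ₗ LinearMap.proj i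
  IsRegular U s := ∀ i, (E i).IsRegular U (fun p => s p i)

end EquivFamily

/-- The fibre of `𝒪(n)` at `p`: functions on the punctured line `p \ {0}` (extended by zero to
the plane) that are homogeneous of degree `n`. For `n = -1` this is the line `p` itself, the
vector `u ∈ p` corresponding to the function `v ↦ u / v`. -/
def lineFiber (n : ℤ) (p : P1) : Submodule ℂ (Plane → ℂ) where
  carrier := {φ | (∀ v, φ v ≠ 0 → v ∈ p.submodule ∧ v ≠ 0) ∧
    ∀ (r : ℂ), r ≠ 0 → ∀ v, φ (r • v) = r ^ n * φ v}
  zero_mem' := ⟨fun v h => absurd rfl h, fun r _ v => by simp⟩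
  add_mem' := by
    rintro φ ψ ⟨h1, h2⟩ ⟨h3, h4⟩
    refine ⟨fun v hv => ?_, fun r hr v => ?_⟩
    · by_cases h : φ v = 0
      · exact h3 v (fun h' => hv (by simp [h, h']))
      · exact h1 v h
    · simp only [Pi.add_apply, h2 r hr, h4 r hr, mul_add]
  smul_mem' := by
    rintro r φ ⟨h1, h2⟩
    refine ⟨fun v hv => h1 v (fun h' => hv (by simp [h'])), fun t ht v => ?_⟩
    simp only [Pi.smul_apply, smul_eq_mul, h2 t ht]
    ring

/-- The line bundle `𝒪(n)_m`: the bundle `𝒪(n)` with `w ∈ ℂˣ` acting by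
`(w φ)(v) = w ^ (m + a n) φ(w⁻¹ v)`. The exponent is the one for which `w` acts on the fibre
over `(1, 0)`, where `w⁻¹ v = w ^ (-a) v`, as multiplication by `w ^ m`
(see `lineBundle_act_weight`). -/
def lineBundle (a b : ℕ) (n m : ℤ) : EquivFamily a b where
  Fiber p := lineFiber n p
  topology _ := ⊥
  act w p :=
    { toFun := fun φ => ⟨fun v => (w : ℂ) ^ (m + a * n) * φ.1 (torus a b w⁻¹ v), by
        refine ⟨fun v hv => ?_, fun r hr v => ?_⟩
        · obtain ⟨h1, h2⟩ := φ.2.1 _ (right_ne_zero_of_mul hv)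
          refine ⟨?_, fun h => h2 (by rw [h, map_zero])⟩
          have := torus_mem_actP a b w p h1
          rwa [torus_torus_inv] at this
        · change _ * φ.1 (torus a b w⁻¹ (r • v)) = _ * (_ * φ.1 (torus a b w⁻¹ v))
          rw [map_smul, φ.2.2 r hr]
          ring⟩
      map_add' := fun φ ψ => by
        ext v
        simp [mul_add]
      map_smul' := fun r φ => by
        ext v
        simp
        ring }
  IsRegular U s := IsRegularOfDegree n U (fun v => (s (Projectivization.mk' ℂ v)).1 v.1)

theorem lineBundle_act_weight (a b : ℕ) (n m : ℤ) (w : ℂˣ) (p : P1)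
    (φ : (lineBundle a b n m).Fiber p) :
    ((lineBundle a b n m).act w p φ).1 ![1, 0] = (w : ℂ) ^ m * φ.1 ![1, 0] := by
  have h : torus a b w⁻¹ ![1, 0] = ((w : ℂ) ^ a)⁻¹ • ![1, 0] := by
    ext i; fin_cases i <;> simp [torus]
  have hw : (w : ℂ) ≠ 0 := w.ne_zero
  change (w : ℂ) ^ (m + a * n) * φ.1 (torus a b w⁻¹ ![1, 0]) = _
  rw [h, φ.2.2 _ (inv_ne_zero (pow_ne_zero _ hw)), ← mul_assoc, zpow_add₀ hw, zpow_mul,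
    zpow_natCast, inv_zpow, mul_assoc ((w : ℂ) ^ m), mul_inv_cancel₀ (zpow_ne_zero _
    (pow_ne_zero _ hw)), mul_one]

/-- The coefficient of `s ^ m * t ^ n` in a power series in `t = X 0` and `s = X 1`, for
arbitrary integers `m` and `n` (zero if one of them is negative). -/
def coeffST (F : MvPowerSeries (Fin 2) ℚ) (m n : ℤ) : ℚ :=
  if 0 ≤ m ∧ 0 ≤ n then
    MvPowerSeries.coeff (Finsupp.single 0 n.toNat + Finsupp.single 1 m.toNat) F
  else 0

/-- The equation `χ(E) = F`: the family `E` is a direct product of line bundles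
`𝒪(p i)_(q i)`, and, for every such decomposition, the formal sum of all `s ^ (p i) * t ^ (q i)`
is `F`, that is, each `𝒪(m)_n` occurs a finite number of times, given by the coefficient of
`s ^ m * t ^ n` in `F`. -/
def HasCharacter {a b : ℕ} (E : EquivFamily a b) (F : MvPowerSeries (Fin 2) ℚ) : Prop :=
  (∃ (ι : Type) (p q : ι → ℤ),
    Nonempty (E.Iso (EquivFamily.prod fun i => lineBundle a b (p i) (q i)))) ∧
  ∀ (ι : Type) (p q : ι → ℤ),
    Nonempty (E.Iso (EquivFamily.prod fun i => lineBundle a b (p i) (q i))) →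
    ∀ m n : ℤ, {i | p i = m ∧ q i = n}.Finite ∧
      ({i | p i = m ∧ q i = n}.ncard : ℚ) = coeffST F m n

end EquivP1

/-! ### Quasihomogeneous surfaces -/

/-- A surface `Q(x, y, z) = 0` in `ℂ³` with an isolated singularity at the origin, where `Q` is
weighted homogeneous of degree `d` for positive integer weights `a ≤ b ≤ c` of `x, y, z`.
(The singular locus is invariant under the weighted scaling, so it is `{0}` as soon as the origin
is an isolated point of it.) -/
structure QHSurface where
  a : ℕ
  b : ℕ
  c : ℕ
  d : ℕ
  a_pos : 0 < a
  a_le_b : a ≤ b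
  b_le_c : b ≤ c
  Q : MvPolynomial (Fin 3) ℂ
  homogeneous : Q.IsWeightedHomogeneous ![a, b, c] d
  isolated : {p : Fin 3 → ℂ | MvPolynomial.eval p Q = 0 ∧
    ∀ i, MvPolynomial.eval p (MvPolynomial.pderiv i Q) = 0} = {0}

namespace QHSurface

open EquivP1

/-- `X` is isomorphic to a Kleinian surface `x ^ m + y ^ 2 + z ^ 2 = 0` of type `A_{m-1}`,
`m ≥ 2`. -/
def IsTypeA (S : QHSurface) : Prop :=
  ∃ m : ℕ, 2 ≤ m ∧ Nonempty
    ((MvPolynomial (Fin 3) ℂ ⧸ Ideal.span {S.Q}) ≃ₐ[ℂ]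
      (MvPolynomial (Fin 3) ℂ ⧸ Ideal.span
        {(MvPolynomial.X 0 ^ m + MvPolynomial.X 1 ^ 2 + MvPolynomial.X 2 ^ 2 :
          MvPolynomial (Fin 3) ℂ)}))

variable (S : QHSurface)

/-- The ideal `(Q)` of `ℂ[[x, y, z]]`. -/
def I : Ideal (MvPowerSeries (Fin 3) ℂ) := Ideal.span {(S.Q : MvPowerSeries (Fin 3) ℂ)}

/-- The completed coordinate ring `ℂ[[x, y, z]] / (Q)`. -/
abbrev OX : Type := MvPowerSeries (Fin 3) ℂ ⧸ S.I

/-- The topology of `ℂ[[x, y, z]] / (Q)`: the quotient of the topology of coefficientwise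
convergence, where `ℂ` is discrete. It is the topology given by the weight filtration. -/
@[reducible] def topOX : TopologicalSpace S.OX :=
  TopologicalSpace.coinduced (Ideal.Quotient.mk S.I)
    (@Pi.topologicalSpace (Fin 3 →₀ ℕ) (fun _ => ℂ) (fun _ => ⊥))

/-- The bracket of power series with `{x, y} = Q_z`, `{y, z} = Q_x`, `{z, x} = Q_y`. -/
def bracketPS (f g : MvPowerSeries (Fin 3) ℂ) : MvPowerSeries (Fin 3) ℂ :=
  let D := fun i h => MvPowerSeries.pderiv ℂ (i : Fin 3) (h : MvPowerSeries (Fin 3) ℂ)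
  D 0 S.Q * (D 1 f * D 2 g - D 2 f * D 1 g) + D 1 S.Q * (D 2 f * D 0 g - D 0 f * D 2 g) +
    D 2 S.Q * (D 0 f * D 1 g - D 1 f * D 0 g)

/-- The Poisson bracket of `ℂ[[x, y, z]] / (Q)`, computed on representatives
(see `bracket_mk`). -/
def bracket (F G : S.OX) : S.OX :=
  Ideal.Quotient.mk S.I (S.bracketPS (Quotient.out F) (Quotient.out G))

theorem bracketPS_left (f h g : MvPowerSeries (Fin 3) ℂ) :
    S.bracketPS (f + S.Q * h) g = S.bracketPS f g + S.Q * S.bracketPS h g := by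
  simp only [bracketPS, map_add, Derivation.leibniz, smul_eq_mul]
  ring

theorem bracketPS_right (f g h : MvPowerSeries (Fin 3) ℂ) :
    S.bracketPS f (g + S.Q * h) = S.bracketPS f g + S.Q * S.bracketPS f h := by
  simp only [bracketPS, map_add, Derivation.leibniz, smul_eq_mul]
  ring

theorem exists_out (f : MvPowerSeries (Fin 3) ℂ) :
    ∃ h, Quotient.out (Ideal.Quotient.mk S.I f) = f + S.Q * h := by
  have h1 : Ideal.Quotient.mk S.I (Quotient.out (Ideal.Quotient.mk S.I f)) =
      Ideal.Quotient.mk S.I f := Quotient.out_eq _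
  rw [Ideal.Quotient.mk_eq_mk_iff_sub_mem] at h1
  obtain ⟨h, hh⟩ := Ideal.mem_span_singleton.1 h1
  exact ⟨h, by rw [← hh]; ring⟩

theorem mk_Q_mul (h : MvPowerSeries (Fin 3) ℂ) : Ideal.Quotient.mk S.I (S.Q * h) = 0 := by
  rw [Ideal.Quotient.eq_zero_iff_mem, I, Ideal.mem_span_singleton]
  exact Dvd.intro _ rfl

theorem bracket_mk (f g : MvPowerSeries (Fin 3) ℂ) :
    S.bracket (Ideal.Quotient.mk S.I f) (Ideal.Quotient.mk S.I g) =
      Ideal.Quotient.mk S.I (S.bracketPS f g) := by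
  obtain ⟨h, hh⟩ := S.exists_out f
  obtain ⟨k, hk⟩ := S.exists_out g
  rw [bracket, hh, hk, bracketPS_left, bracketPS_right, map_add, mk_Q_mul, add_zero, map_add,
    mk_Q_mul, add_zero]

/-- The weights of the action of `w ∈ ℂˣ` on the variables `x, y, z`. -/
def scaleVec (w : ℂˣ) : Fin 3 → ℂ := ![(w : ℂ) ^ S.a, (w : ℂ) ^ S.b, (w : ℂ) ^ S.c]

theorem scaleVec_prod (w : ℂˣ) (n : Fin 3 →₀ ℕ) :
    (n.prod fun i m => S.scaleVec w i ^ m) =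
      (w : ℂ) ^ (Finsupp.weight ![S.a, S.b, S.c] n) := by
  rw [Finsupp.prod_fintype _ _ (by simp), Finsupp.weight_apply,
    Finsupp.sum_fintype _ _ (by simp)]
  simp [Fin.prod_univ_three, Fin.sum_univ_three, scaleVec, pow_add, ← pow_mul, mul_comm]

theorem rescale_Q (w : ℂˣ) :
    MvPowerSeries.rescale (S.scaleVec w) (S.Q : MvPowerSeries (Fin 3) ℂ) =
      ((w : ℂ) ^ S.d) • (S.Q : MvPowerSeries (Fin 3) ℂ) := by
  ext n
  rw [MvPowerSeries.coeff_rescale, scaleVec_prod, map_smul, smul_eq_mul, MvPolynomial.coeff_coe]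
  by_cases h : MvPolynomial.coeff n S.Q = 0
  · simp [h]
  · rw [S.homogeneous h]

/-- The action of `w ∈ ℂˣ` on `ℂ[[x, y, z]] / (Q)`, that is, multiplication by `w ^ m` in
weight `m`. -/
def scale (w : ℂˣ) : S.OX →ₐ[ℂ] S.OX :=
  Ideal.quotientMapₐ S.I (MvPowerSeries.rescaleAlgHom (S.scaleVec w)) (by
    rw [I, Ideal.span_le, Set.singleton_subset_iff]
    change MvPowerSeries.rescaleAlgHom (S.scaleVec w) (S.Q : MvPowerSeries (Fin 3) ℂ) ∈
      Ideal.span {(S.Q : MvPowerSeries (Fin 3) ℂ)}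
    rw [MvPowerSeries.rescaleAlgHom_apply, rescale_Q, MvPowerSeries.smul_eq_C_mul]
    exact Ideal.mul_mem_left _ _ (Ideal.mem_span_singleton_self _))

theorem scale_mk (w : ℂˣ) (f : MvPowerSeries (Fin 3) ℂ) :
    S.scale w (Ideal.Quotient.mk S.I f) =
      Ideal.Quotient.mk S.I (MvPowerSeries.rescale (S.scaleVec w) f) := by
  rw [← MvPowerSeries.rescaleAlgHom_apply]
  rfl

/-- The element `αx + βy` of `ℂ[[x, y, z]] / (Q)`. -/
def lin (v : Plane) : S.OX :=
  v 0 • Ideal.Quotient.mk S.I (MvPowerSeries.X 0) +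
    v 1 • Ideal.Quotient.mk S.I (MvPowerSeries.X 1)

/-- The subspace `V = ⟨x, y⟩` of `ℂ[[x, y, z]] / (Q)`. -/
def V : Submodule ℂ S.OX :=
  Submodule.span ℂ {Ideal.Quotient.mk S.I (MvPowerSeries.X 0),
    Ideal.Quotient.mk S.I (MvPowerSeries.X 1)}

/-- `W` is a graded complement to `V = ⟨x, y⟩` that contains all Poisson brackets. (In the
completed ring, the graded subspaces, which are the products of their weight components, are the
closed subspaces that are stable under `ℂˣ`.) -/
structure IsGradedComplement (W : Submodule ℂ S.OX) : Prop where
  isCompl : IsCompl S.V W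
  scale_mem : ∀ (w : ℂˣ), ∀ f ∈ W, S.scale w f ∈ W
  isClosed : IsClosed[S.topOX] (W : Set S.OX)
  bracket_mem : ∀ f g, S.bracket f g ∈ W

/-- The subspace `{αx + βy, ℂ[[x, y, z]] / (Q)}` for the point `p = [α : β]`. -/
def brackets (p : P1) : Submodule ℂ S.OX :=
  Submodule.span ℂ {h | ∃ v ∈ p.submodule, ∃ f, h = S.bracket (S.lin v) f}

theorem pderiv_rescale (r : Fin 3 → ℂ) (i : Fin 3) (f : MvPowerSeries (Fin 3) ℂ) :
    MvPowerSeries.pderiv ℂ i (MvPowerSeries.rescale r f) =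
      r i • MvPowerSeries.rescale r (MvPowerSeries.pderiv ℂ i f) := by
  classical
  ext n
  simp only [MvPowerSeries.coeff_pderiv, MvPowerSeries.coeff_rescale, map_smul, smul_eq_mul]
  rw [Finsupp.prod_add_index' (by simp) (by intros; rw [pow_add]),
    Finsupp.prod_single_index (by simp)]
  ring

theorem bracketPS_rescale (w : ℂˣ) (f g : MvPowerSeries (Fin 3) ℂ) :
    ((w : ℂ) ^ S.d) • S.bracketPS (MvPowerSeries.rescale (S.scaleVec w) f)
        (MvPowerSeries.rescale (S.scaleVec w) g) =
      ((w : ℂ) ^ (S.a + S.b + S.c)) •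
        MvPowerSeries.rescale (S.scaleVec w) (S.bracketPS f g) := by
  have hQ : ∀ i : Fin 3, ((w : ℂ) ^ S.d) • MvPowerSeries.pderiv ℂ i
      (S.Q : MvPowerSeries (Fin 3) ℂ) = S.scaleVec w i •
        MvPowerSeries.rescale (S.scaleVec w) (MvPowerSeries.pderiv ℂ i S.Q) := by
    intro i
    rw [← pderiv_rescale, rescale_Q, Derivation.map_smul]
  simp only [bracketPS, smul_add, ← smul_mul_assoc, hQ, pderiv_rescale, map_add, map_sub, map_mul]
  simp only [MvPowerSeries.smul_eq_C_mul, pow_add, map_mul]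
  simp only [scaleVec, Matrix.cons_val_zero, Matrix.cons_val_one, Matrix.cons_val]
  ring

theorem scale_bracket (w : ℂˣ) (F G : S.OX) :
    S.scale w (S.bracket F G) = (((w : ℂ) ^ (S.a + S.b + S.c))⁻¹ * (w : ℂ) ^ S.d) •
      S.bracket (S.scale w F) (S.scale w G) := by
  obtain ⟨f, rfl⟩ := Ideal.Quotient.mk_surjective F
  obtain ⟨g, rfl⟩ := Ideal.Quotient.mk_surjective G
  have hw : (w : ℂ) ^ (S.a + S.b + S.c) ≠ 0 := pow_ne_zero _ w.ne_zero
  have h := congrArg (Ideal.Quotient.mkₐ ℂ S.I) (S.bracketPS_rescale w f g)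
  rw [map_smul, map_smul] at h
  rw [bracket_mk, scale_mk, scale_mk, scale_mk, bracket_mk, mul_smul]
  exact (eq_inv_smul_iff₀ hw).2 h.symm

theorem scale_lin (w : ℂˣ) (v : Plane) :
    S.scale w (S.lin v) = S.lin (torus S.a S.b w v) := by
  have hX : ∀ i : Fin 3, S.scale w (Ideal.Quotient.mk S.I (MvPowerSeries.X i)) =
      S.scaleVec w i • Ideal.Quotient.mk S.I (MvPowerSeries.X i) := by
    intro i
    have : MvPowerSeries.rescale (S.scaleVec w) (MvPowerSeries.X i) =
        S.scaleVec w i • (MvPowerSeries.X i : MvPowerSeries (Fin 3) ℂ) := by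
      classical
      ext n
      simp only [MvPowerSeries.coeff_rescale, map_smul, smul_eq_mul, MvPowerSeries.coeff_X]
      split_ifs with h
      · subst h; simp
      · simp
    rw [scale_mk, this]
    rfl
  rw [lin, map_add, map_smul, map_smul, hX, hX, lin, smul_smul, smul_smul]
  simp [torus, scaleVec, mul_comm]

theorem scale_mem_brackets (w : ℂˣ) (p : P1) {F : S.OX} (hF : F ∈ S.brackets p) :
    S.scale w F ∈ S.brackets (actP S.a S.b w p) := by
  induction hF using Submodule.span_induction with
  | mem F hF =>
    obtain ⟨v, hv, f, rfl⟩ := hF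
    rw [scale_bracket, scale_lin]
    exact Submodule.smul_mem _ _ (Submodule.subset_span
      ⟨_, torus_mem_actP S.a S.b w p hv, _, rfl⟩)
  | zero => rw [map_zero]; exact Submodule.zero_mem _
  | add F G _ _ h1 h2 => rw [map_add]; exact Submodule.add_mem _ h1 h2
  | smul r F _ h => rw [map_smul]; exact Submodule.smul_mem _ _ h

variable {S}

/-- The topology of a subspace `W` of `ℂ[[x, y, z]] / (Q)`. -/
@[reducible] def topSub (W : Submodule ℂ S.OX) : TopologicalSpace W :=
  TopologicalSpace.induced Subtype.val S.topOX

/-- A `W`-valued function on `ℙ¹` is a regular section over `U` of the trivial pro-bundle with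
fibre `W`: its composites with all continuous linear functionals on `W` are regular on `U`. -/
def IsRegularTrivial (W : Submodule ℂ S.OX) (U : Set P1) (g : P1 → W) : Prop :=
  ∀ l : W →ₗ[ℂ] ℂ, Continuous[topSub W, ⊥] l →
    IsRegularOfDegree 0 U (fun v => l (g (Projectivization.mk' ℂ v)))

/-- The pro-bundle `Y` with fibre `W / {αx + βy, ℂ[[x, y, z]] / (Q)}` over `[α : β]`, where `W`
is a graded complement to `⟨x, y⟩`, as a quotient of the trivial pro-bundle with fibre `W`:
the fibres have the quotient topology and the action induced from `W`, and the regular sections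
are those that lift locally to regular sections of the trivial pro-bundle. -/
def Y (W : Submodule ℂ S.OX) (hW : S.IsGradedComplement W) : EquivFamily S.a S.b where
  Fiber p := W ⧸ (S.brackets p).submoduleOf W
  topology p := TopologicalSpace.coinduced (Submodule.mkQ ((S.brackets p).submoduleOf W))
    (topSub W)
  act w p := Submodule.mapQ _ _
    ((S.scale w).toLinearMap.restrict (p := W) (q := W) (hW.scale_mem w))
    (fun _ hF => S.scale_mem_brackets w p hF)
  IsRegular U s := ∀ p ∈ U, ∃ U' : Set P1, IsZariskiOpen U' ∧ p ∈ U' ∧ U' ⊆ U ∧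
    ∃ g : P1 → W, IsRegularTrivial W U' g ∧ ∀ p' ∈ U', s p' = Submodule.Quotient.mk (g p')

/-- The pro-bundle `Y ⊕ 𝒪(0)_a ⊕ 𝒪(0)_b`. -/
def Ytilde (W : Submodule ℂ S.OX) (hW : S.IsGradedComplement W) : EquivFamily S.a S.b :=
  ((Y W hW).sum (lineBundle S.a S.b 0 S.a)).sum (lineBundle S.a S.b 0 S.b)

variable (S)

/-- The power series expansion of
`(1 - t^(d-a)) (1 - t^(d-b)) (1 - t^(d-c)) / ((1 - t^a) (1 - t^b) (1 - t^c) (1 - t^(d-a) s))`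
with `t = X 0` and `s = X 1`. -/
def characterSeries : MvPowerSeries (Fin 2) ℚ :=
  let t : MvPowerSeries (Fin 2) ℚ := MvPowerSeries.X 0
  let s : MvPowerSeries (Fin 2) ℚ := MvPowerSeries.X 1
  ((1 - t ^ (S.d - S.a)) * (1 - t ^ (S.d - S.b)) * (1 - t ^ (S.d - S.c))) *
    ((1 - t ^ S.a) * (1 - t ^ S.b) * (1 - t ^ S.c) * (1 - t ^ (S.d - S.a) * s))⁻¹

end QHSurface

end

/-! Write R = ℂ[[x,y,z]], let ∫ be the antiderivative in z that vanishes on z = 0, and set A f = Q_x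
f - Q_z ∂_x∫f and B f = Q_y f - Q_z ∂_y∫f (`crossOp`). Brackets lie in the complement W, so adding
𝒪(0)_a ⊕ 𝒪(0)_b to Y restores V, and the fibre of `Ytilde` over [α:β] is 𝒪/{αx+βy, 𝒪}. Splitting g
into ∫g_z and g(x,y,0) gives {αx+βy, g} = (βA - αB) g_z + Q_z c, where g_z and the series c in x, y
are arbitrary (`bracketPS_linear`, `exists_pderiv_sub_eq`). So the fibre is R modulo (βA - αB)R +
Q_z ℂ[[x,y]] + QR.

The operators A and B commute (`crossOp_comm`). Let e_j be homogeneous representatives of a basis of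
the Jacobian ring. The heart of the proof is that the elements A^r B^s e_j, Q_z x^i y^j and Q x^i
y^j z^k form a topological basis of R. They span by induction on the weight
(`weightHom_le_vecSpan`): modulo the e_j an element is Q_x g + Q_y g' + Q_z g'', the first two terms
are A g and B g' up to multiples of Q_z, and Euler's formula treats the elements Q_z∫f. Since A and
B need not preserve QR, the induction runs over all deformed families Qf + nQ_z∫f at once; A and B
lower n by one (`crossOp_mul_add`). Independence is a count: the Jacobian ring is a complete
intersection, so the weights of the family have the generating function of all monomials
(`card_basisWeight`).

Modulo the image of βA - αB, the element A^r B^s e_j equals α^r β^s C^(r+s) e_j, where C = l₀A + l₁B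
with l₀α + l₁β = 1. Hence the functionals ∑_{r+s=k} α^r β^s L_{rsj}, where L are the coordinates in
the basis, vanish jointly exactly on the brackets (`mem_brackets_iff`). They have degree k in (α, β)
and weight k(d - a) + |e_j| at [1:0], which identifies `Ytilde` with the product of the bundles 𝒪(k)
of these weights; the character is the Hilbert series of the Jacobian ring divided by 1 - t^(d-a) s.

The multiplicities are intrinsic: the vectors of weight n over [1:0] that extend to global sections
of the twist by 𝒪(-m) form a space with one coordinate for every factor 𝒪(p)_n with p ≥ m
(`exists_equiv_of_iso`). The complement W is constructed from d > b + c; if d ≤ b + c, explicit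
coordinate changes show that X is of type A (`isKleinianA_of_degree_le`). -/

noncomputable section

/-! ### Singular points, elementary automorphisms and the normal form of type A. -/

namespace MvPolynomial

/-- The points of the hypersurface `Q = 0` in affine three-space at which it is singular. -/
def singularPoints (Q : MvPolynomial (Fin 3) ℂ) : Set (Fin 3 → ℂ) :=
  {p | eval p Q = 0 ∧ ∀ i, eval p (pderiv i Q) = 0}

theorem mem_singularPoints_mul {p : Fin 3 → ℂ} {f g : MvPolynomial (Fin 3) ℂ}
    (hf : eval p f = 0) (hg : eval p g = 0) : p ∈ singularPoints (f * g) := by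
  refine ⟨by simp [hf], fun i => ?_⟩
  simp [Derivation.leibniz, hf, hg]

theorem mem_singularPoints_add {p : Fin 3 → ℂ} {f g : MvPolynomial (Fin 3) ℂ}
    (hf : p ∈ singularPoints f) (hg : p ∈ singularPoints g) : p ∈ singularPoints (f + g) :=
  ⟨by simp [hf.1, hg.1], fun i => by simp [hf.2 i, hg.2 i]⟩

theorem mem_singularPoints_zero (p : Fin 3 → ℂ) : p ∈ singularPoints 0 := by
  simp [singularPoints]

theorem mem_singularPoints_of_support {p : Fin 3 → ℂ} {Q : MvPolynomial (Fin 3) ℂ}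
    (h : ∀ n ∈ Q.support, p ∈ singularPoints (monomial n (coeff n Q))) :
    p ∈ singularPoints Q := by
  rw [Q.as_sum]
  exact Finset.sum_induction _ (fun f => p ∈ singularPoints f)
    (fun _ _ => mem_singularPoints_add) (mem_singularPoints_zero p) h

/-- Monomials divisible by a product of two of the first two variables are singular along the
third axis. -/
theorem axis_mem_singularPoints_monomial {n : Fin 3 →₀ ℕ} (h : 2 ≤ n 0 + n 1) (r : ℂ) :
    ![0, 0, 1] ∈ singularPoints (monomial n r) := by
  have key : ∃ i j : Fin 3, i ≠ 2 ∧ j ≠ 2 ∧ Finsupp.single i 1 + Finsupp.single j 1 ≤ n := by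
    by_cases h0 : n 0 = 0
    · refine ⟨1, 1, by decide, by decide, fun k => ?_⟩
      fin_cases k <;> simp <;> omega
    · by_cases h1 : n 1 = 0
      · refine ⟨0, 0, by decide, by decide, fun k => ?_⟩
        fin_cases k <;> simp <;> omega
      · refine ⟨0, 1, by decide, by decide, fun k => ?_⟩
        fin_cases k <;> simp <;> omega
  obtain ⟨i, j, hi, hj, hn⟩ := key
  obtain ⟨m, rfl⟩ := exists_add_of_le hn
  have : monomial (Finsupp.single i 1 + Finsupp.single j 1 + m) r =
      X i * (X j * monomial m r : MvPolynomial (Fin 3) ℂ) := by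
    rw [X, X, monomial_mul, monomial_mul, one_mul, one_mul, add_assoc]
  rw [this]
  have h2 : ∀ i : Fin 3, i ≠ 2 → (![0, 0, 1] : Fin 3 → ℂ) i = 0 := by
    intro i hi; fin_cases i <;> simp_all
  exact mem_singularPoints_mul (by simp [h2 i hi]) (by simp [h2 j hj])

theorem coeff_eq_zero_of_zero_mem_singularPoints {Q : MvPolynomial (Fin 3) ℂ}
    (h : (0 : Fin 3 → ℂ) ∈ singularPoints Q) {n : Fin 3 →₀ ℕ} (hn : n 0 + n 1 + n 2 ≤ 1) :
    coeff n Q = 0 := by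
  have key : n = 0 ∨ ∃ i : Fin 3, n = Finsupp.single i 1 := by
    by_cases h0 : n 0 = 1
    · right; refine ⟨0, ?_⟩; ext k; fin_cases k <;> simp <;> omega
    · by_cases h1 : n 1 = 1
      · right; refine ⟨1, ?_⟩; ext k; fin_cases k <;> simp <;> omega
      · by_cases h2 : n 2 = 1
        · right; refine ⟨2, ?_⟩; ext k; fin_cases k <;> simp <;> omega
        · left; ext k; fin_cases k <;> simp <;> omega
  have h0 : ∀ f : MvPolynomial (Fin 3) ℂ, eval (0 : Fin 3 → ℂ) f = coeff 0 f := fun f => by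
    rw [← constantCoeff_eq, ← eval_zero]
  obtain rfl | ⟨i, rfl⟩ := key
  · rw [← h0]; exact h.1
  · have := h.2 i
    rw [h0, coeff_pderiv] at this
    simpa using this

/-- The automorphism that maps the variable `X i` to `u * X i + p`, where `p` does not involve
`X i`, and fixes the other variables. -/
def elementaryAut (i : Fin 3) (u : ℂ) (hu : u ≠ 0) (p : MvPolynomial (Fin 3) ℂ)
    (hp : ∀ q, aeval (Function.update X i q) p = p) :
    MvPolynomial (Fin 3) ℂ ≃ₐ[ℂ] MvPolynomial (Fin 3) ℂ :=
  have hC : C u * C u⁻¹ = (1 : MvPolynomial (Fin 3) ℂ) := by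
    rw [← C_mul, mul_inv_cancel₀ hu, C_1]
  AlgEquiv.ofAlgHom (aeval (Function.update X i (C u * X i + p)))
    (aeval (Function.update X i (C u⁻¹ * (X i - p))))
    (by
      ext1 j
      by_cases h : j = i
      · subst h
        simp only [AlgHom.comp_apply, aeval_X, Function.update_self, map_mul, map_sub, hp,
          algHom_C, algebraMap_eq, AlgHom.id_apply]
        linear_combination X j * hC
      · simp [Function.update_of_ne h])
    (by
      ext1 j
      by_cases h : j = i
      · subst h
        simp only [AlgHom.comp_apply, aeval_X, Function.update_self, map_mul, map_add, hp,
          algHom_C, algebraMap_eq, AlgHom.id_apply]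
        linear_combination (X j - p) * hC
      · simp [Function.update_of_ne h])

theorem elementaryAut_X_self (i : Fin 3) (u : ℂ) (hu : u ≠ 0) (p : MvPolynomial (Fin 3) ℂ)
    (hp : ∀ q, aeval (Function.update X i q) p = p) :
    elementaryAut i u hu p hp (X i) = C u * X i + p := by
  simp [elementaryAut]

theorem elementaryAut_apply_of_ne (i : Fin 3) (u : ℂ) (hu : u ≠ 0) (p : MvPolynomial (Fin 3) ℂ)
    (hp : ∀ q, aeval (Function.update X i q) p = p) {j : Fin 3} (h : j ≠ i) :
    elementaryAut i u hu p hp (X j) = X j := by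
  simp [elementaryAut, Function.update_of_ne h]

/-- Polynomials in the first two of three variables. -/
def inclXY : MvPolynomial (Fin 2) ℂ →ₐ[ℂ] MvPolynomial (Fin 3) ℂ := aeval ![X 0, X 1]

theorem aeval_update_inclXY (f : MvPolynomial (Fin 2) ℂ) (q : MvPolynomial (Fin 3) ℂ) :
    aeval (Function.update X 2 q) (inclXY f) = inclXY f := by
  rw [inclXY, ← AlgHom.comp_apply]
  congr 1
  ext1 j
  fin_cases j <;> simp

/-- The automorphism from `y z + β x ^ m` to `x ^ m + y ^ 2 + z ^ 2`. -/
def diagonalAut (δ : ℂ) (hδ : δ ≠ 0) :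
    MvPolynomial (Fin 3) ℂ ≃ₐ[ℂ] MvPolynomial (Fin 3) ℂ :=
  have hC : C δ * C δ⁻¹ = (1 : MvPolynomial (Fin 3) ℂ) := by
    rw [← C_mul, mul_inv_cancel₀ hδ, C_1]
  have hI : C Complex.I * C Complex.I = (-1 : MvPolynomial (Fin 3) ℂ) := by
    rw [← C_mul, Complex.I_mul_I]; simp
  have h2 : C (1 / 2) + C (1 / 2) = (1 : MvPolynomial (Fin 3) ℂ) := by
    rw [← C_add]; norm_num
  AlgEquiv.ofAlgHom (aeval ![C δ * X 0, X 1 + C Complex.I * X 2, X 1 - C Complex.I * X 2])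
    (aeval ![C δ⁻¹ * X 0, C (1 / 2) * (X 1 + X 2), C (1 / 2) * C Complex.I * (X 2 - X 1)])
    (by
      ext1 j
      fin_cases j
      · simp only [AlgHom.comp_apply, aeval_X, map_mul, algHom_C, algebraMap_eq,
          AlgHom.id_apply, Fin.zero_eta, Matrix.cons_val_zero]
        linear_combination X 0 * hC
      · simp only [AlgHom.comp_apply, aeval_X, map_mul, map_add, algHom_C, algebraMap_eq,
          AlgHom.id_apply, Fin.mk_one, Matrix.cons_val_one, Matrix.cons_val_zero, Matrix.cons_val]
        linear_combination X 1 * h2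
      · simp only [AlgHom.comp_apply, aeval_X, map_mul, map_sub, algHom_C, algebraMap_eq,
          AlgHom.id_apply, Fin.reduceFinMk, Matrix.cons_val_one, Matrix.cons_val]
        linear_combination (-2 * C (1 / 2) * X 2) * hI + X 2 * h2)
    (by
      ext1 j
      fin_cases j
      · simp only [AlgHom.comp_apply, aeval_X, map_mul, algHom_C, algebraMap_eq,
          AlgHom.id_apply, Fin.zero_eta, Matrix.cons_val_zero]
        linear_combination X 0 * hC
      · simp only [AlgHom.comp_apply, aeval_X, map_mul, map_add, algHom_C, algebraMap_eq,
          AlgHom.id_apply, Fin.mk_one, Matrix.cons_val_one, Matrix.cons_val]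
        linear_combination (C (1 / 2) * (X 2 - X 1)) * hI + X 1 * h2
      · simp only [AlgHom.comp_apply, aeval_X, map_mul, map_sub, algHom_C, algebraMap_eq,
          AlgHom.id_apply, Fin.reduceFinMk, Matrix.cons_val_one, Matrix.cons_val]
        linear_combination (-C (1 / 2) * (X 2 - X 1)) * hI + X 2 * h2)

/-- The surface `Q = 0` is isomorphic to a surface `x ^ m + y ^ 2 + z ^ 2 = 0`. -/
def IsKleinianA (Q : MvPolynomial (Fin 3) ℂ) : Prop :=
  ∃ m : ℕ, 2 ≤ m ∧ Nonempty
    ((MvPolynomial (Fin 3) ℂ ⧸ Ideal.span {Q}) ≃ₐ[ℂ]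
      (MvPolynomial (Fin 3) ℂ ⧸ Ideal.span
        {(X 0 ^ m + X 1 ^ 2 + X 2 ^ 2 : MvPolynomial (Fin 3) ℂ)}))

/-- The isomorphism of quotients by principal ideals induced by an automorphism. -/
def quotientSpanEquiv (e : MvPolynomial (Fin 3) ℂ ≃ₐ[ℂ] MvPolynomial (Fin 3) ℂ)
    {f g : MvPolynomial (Fin 3) ℂ} (h : e f = g) :
    (MvPolynomial (Fin 3) ℂ ⧸ Ideal.span {f}) ≃ₐ[ℂ] (MvPolynomial (Fin 3) ℂ ⧸ Ideal.span {g}) :=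
  Ideal.quotientEquivAlg _ _ e (by
    rw [Ideal.map_span, Set.image_singleton, ← h]; rfl)

theorem IsKleinianA.of_aut (e : MvPolynomial (Fin 3) ℂ ≃ₐ[ℂ] MvPolynomial (Fin 3) ℂ)
    {f g : MvPolynomial (Fin 3) ℂ} (h : e f = g) (hg : IsKleinianA g) : IsKleinianA f := by
  obtain ⟨m, hm, ⟨φ⟩⟩ := hg
  exact ⟨m, hm, ⟨(quotientSpanEquiv e h).trans φ⟩⟩

/-- Scaling x by an m-th root of β⁻¹ removes the coefficient, and replacing y, z by y + iz, y - iz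
turns the product into a sum of two squares; e is undone beforehand. -/
theorem isKleinianA_of_aut_product (e : MvPolynomial (Fin 3) ℂ ≃ₐ[ℂ] MvPolynomial (Fin 3) ℂ)
    {β : ℂ} (hβ : β ≠ 0) {m : ℕ} (hm : 2 ≤ m) :
    IsKleinianA (e (X 1 * X 2 + C β * X 0 ^ m)) := by
  obtain ⟨δ, hδ⟩ := IsAlgClosed.exists_pow_nat_eq β⁻¹ (n := m) (by omega)
  have hδ0 : δ ≠ 0 := by
    rintro rfl
    rw [zero_pow (by omega)] at hδ
    exact inv_ne_zero hβ hδ.symm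
  refine IsKleinianA.of_aut (e.symm.trans (diagonalAut δ hδ0)) (g := X 0 ^ m + X 1 ^ 2 + X 2 ^ 2) ?_
    ⟨m, hm, ⟨AlgEquiv.refl⟩⟩
  have hI : C Complex.I * C Complex.I = (-1 : MvPolynomial (Fin 3) ℂ) := by
    rw [← C_mul, Complex.I_mul_I]; simp
  have hC : C β * C δ ^ m = (1 : MvPolynomial (Fin 3) ℂ) := by
    rw [← C_pow, hδ, ← C_mul, mul_inv_cancel₀ hβ, C_1]
  simp only [AlgEquiv.trans_apply, AlgEquiv.symm_apply_apply]
  simp only [diagonalAut, AlgEquiv.ofAlgHom_apply, map_add, map_mul, map_pow, aeval_X, algHom_C,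
    algebraMap_eq, Matrix.cons_val_zero, Matrix.cons_val_one, Matrix.cons_val, mul_pow]
  linear_combination (-X 2 ^ 2) * hI + X 0 ^ m * hC

end MvPolynomial

/-! ### Degree at most b + c: equations of degree at most one in z. -/

namespace MvPolynomial

theorem weight_fin_three (a b c : ℕ) (n : Fin 3 →₀ ℕ) :
    Finsupp.weight ![a, b, c] n = n 0 * a + n 1 * b + n 2 * c := by
  rw [Finsupp.weight_apply, Finsupp.sum_fintype _ _ (by simp)]
  simp [Fin.sum_univ_three]

theorem monomial_eq_mul_pow (n : Fin 3 →₀ ℕ) (r : ℂ) :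
    monomial n r = C r * X 0 ^ n 0 * X 1 ^ n 1 * X 2 ^ n 2 := by
  rw [monomial_eq, Finsupp.prod_fintype _ _ (by simp), Fin.prod_univ_three]
  ring

theorem exists_sum_decomposition {P : MvPolynomial (Fin 3) ℂ → Prop} (h0 : P 0)
    (hadd : ∀ f g, P f → P g → P (f + g)) (s : Finset (Fin 3 →₀ ℕ)) (Q : MvPolynomial (Fin 3) ℂ)
    (h : ∀ n ∈ s, P (monomial n (coeff n Q))) : P (∑ n ∈ s, monomial n (coeff n Q)) :=
  Finset.sum_induction _ P hadd h0 h

/-- A polynomial `ℓ z + q(x, y)` is of type `A` if an automorphism of the plane maps `x, y` to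
`κ, ℓ` and `q` is congruent to a multiple of `κ ^ m` modulo `ℓ`. -/
theorem isKleinianA_of_congruence {Q : MvPolynomial (Fin 3) ℂ} (hs : singularPoints Q = {0})
    {κ ℓ f : MvPolynomial (Fin 2) ℂ} {β : ℂ} {m : ℕ} (hm : β ≠ 0 → 2 ≤ m)
    (hQ : Q = X 2 * inclXY ℓ + (inclXY ℓ * inclXY f + C β * inclXY κ ^ m))
    (e : MvPolynomial (Fin 3) ℂ ≃ₐ[ℂ] MvPolynomial (Fin 3) ℂ) (h0 : e (X 0) = inclXY κ)
    (h1 : e (X 1) = inclXY ℓ) (h2 : e (X 2) = X 2) (v : Fin 2 → ℂ) (hv : v ≠ 0)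
    (hvl : eval v ℓ = 0) : IsKleinianA Q := by
  have hev : ∀ (t : ℂ) (g : MvPolynomial (Fin 2) ℂ),
      eval ![v 0, v 1, t] (inclXY g) = eval v g := by
    intro t g
    rw [inclXY, ← coe_aeval_eq_eval, ← coe_aeval_eq_eval, RingHom.coe_coe, RingHom.coe_coe,
      ← AlgHom.comp_apply]
    congr 1
    ext1 j
    fin_cases j <;> simp
  -- For β = 0 the equation is the product ℓ(z + f), singular wherever both factors vanish. The zero
  -- v of ℓ together with z = -f(v) is such a point, and it is not the origin.
  have hβ : β ≠ 0 := by
    rintro rfl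
    have hQ' : Q = inclXY ℓ * (X 2 + inclXY f) := by
      rw [hQ, C_0]; ring
    have : ![v 0, v 1, - eval v f] ∈ singularPoints Q := by
      rw [hQ']
      exact mem_singularPoints_mul (by rw [hev, hvl]) (by rw [map_add, hev]; simp)
    rw [hs, Set.mem_singleton_iff] at this
    apply hv
    ext j
    fin_cases j
    · simpa using congrFun this 0
    · simpa using congrFun this 1
  have hfix := aeval_update_inclXY f
  -- The substitution z ↦ z + f absorbs the part of q divisible by ℓ: yz + βx^m goes to ℓz + βκ^m
  -- under e and then to ℓ(z + f) + βκ^m.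
  set e2 := elementaryAut 2 1 one_ne_zero (inclXY f) hfix with he2
  have hincl : ∀ g, e2 (inclXY g) = inclXY g := fun g => by
    rw [he2, elementaryAut, AlgEquiv.ofAlgHom_apply, aeval_update_inclXY]
  have hQ' : Q = (e.trans e2) (X 1 * X 2 + C β * X 0 ^ m) := by
    simp only [AlgEquiv.trans_apply, map_add, map_mul, map_pow, h0, h1, h2, hincl]
    rw [he2, elementaryAut_X_self, hQ]
    have hC : ∀ (φ : MvPolynomial (Fin 3) ℂ ≃ₐ[ℂ] MvPolynomial (Fin 3) ℂ), φ (C β) = C β :=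
      fun φ => φ.commutes β
    rw [hC, hC, C_1]
    ring
  rw [hQ']
  exact isKleinianA_of_aut_product _ hβ (hm hβ)

/-- Congruence to a multiple of κ^m modulo ℓ is additive and may be tested on monomials. The
proposition p is a side condition attached to a nonzero multiple; it survives addition because a sum
of coefficients is nonzero only if one of them is. -/
theorem congruence_of_support {Q0 : MvPolynomial (Fin 3) ℂ} {κ ℓ : MvPolynomial (Fin 2) ℂ}
    {m : ℕ} {p : Prop} (s : Finset (Fin 3 →₀ ℕ)) (hs : Q0 = ∑ n ∈ s, monomial n (coeff n Q0))
    (h : ∀ n ∈ s, ∃ (f : MvPolynomial (Fin 2) ℂ) (β : ℂ), (β ≠ 0 → p) ∧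
      (X 0 ^ n 0 * X 1 ^ n 1 * X 2 ^ n 2 : MvPolynomial (Fin 3) ℂ) =
        inclXY ℓ * inclXY f + C β * inclXY κ ^ m) :
    ∃ (f : MvPolynomial (Fin 2) ℂ) (β : ℂ), (β ≠ 0 → p) ∧
      Q0 = inclXY ℓ * inclXY f + C β * inclXY κ ^ m := by
  rw [hs]
  refine exists_sum_decomposition (P := fun q => ∃ (f : MvPolynomial (Fin 2) ℂ) (β : ℂ),
    (β ≠ 0 → p) ∧ q = inclXY ℓ * inclXY f + C β * inclXY κ ^ m) ?_ ?_ _ _ ?_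
  · exact ⟨0, 0, by simp, by simp⟩
  · rintro _ _ ⟨f, β, hβ, rfl⟩ ⟨g, γ, hγ, rfl⟩
    refine ⟨f + g, β + γ, fun h => ?_, by rw [map_add, C_add]; ring⟩
    by_cases h' : β = 0
    · exact hγ (by rintro rfl; simp [h'] at h)
    · exact hβ h'
  · intro n hn
    obtain ⟨f, β, hβ, e⟩ := h n hn
    refine ⟨C (coeff n Q0) * f, coeff n Q0 * β, fun h => hβ (right_ne_zero_of_mul h), ?_⟩
    rw [monomial_eq_mul_pow]
    have hC : inclXY (C (coeff n Q0)) = C (coeff n Q0) := inclXY.commutes _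
    rw [map_mul, hC, C_mul]
    linear_combination C (coeff n Q0) * e

/-- Here Q = zℓ + q with ℓ, q in x, y, and ℓ has weight d - c ≤ b. An isolated singularity forces ℓ
to have a linear term, so ℓ is a multiple of x or has the form ηy + γx^(b/a) with η ≠ 0. In both
cases ℂ[x,y]/ℓ is a polynomial ring in one variable κ, and by homogeneity q becomes a multiple of a
power of κ. -/
theorem isKleinianA_of_le_one {a b c d : ℕ} (ha : 0 < a) (hab : a ≤ b) (hbc : b ≤ c)
    {Q : MvPolynomial (Fin 3) ℂ} (hQ : Q.IsWeightedHomogeneous ![a, b, c] d) (hd : d ≤ b + c)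
    (hs : singularPoints Q = {0}) (h1 : ∀ n ∈ Q.support, n 2 ≤ 1) : IsKleinianA Q := by
  classical
  have hw : ∀ n ∈ Q.support, n 0 * a + n 1 * b + n 2 * c = d := fun n hn => by
    rw [← weight_fin_three]; exact hQ (mem_support_iff.1 hn)
  have hlow : ∀ n ∈ Q.support, 2 ≤ n 0 + n 1 + n 2 := by
    intro n hn
    by_contra h
    exact mem_support_iff.1 hn (coeff_eq_zero_of_zero_mem_singularPoints (hs ▸ rfl) (by omega))
  set S1 := Q.support.filter (fun n => n 2 = 1) with hS1
  set S0 := Q.support.filter (fun n => ¬ n 2 = 1) with hS0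
  set Q1 := ∑ n ∈ S1, monomial n (coeff n Q) with hQ1
  set Q0 := ∑ n ∈ S0, monomial n (coeff n Q) with hQ0
  have hsum : Q = Q1 + Q0 := by
    conv_lhs => rw [Q.as_sum]
    rw [hQ1, hQ0, hS1, hS0, Finset.sum_filter_add_sum_filter_not]
  have hcoeff0 : ∀ n ∈ S0, coeff n Q0 = coeff n Q := by
    intro n hn
    rw [hQ0, coeff_sum]
    simp only [coeff_monomial]
    rw [Finset.sum_ite_eq' S0 n, if_pos hn]
  have hQ0' : Q0 = ∑ n ∈ S0, monomial n (coeff n Q0) := by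
    conv_lhs => rw [hQ0]
    exact Finset.sum_congr rfl fun n hn => by rw [hcoeff0 n hn]
  have hcoeff1 : ∀ n, n 2 = 1 → coeff n Q1 = coeff n Q := by
    intro n hn
    rw [hQ1, coeff_sum]
    simp only [coeff_monomial]
    rw [Finset.sum_ite_eq' S1 n]
    split_ifs with h
    · rfl
    · by_contra h'
      exact h (Finset.mem_filter.2 ⟨mem_support_iff.2 fun h => h' h.symm, hn⟩)
  have hmem0 : ∀ n ∈ S0, n ∈ Q.support ∧ n 2 = 0 := fun n hn => by
    obtain ⟨h2, h3⟩ := Finset.mem_filter.1 hn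
    exact ⟨h2, by have := h1 n h2; omega⟩
  have hmem1 : ∀ n ∈ S1, n ∈ Q.support ∧ n 2 = 1 := fun n hn => Finset.mem_filter.1 hn
  by_cases hyz : coeff (Finsupp.single 1 1 + Finsupp.single 2 1) Q = 0
  · by_cases hxz : coeff (Finsupp.single 0 1 + Finsupp.single 2 1) Q = 0
    · exfalso
      -- Every monomial has total degree at least 2 and z-degree at most 1. With xz and yz absent it
      -- has degree at least 2 in x, y, so the whole z-axis would be singular.
      have : ![0, 0, 1] ∈ singularPoints Q := by
        refine mem_singularPoints_of_support fun n hn =>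
          axis_mem_singularPoints_monomial ?_ _
        have h2 := hlow n hn
        have h3 := h1 n hn
        by_contra h4
        have h5 : n 2 = 1 := by omega
        have h6 : n 0 + n 1 = 1 := by omega
        apply mem_support_iff.1 hn
        by_cases h7 : n 0 = 1
        · rw [← hxz]; congr 1; ext k; fin_cases k <;> simp <;> omega
        · rw [← hyz]; congr 1; ext k; fin_cases k <;> simp <;> omega
      rw [hs, Set.mem_singleton_iff] at this
      simpa using congrFun this 2
    · have hdac : a + c = d := by
        have := hw _ (mem_support_iff.2 hxz)
        simpa using this
      have hS1' : ∀ n ∈ S1, n = Finsupp.single 0 1 + Finsupp.single 2 1 := by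
        intro n hn
        obtain ⟨h2, h3⟩ := hmem1 n hn
        have h4 := hw n h2
        rw [h3] at h4
        have h5 : n 0 = 1 ∧ n 1 = 0 := by
          rcases Nat.eq_zero_or_pos (n 1) with h6 | h6
          · rw [h6] at h4
            exact ⟨Nat.eq_of_mul_eq_mul_right ha (by omega), h6⟩
          · exfalso
            have h7 : n 1 = 1 := by
              by_contra h8
              have : 2 * b ≤ n 1 * b := Nat.mul_le_mul_right _ (by omega)
              omega
            have h8 : n 0 = 0 := by
              by_contra h8
              have : 1 * a ≤ n 0 * a := Nat.mul_le_mul_right _ (by omega)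
              rw [h7] at h4
              omega
            apply mem_support_iff.1 h2
            rw [← hyz]; congr 1; ext k; fin_cases k <;> simp <;> omega
        ext k; fin_cases k <;> simp <;> omega
      obtain ⟨ξ, hξ0, hξ⟩ : ∃ ξ : ℂ, ξ ≠ 0 ∧ Q1 = X 2 * (C ξ * X 0) := by
        refine ⟨_, hxz, ?_⟩
        have : S1 = {Finsupp.single 0 1 + Finsupp.single 2 1} := by
          ext n
          rw [Finset.mem_singleton]
          refine ⟨hS1' n, ?_⟩
          rintro rfl
          exact Finset.mem_filter.2 ⟨mem_support_iff.2 hxz, by simp⟩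
        rw [hQ1, this, Finset.sum_singleton, monomial_eq_mul_pow]
        simp
        ring
      have hξi : inclXY (C ξ⁻¹) * C ξ = 1 := by
        change inclXY (algebraMap _ _ ξ⁻¹) * C ξ = 1
        rw [inclXY.commutes, algebraMap_eq, ← C_mul, inv_mul_cancel₀ hξ0, C_1]
      have hξc : inclXY (C ξ) = C ξ := inclXY.commutes _
      -- Modulo x only a pure power of y survives, with exponent d/b. The side condition that b
      -- divides d is what later gives an exponent of at least 2, since d = a + c > b.
      obtain ⟨f, β, hβ, hf⟩ := congruence_of_support (κ := X 1) (ℓ := C ξ * X 0) (m := d / b)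
        (p := d / b * b = d) S0 hQ0' (by
          intro n hn
          obtain ⟨h2, h3⟩ := hmem0 n hn
          have h4 := hw n h2
          rw [h3]
          rcases Nat.eq_zero_or_pos (n 0) with h5 | h5
          · have h6 : d / b = n 1 := by
              rw [← h4, h3, h5]
              simp [Nat.mul_div_cancel _ (lt_of_lt_of_le ha hab)]
            refine ⟨0, 1, fun _ => ?_, ?_⟩
            · rw [h6, ← h4, h3, h5]; simp
            · rw [h5, h6]; simp [inclXY]
          · refine ⟨C ξ⁻¹ * X 0 ^ (n 0 - 1) * X 1 ^ n 1, 0, by simp, ?_⟩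
            obtain ⟨k, hk⟩ : ∃ k, n 0 = k + 1 := ⟨n 0 - 1, by omega⟩
            rw [hk, Nat.add_sub_cancel]
            simp only [map_mul, map_pow, hξc]
            have hX : inclXY (X 0) = X 0 ∧ inclXY (X 1) = X 1 := by simp [inclXY]
            rw [hX.1, hX.2]
            rw [C_0]
            linear_combination (- X 0 ^ (k + 1) * X 1 ^ n 1) * hξi)
      refine isKleinianA_of_congruence hs (κ := X 1) (ℓ := C ξ * X 0) (f := f) (β := β)
        (m := d / b) (fun h => ?_) (by rw [hsum, hξ, hf]; simp [inclXY, algebraMap_eq])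
        ((renameEquiv ℂ (Equiv.swap 0 1)).trans
          (elementaryAut 0 ξ hξ0 0 (fun q => map_zero _))) ?_ ?_ ?_ ![0, 1] ?_ (by simp)
      · have h2 := hβ h
        by_contra h3
        have h4 : d / b * b ≤ 1 * b := Nat.mul_le_mul_right _ (by omega)
        omega
      · simp [elementaryAut_apply_of_ne, inclXY]
      · simp [elementaryAut_X_self, inclXY]
      · rw [AlgEquiv.trans_apply, renameEquiv_apply, rename_X, Equiv.swap_apply_of_ne_of_ne
          (by decide) (by decide), elementaryAut_apply_of_ne _ _ _ _ _ (by decide)]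
      · intro h; simpa using congrFun h 1
  · have hdbc : b + c = d := by
      have := hw _ (mem_support_iff.2 hyz)
      simpa using this
    have hS1' : ∀ n ∈ S1, n = Finsupp.single 1 1 + Finsupp.single 2 1 ∨
        (b / a * a = b ∧ n = Finsupp.single 0 (b / a) + Finsupp.single 2 1) := by
      intro n hn
      obtain ⟨h2, h3⟩ := hmem1 n hn
      have h4 := hw n h2
      rw [h3] at h4
      rcases Nat.eq_zero_or_pos (n 1) with h6 | h6
      · right
        rw [h6] at h4
        have h7 : n 0 * a = b := by omega
        have h8 : b / a = n 0 := by rw [← h7, Nat.mul_div_cancel _ ha]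
        refine ⟨by rw [h8, h7], ?_⟩
        rw [h8]
        ext k; fin_cases k <;> simp <;> omega
      · left
        have h7 : n 1 = 1 := by
          by_contra h8
          have : 2 * b ≤ n 1 * b := Nat.mul_le_mul_right _ (by omega)
          omega
        have h8 : n 0 = 0 := by
          by_contra h8
          have : 1 * a ≤ n 0 * a := Nat.mul_le_mul_right _ (by omega)
          rw [h7] at h4
          omega
        ext k; fin_cases k <;> simp <;> omega
    obtain ⟨η, γ, hγ, hηγ⟩ : ∃ η γ : ℂ, (γ ≠ 0 → b / a * a = b) ∧
        Q1 = X 2 * (C η * X 1 + C γ * X 0 ^ (b / a)) := by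
      refine exists_sum_decomposition (P := fun q => ∃ η γ : ℂ, (γ ≠ 0 → b / a * a = b) ∧
        q = X 2 * (C η * X 1 + C γ * X 0 ^ (b / a))) ?_ ?_ _ _ ?_
      · exact ⟨0, 0, by simp, by simp⟩
      · rintro _ _ ⟨f, β, hβ, rfl⟩ ⟨g, γ, hγ, rfl⟩
        refine ⟨f + g, β + γ, fun h => ?_, by rw [C_add, C_add]; ring⟩
        by_cases h' : β = 0
        · exact hγ (by rintro rfl; simp [h'] at h)
        · exact hβ h'
      · intro n hn
        rcases hS1' n hn with h | ⟨h2, h⟩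
        · refine ⟨coeff n Q, 0, by simp, ?_⟩
          rw [monomial_eq_mul_pow, h]
          simp
          ring
        · refine ⟨0, coeff n Q, fun _ => h2, ?_⟩
          rw [monomial_eq_mul_pow, h]
          simp
          ring
    have hη0 : η ≠ 0 := by
      rintro rfl
      apply hyz
      rw [← hcoeff1 _ (by simp), hηγ, C_0, zero_mul, zero_add]
      have : (X 2 * (C γ * X 0 ^ (b / a)) : MvPolynomial (Fin 3) ℂ) =
          monomial (Finsupp.single 0 (b / a) + Finsupp.single 2 1) γ := by
        rw [monomial_eq_mul_pow]; simp; ring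
      rw [this, coeff_monomial, if_neg]
      intro h
      simpa using DFunLike.congr_fun h 1
    have hC : ∀ r, inclXY (C r) = C r := fun r => inclXY.commutes _
    have hX : inclXY (X 0) = X 0 ∧ inclXY (X 1) = X 1 := by simp [inclXY]
    have hηi : C η⁻¹ * C η = (1 : MvPolynomial (Fin 2) ℂ) := by
      rw [← C_mul, inv_mul_cancel₀ hη0, C_1]
    obtain ⟨f, β, -, hf⟩ := congruence_of_support (κ := X 0)
      (ℓ := C η * X 1 + C γ * X 0 ^ (b / a)) (m := d / a) (p := True) S0 hQ0' (by
        intro n hn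
        obtain ⟨h2, h3⟩ := hmem0 n hn
        have h4 := hw n h2
        rw [h3]
        -- Modulo ℓ the variable y is -(γ/η) x^(b/a), so y^n is congruent to the n-th power of that
        -- monomial.
        obtain ⟨h, hh⟩ := sub_dvd_pow_sub_pow (X 1 : MvPolynomial (Fin 2) ℂ)
          (-(C η⁻¹ * C γ * X 0 ^ (b / a))) (n 1)
        refine ⟨C η⁻¹ * h * X 0 ^ n 0, (-(η⁻¹ * γ)) ^ n 1, by simp, ?_⟩
        have key : X 0 ^ n 0 * (-(C η⁻¹ * C γ * X 0 ^ (b / a))) ^ n 1 =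
            (C ((-(η⁻¹ * γ)) ^ n 1) * X 0 ^ (d / a) : MvPolynomial (Fin 2) ℂ) := by
          by_cases hγ0 : γ = 0
          · rcases Nat.eq_zero_or_pos (n 1) with h5 | h5
            · have : d / a = n 0 := by
                rw [← h4, h3, h5]; simp [Nat.mul_div_cancel _ ha]
              rw [this, h5]; simp
            · rw [hγ0]; simp [zero_pow (by omega : n 1 ≠ 0)]
          · have h6 := hγ hγ0
            have : d / a = n 0 + b / a * n 1 := by
              rw [← h4, h3]
              conv_lhs => rw [← h6]
              rw [zero_mul, add_zero, show n 0 * a + n 1 * (b / a * a) =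
                (n 0 + b / a * n 1) * a by ring, Nat.mul_div_cancel _ ha]
            rw [this, C_pow, C_neg, C_mul, ← neg_mul, mul_pow, ← pow_mul, pow_add]
            ring
        have : (X 0 ^ n 0 * X 1 ^ n 1 : MvPolynomial (Fin 2) ℂ) =
            (C η * X 1 + C γ * X 0 ^ (b / a)) * (C η⁻¹ * h * X 0 ^ n 0) +
              C ((-(η⁻¹ * γ)) ^ n 1) * X 0 ^ (d / a) := by
          rw [← key]
          linear_combination X 0 ^ n 0 * hh - (X 1 * h * X 0 ^ n 0) * hηi
        have := congrArg inclXY this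
        generalize (-(η⁻¹ * γ)) ^ n 1 = θ at this ⊢
        simp only [map_add, map_mul, map_pow, hX.1, hX.2, hC] at this
        simp only [map_add, map_mul, map_pow, hX.1, hX.2, hC]
        rw [pow_zero, mul_one, this])
    refine isKleinianA_of_congruence hs (κ := X 0) (ℓ := C η * X 1 + C γ * X 0 ^ (b / a)) (f := f)
      (β := β) (m := d / a) (fun h => ?_) (by rw [hsum, hηγ, hf]; simp only [map_add, map_mul, map_pow, hX.1, hX.2, hC])
      (elementaryAut 1 η hη0 (C γ * X 0 ^ (b / a)) (by simp [algebraMap_eq])) ?_ ?_ ?_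
      ![1, - (η⁻¹ * γ)] ?_ ?_
    · rw [Nat.le_div_iff_mul_le ha]; omega
    · rw [elementaryAut_apply_of_ne _ _ _ _ _ (by decide), hX.1]
    · rw [elementaryAut_X_self]; simp only [map_add, map_mul, map_pow, hX.1, hX.2, hC]
    · rw [elementaryAut_apply_of_ne _ _ _ _ _ (by decide)]
    · intro h; simpa using congrFun h 0
    · simp; field_simp; ring

end MvPolynomial

/-! ### Degree at most b + c: reduction to degree at most one in z. -/

namespace MvPolynomial

theorem eval_aeval_fin_three (p : Fin 3 → ℂ) (g : Fin 3 → MvPolynomial (Fin 3) ℂ)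
    (Q : MvPolynomial (Fin 3) ℂ) :
    eval p (aeval g Q) = eval (fun i => eval p (g i)) Q := by
  induction Q using MvPolynomial.induction_on with
  | C r => simp [algebraMap_eq]
  | add f g hf hg => rw [map_add, map_add, hf, hg, map_add]
  | mul_X f k hf => rw [map_mul, map_mul, hf, aeval_X, map_mul, eval_X]

theorem pderiv_aeval_fin_three (i : Fin 3) (g : Fin 3 → MvPolynomial (Fin 3) ℂ)
    (Q : MvPolynomial (Fin 3) ℂ) :
    pderiv i (aeval g Q) = ∑ j, aeval g (pderiv j Q) * pderiv i (g j) := by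
  induction Q using MvPolynomial.induction_on with
  | C r => simp [algebraMap_eq]
  | add f g hf hg => simp only [map_add, hf, hg, add_mul, Finset.sum_add_distrib]
  | mul_X f k hf =>
    have h : ∀ j, aeval g (pderiv j (f * X k)) * pderiv i (g j) =
        aeval g (pderiv j f) * pderiv i (g j) * g k +
          if j = k then aeval g f * pderiv i (g k) else 0 := by
      intro j
      rw [pderiv_mul, map_add, map_mul, map_mul, aeval_X]
      split_ifs with hjk
      · subst hjk
        rw [pderiv_X_self, map_one]
        ring
      · rw [pderiv_X_of_ne (Ne.symm hjk), map_zero]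
        ring
    rw [Finset.sum_congr rfl fun j _ => h j, Finset.sum_add_distrib, Finset.sum_ite_eq',
      if_pos (Finset.mem_univ _), ← Finset.sum_mul, ← hf, map_mul, aeval_X, pderiv_mul]

theorem eval_pderiv_aeval_fin_three (p : Fin 3 → ℂ) (i : Fin 3)
    (g : Fin 3 → MvPolynomial (Fin 3) ℂ) (Q : MvPolynomial (Fin 3) ℂ) :
    eval p (pderiv i (aeval g Q)) =
      eval (fun i => eval p (g i)) (pderiv 0 Q) * eval p (pderiv i (g 0)) +
      eval (fun i => eval p (g i)) (pderiv 1 Q) * eval p (pderiv i (g 1)) +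
      eval (fun i => eval p (g i)) (pderiv 2 Q) * eval p (pderiv i (g 2)) := by
  rw [pderiv_aeval_fin_three, Fin.sum_univ_three, map_add, map_add, map_mul, map_mul, map_mul,
    eval_aeval_fin_three, eval_aeval_fin_three, eval_aeval_fin_three]

theorem mem_singularPoints_iff {p : Fin 3 → ℂ} {Q : MvPolynomial (Fin 3) ℂ} :
    p ∈ singularPoints Q ↔ eval p Q = 0 ∧ eval p (pderiv 0 Q) = 0 ∧ eval p (pderiv 1 Q) = 0 ∧
      eval p (pderiv 2 Q) = 0 :=
  and_congr_right fun _ => ⟨fun h => ⟨h 0, h 1, h 2⟩, fun h i => by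
    fin_cases i
    · exact h.1
    · exact h.2.1
    · exact h.2.2⟩

theorem vec_eq_zero_iff {p : Fin 3 → ℂ} : p = 0 ↔ p 0 = 0 ∧ p 1 = 0 ∧ p 2 = 0 :=
  ⟨fun h => by simp [h], fun h => by
    ext i
    fin_cases i
    · exact h.1
    · exact h.2.1
    · exact h.2.2⟩

/-- On x = 0 the polynomial is a binary quadratic form in y, z. If Q(0,r,1) were a nonzero constant
e as a polynomial in r, homogeneity would give Q(0,1,t) = e t² for t ≠ 0, hence identically, and so
Q(0,1,0) = 0. -/
theorem exists_root_on_axis {a b d : ℕ} (hb : 0 < b) {Q : MvPolynomial (Fin 3) ℂ}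
    (hQ : Q.IsWeightedHomogeneous ![a, b, b] d) (hd : d = b + b) (hA : eval ![0, 1, 0] Q ≠ 0) :
    ∃ r : ℂ, eval ![0, r, 1] Q = 0 := by
  have hev : ∀ (g : Fin 3 → Polynomial ℂ) (t : ℂ),
      (aeval g Q).eval t = eval (fun i => (g i).eval t) Q := by
    intro g t
    clear hQ hA
    induction Q using MvPolynomial.induction_on with
    | C r => rw [aeval_C, eval_C, Polynomial.algebraMap_eq, Polynomial.eval_C]
    | add f g hf hg => rw [map_add, map_add, Polynomial.eval_add, hf, hg]
    | mul_X f k hf => rw [map_mul, map_mul, Polynomial.eval_mul, hf, aeval_X, eval_X]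
  by_cases hF : (aeval ![0, Polynomial.X, 1] Q : Polynomial ℂ).degree = 0
  · exfalso
    set e := (aeval ![0, Polynomial.X, 1] Q : Polynomial ℂ).coeff 0 with he
    have h1 : ∀ r : ℂ, eval ![0, r, 1] Q = e := by
      intro r
      have h := hev ![0, Polynomial.X, 1] r
      rw [Polynomial.eq_C_of_degree_eq_zero hF, Polynomial.eval_C] at h
      rw [he, h]
      congr 2
      ext i
      fin_cases i <;> simp
    have h2 : ∀ t y z : ℂ, eval ![0, t * y, t * z] Q = t ^ 2 * eval ![0, y, z] Q := by
      intro t y z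
      rw [eval_eq', eval_eq', Finset.mul_sum]
      refine Finset.sum_congr rfl fun n hn => ?_
      simp only [Fin.prod_univ_three, Matrix.cons_val_zero, Matrix.cons_val_one, Matrix.cons_val]
      rcases Nat.eq_zero_or_pos (n 0) with h0 | h0
      · have hw : n 0 * a + n 1 * b + n 2 * b = d := by
          rw [← weight_fin_three]; exact hQ (mem_support_iff.1 hn)
        have h3 : n 1 + n 2 = 2 := by
          rw [h0, hd, zero_mul, zero_add, ← add_mul, ← two_mul] at hw
          exact Nat.eq_of_mul_eq_mul_right hb hw
        have h4 : t ^ 2 = t ^ n 1 * t ^ n 2 := by rw [← pow_add, h3]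
        rw [h4, mul_pow, mul_pow]
        ring
      · rw [zero_pow (by omega)]
        ring
    have h3 : (aeval ![0, 1, Polynomial.X] Q : Polynomial ℂ) = Polynomial.C e * Polynomial.X ^ 2 := by
      refine Polynomial.eq_of_infinite_eval_eq _ _ ((Set.finite_singleton 0).infinite_compl.mono ?_)
      intro t ht
      have ht : t ≠ 0 := ht
      change Polynomial.eval _ _ = Polynomial.eval _ _
      rw [hev]
      have h4 : (fun i => Polynomial.eval t (![0, 1, Polynomial.X] i)) =
          ![0, t * t⁻¹, t * 1] := by
        ext i
        fin_cases i <;> simp [ht]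
      rw [h4, h2, h1, Polynomial.eval_mul, Polynomial.eval_C, Polynomial.eval_pow,
        Polynomial.eval_X, mul_comm]
    have h4 := hev ![0, 1, Polynomial.X] 0
    rw [h3] at h4
    apply hA
    rw [show (![0, 1, 0] : Fin 3 → ℂ) = fun i => Polynomial.eval 0 (![0, 1, Polynomial.X] i) by
      ext i
      fin_cases i <;> simp, ← h4]
    simp
  · obtain ⟨r, hr⟩ := IsAlgClosed.exists_root _ hF
    refine ⟨r, ?_⟩
    rw [Polynomial.IsRoot, hev] at hr
    refine (congrArg (eval · Q) ?_).trans hr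
    ext i
    fin_cases i <;> simp

theorem IsWeightedHomogeneous.aeval_fin_three {w : Fin 3 → ℕ} {d : ℕ}
    {Q : MvPolynomial (Fin 3) ℂ} (hQ : Q.IsWeightedHomogeneous w d)
    {g : Fin 3 → MvPolynomial (Fin 3) ℂ} (hg : ∀ i, (g i).IsWeightedHomogeneous w (w i)) :
    (aeval g Q).IsWeightedHomogeneous w d := by
  rw [aeval_def, eval₂_eq]
  refine IsWeightedHomogeneous.sum _ _ _ fun n hn => ?_
  have h1 : (∏ i ∈ n.support, g i ^ n i).IsWeightedHomogeneous w (∑ i ∈ n.support, n i • w i) :=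
    IsWeightedHomogeneous.prod _ _ _ fun i _ => (hg i).pow _
  have h2 : ∑ i ∈ n.support, n i • w i = d := by
    rw [← hQ (mem_support_iff.1 hn), Finsupp.weight_apply]
    rfl
  rw [h2] at h1
  have := (isWeightedHomogeneous_C w (coeff n Q)).mul h1
  rwa [zero_add] at this

/-- For weights a, c, c and degree 2c the only monomial of z-degree at least 2 is z², and its
coefficient is the value at (0,0,1). A homogeneous coordinate change that kills this value therefore
reduces to `isKleinianA_of_le_one`. -/
theorem isKleinianA_of_change {a c d : ℕ} (ha : 0 < a) (hac : a ≤ c)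
    {Q : MvPolynomial (Fin 3) ℂ} (hQ : Q.IsWeightedHomogeneous ![a, c, c] d) (hd : d = c + c)
    (hs : singularPoints Q = {0}) (e : MvPolynomial (Fin 3) ℂ ≃ₐ[ℂ] MvPolynomial (Fin 3) ℂ)
    (g : Fin 3 → MvPolynomial (Fin 3) ℂ) (hg : ∀ f, e f = aeval g f)
    (hgw : ∀ i, (g i).IsWeightedHomogeneous ![a, c, c] (![a, c, c] i))
    (hsing : ∀ p, p ∈ singularPoints (aeval g Q) ↔ (fun i => eval p (g i)) ∈ singularPoints Q)
    (hpt : ∀ p : Fin 3 → ℂ, (fun i => eval p (g i)) = 0 ↔ p = 0)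
    (hz : eval ![0, 0, 1] (aeval g Q) = 0) : IsKleinianA Q := by
  refine IsKleinianA.of_aut e (hg Q) ?_
  have hQ' := hQ.aeval_fin_three hgw
  refine isKleinianA_of_le_one ha hac le_rfl hQ' hd.le ?_ ?_
  · ext p
    rw [hsing, hs, Set.mem_singleton_iff, hpt, Set.mem_singleton_iff]
  · intro n hn
    by_contra h
    have hw : ∀ n ∈ (aeval g Q).support, n 0 * a + n 1 * c + n 2 * c = d := fun n hn => by
      rw [← weight_fin_three]; exact hQ' (mem_support_iff.1 hn)
    have key : ∀ n ∈ (aeval g Q).support, 2 ≤ n 2 → n = Finsupp.single 2 2 := by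
      intro n hn h
      have h1 := hw n hn
      have h2 : 2 * c ≤ n 2 * c := Nat.mul_le_mul_right _ h
      have h3 : n 0 * a = 0 := by omega
      have h4 : n 1 * c = 0 := by omega
      have h5 : n 2 * c = 2 * c := by omega
      have h6 : n 2 = 2 := Nat.eq_of_mul_eq_mul_right (by omega) h5
      rcases Nat.mul_eq_zero.1 h3 with h7 | h7
      · rcases Nat.mul_eq_zero.1 h4 with h8 | h8
        · ext k; fin_cases k <;> simp [h7, h8, h6]
        · omega
      · omega
    have hn2 := key n hn (by omega)
    apply mem_support_iff.1 hn
    rw [eval_eq'] at hz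
    rw [Finset.sum_eq_single n] at hz
    · simpa [Fin.prod_univ_three, hn2] using hz
    · intro n' hn' hne
      have h1 : ¬ 2 ≤ n' 2 := fun h => hne ((key n' hn' h).trans hn2.symm)
      have h2 := hw n' hn'
      have h3 : n' 0 ≠ 0 ∨ n' 1 ≠ 0 := by
        by_contra h4
        push Not at h4
        rw [h4.1, h4.2] at h2
        have : n' 2 * c ≤ 1 * c := Nat.mul_le_mul_right _ (by omega)
        omega
      rcases h3 with h3 | h3 <;> simp [Fin.prod_univ_three, h3]
    · intro h; exact absurd hn h

/-- A quasihomogeneous isolated surface singularity of degree at most `b + c` is of type `A`. -/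
theorem isKleinianA_of_degree_le {a b c d : ℕ} (ha : 0 < a) (hab : a ≤ b) (hbc : b ≤ c)
    {Q : MvPolynomial (Fin 3) ℂ} (hQ : Q.IsWeightedHomogeneous ![a, b, c] d) (hd : d ≤ b + c)
    (hs : singularPoints Q = {0}) : IsKleinianA Q := by
  have hw : ∀ n ∈ Q.support, n 0 * a + n 1 * b + n 2 * c = d := fun n hn => by
    rw [← weight_fin_three]; exact hQ (mem_support_iff.1 hn)
  by_cases h1 : ∀ n ∈ Q.support, n 2 ≤ 1
  · exact isKleinianA_of_le_one ha hab hbc hQ hd hs h1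
  push Not at h1
  obtain ⟨n, hn, hn2⟩ := h1
  have h2 : 2 * c ≤ n 2 * c := Nat.mul_le_mul_right _ hn2
  have h3 := hw n hn
  -- A monomial divisible by z² gives 2c ≤ d ≤ b + c, and b ≤ c.
  obtain rfl : b = c := by omega
  obtain hd : d = b + b := by omega
  clear hn hn2 h2 h3 n
  -- A zero of Q on the line x = 0 has to be moved to (0,0,1): by exchanging y and z if it is
  -- (0,1,0), and otherwise by the shear y ↦ y + rz with Q(0,r,1) = 0.
  by_cases hA : eval ![0, 1, 0] Q = 0
  · refine isKleinianA_of_change ha hab hQ hd hs (renameEquiv ℂ (Equiv.swap 1 2)) ![X 0, X 2, X 1]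
      ?_ ?_ ?_ ?_ ?_
    · intro f
      rw [renameEquiv_apply, rename_eq_aeval] 
      congr 2
      ext1 j
      fin_cases j <;> simp [Equiv.swap_apply_of_ne_of_ne]
    · intro i
      fin_cases i
      · exact isWeightedHomogeneous_X ℂ _ 0
      · exact isWeightedHomogeneous_X ℂ ![a, b, b] 2
      · exact isWeightedHomogeneous_X ℂ ![a, b, b] 1
    · intro p
      have h := fun i => eval_pderiv_aeval_fin_three p i ![X 0, X 2, X 1] Q
      rw [mem_singularPoints_iff, mem_singularPoints_iff, h, h, h, eval_aeval_fin_three]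
      generalize (fun i => eval p ((![X 0, X 2, X 1] : Fin 3 → MvPolynomial (Fin 3) ℂ) i)) = p'
      simp only [Matrix.cons_val_zero, Matrix.cons_val_one, Matrix.cons_val,
        pderiv_X_self, map_one, map_zero, mul_zero, add_zero, zero_add, mul_one,
        pderiv_X_of_ne (show (1 : Fin 3) ≠ 0 by decide),
        pderiv_X_of_ne (show (2 : Fin 3) ≠ 0 by decide),
        pderiv_X_of_ne (show (0 : Fin 3) ≠ 1 by decide),
        pderiv_X_of_ne (show (2 : Fin 3) ≠ 1 by decide),
        pderiv_X_of_ne (show (0 : Fin 3) ≠ 2 by decide),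
        pderiv_X_of_ne (show (1 : Fin 3) ≠ 2 by decide)]
      exact ⟨fun ⟨h1, h2, h3, h4⟩ => ⟨h1, h2, h4, h3⟩, fun ⟨h1, h2, h3, h4⟩ => ⟨h1, h2, h4, h3⟩⟩
    · intro p
      rw [vec_eq_zero_iff, vec_eq_zero_iff]
      simp only [Matrix.cons_val_zero, Matrix.cons_val_one, Matrix.cons_val, eval_X]
      exact ⟨fun ⟨h1, h2, h3⟩ => ⟨h1, h3, h2⟩, fun ⟨h1, h2, h3⟩ => ⟨h1, h3, h2⟩⟩
    · rw [eval_aeval_fin_three]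
      refine (congrArg (eval · Q) ?_).trans hA
      ext i
      fin_cases i <;> simp
  · obtain ⟨r, hr⟩ : ∃ r : ℂ, eval ![0, r, 1] Q = 0 :=
      exists_root_on_axis (by omega) hQ hd hA
    refine isKleinianA_of_change ha hab hQ hd hs (elementaryAut 1 1 one_ne_zero (C r * X 2)
      (by simp [algebraMap_eq])) ![X 0, X 1 + C r * X 2, X 2] ?_ ?_ ?_ ?_ ?_
    · intro f
      rw [elementaryAut, AlgEquiv.ofAlgHom_apply]
      congr 2
      ext1 j
      fin_cases j <;> simp
    · intro i
      fin_cases i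
      · exact isWeightedHomogeneous_X ℂ _ 0
      · refine (isWeightedHomogeneous_X ℂ ![a, b, b] 1).add ?_
        have := (isWeightedHomogeneous_C ![a, b, b] r).mul (isWeightedHomogeneous_X ℂ ![a, b, b] 2)
        rwa [zero_add] at this
      · exact isWeightedHomogeneous_X ℂ ![a, b, b] 2
    · intro p
      have h := fun i => eval_pderiv_aeval_fin_three p i ![X 0, X 1 + C r * X 2, X 2] Q
      rw [mem_singularPoints_iff, mem_singularPoints_iff, h, h, h, eval_aeval_fin_three]
      generalize (fun i => eval p ((![X 0, X 1 + C r * X 2, X 2] : Fin 3 → MvPolynomial (Fin 3) ℂ) i)) = p'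
      simp only [Matrix.cons_val_zero, Matrix.cons_val_one, Matrix.cons_val, map_add, pderiv_mul,
        pderiv_X_self, pderiv_C, map_one, map_zero, zero_mul, mul_zero, add_zero, zero_add, mul_one,
        pderiv_X_of_ne (show (1 : Fin 3) ≠ 0 by decide),
        pderiv_X_of_ne (show (2 : Fin 3) ≠ 0 by decide),
        pderiv_X_of_ne (show (0 : Fin 3) ≠ 1 by decide),
        pderiv_X_of_ne (show (2 : Fin 3) ≠ 1 by decide),
        pderiv_X_of_ne (show (0 : Fin 3) ≠ 2 by decide),
        pderiv_X_of_ne (show (1 : Fin 3) ≠ 2 by decide), eval_C]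
      refine and_congr_right fun _ => and_congr_right fun _ => and_congr_right fun h => ?_
      rw [h, zero_mul, zero_add]
    · intro p
      rw [vec_eq_zero_iff, vec_eq_zero_iff]
      simp only [Matrix.cons_val_zero, Matrix.cons_val_one, Matrix.cons_val, eval_X, map_add,
        map_mul, eval_C]
      refine and_congr_right fun _ => ?_
      constructor
      · rintro ⟨h1, h2⟩
        exact ⟨by simpa [h2] using h1, h2⟩
      · rintro ⟨h1, h2⟩
        simp [h1, h2]
    · rw [eval_aeval_fin_three]
      refine (congrArg (eval · Q) ?_).trans hr
      ext i
      fin_cases i <;> simp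

end MvPolynomial

/-! ### The Koszul complex of three forms -/

/-- If the ideal of `f = (f₁, f₂, f₃)` contains a regular sequence of length three, then every
relation between `f₁, f₂, f₃` is a Koszul relation. -/
theorem exists_cross_of_dot_eq_zero {R : Type*} [CommRing R] {f₁ f₂ f₃ g₁ g₂ g₃ : R}
    (hg₁ : g₁ ∈ Ideal.span {f₁, f₂, f₃}) (hg₂ : g₂ ∈ Ideal.span {f₁, f₂, f₃})
    (hg₃ : g₃ ∈ Ideal.span {f₁, f₂, f₃}) (r₁ : ∀ x, g₁ * x = 0 → x = 0)
    (r₂ : ∀ x, g₁ ∣ g₂ * x → g₁ ∣ x)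
    (r₃ : ∀ x, g₃ * x ∈ Ideal.span {g₁, g₂} → x ∈ Ideal.span {g₁, g₂})
    {h₁ h₂ h₃ : R} (h : f₁ * h₁ + f₂ * h₂ + f₃ * h₃ = 0) :
    ∃ k₁ k₂ k₃, h₁ = f₂ * k₃ - f₃ * k₂ ∧ h₂ = f₃ * k₁ - f₁ * k₃ ∧ h₃ = f₁ * k₂ - f₂ * k₁ := by
  obtain ⟨a₁, a₂, a₃, ha⟩ := Submodule.mem_span_triple.1 hg₁
  obtain ⟨b₁, b₂, b₃, hb⟩ := Submodule.mem_span_triple.1 hg₂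
  obtain ⟨c₁, c₂, c₃, hc⟩ := Submodule.mem_span_triple.1 hg₃
  simp only [smul_eq_mul] at ha hb hc
  -- With g₁ = a·f and κ = h × a, the identity f × (h × a) = (f·a)h - (f·h)a and f·h = 0 give g₁h =
  -- f × κ. It remains to divide κ by g₁, up to a multiple of f.
  set κ₁ := h₂ * a₃ - h₃ * a₂ with hκ₁
  set κ₂ := h₃ * a₁ - h₁ * a₃ with hκ₂
  set κ₃ := h₁ * a₂ - h₂ * a₁ with hκ₃
  set l := b₁ * κ₁ + b₂ * κ₂ + b₃ * κ₃ with hl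
  have e₁ : g₁ * h₁ = f₂ * κ₃ - f₃ * κ₂ := by
    rw [hκ₂, hκ₃]; linear_combination (-h₁) * ha + a₁ * h
  have e₂ : g₁ * h₂ = f₃ * κ₁ - f₁ * κ₃ := by
    rw [hκ₁, hκ₃]; linear_combination (-h₂) * ha + a₂ * h
  have e₃ : g₁ * h₃ = f₁ * κ₂ - f₂ * κ₁ := by
    rw [hκ₁, hκ₂]; linear_combination (-h₃) * ha + a₃ * h
  -- The same vector identity with g₂ = b·f and l = b·κ: g₂κ = l f - g₁ (b × h).
  have l₁ : g₂ * κ₁ = l * f₁ - g₁ * (b₂ * h₃ - b₃ * h₂) := by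
    rw [hl]; linear_combination (-κ₁) * hb - b₃ * e₂ + b₂ * e₃
  have l₂ : g₂ * κ₂ = l * f₂ - g₁ * (b₃ * h₁ - b₁ * h₃) := by
    rw [hl]; linear_combination (-κ₂) * hb + b₃ * e₁ - b₁ * e₃
  have l₃ : g₂ * κ₃ = l * f₃ - g₁ * (b₁ * h₂ - b₂ * h₁) := by
    rw [hl]; linear_combination (-κ₃) * hb - b₂ * e₁ + b₁ * e₂
  -- Pairing the previous relations with c, where c·f = g₃, shows g₃ l ∈ (g₁, g₂), so l = μg₁ + νg₂.
  -- Then g₁ divides g₂(κ - νf), hence κ = νf + g₁p, and h = f × p after cancelling g₁.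
  obtain ⟨μ, ν, hμ⟩ := Ideal.mem_span_pair.1 (r₃ l (by
    refine Ideal.mem_span_pair.2
      ⟨c₁ * (b₂ * h₃ - b₃ * h₂) + c₂ * (b₃ * h₁ - b₁ * h₃) + c₃ * (b₁ * h₂ - b₂ * h₁),
        c₁ * κ₁ + c₂ * κ₂ + c₃ * κ₃, ?_⟩
    linear_combination l * hc + c₁ * l₁ + c₂ * l₂ + c₃ * l₃))
  obtain ⟨p₁, hp₁⟩ := r₂ (κ₁ - ν * f₁) ⟨μ * f₁ - (b₂ * h₃ - b₃ * h₂), by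
    linear_combination l₁ - f₁ * hμ⟩
  obtain ⟨p₂, hp₂⟩ := r₂ (κ₂ - ν * f₂) ⟨μ * f₂ - (b₃ * h₁ - b₁ * h₃), by
    linear_combination l₂ - f₂ * hμ⟩
  obtain ⟨p₃, hp₃⟩ := r₂ (κ₃ - ν * f₃) ⟨μ * f₃ - (b₁ * h₂ - b₂ * h₁), by
    linear_combination l₃ - f₃ * hμ⟩
  refine ⟨p₁, p₂, p₃, ?_, ?_, ?_⟩
  · exact sub_eq_zero.1 (r₁ _ (by linear_combination e₁ + f₂ * hp₃ - f₃ * hp₂))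
  · exact sub_eq_zero.1 (r₁ _ (by linear_combination e₂ + f₃ * hp₁ - f₁ * hp₃))
  · exact sub_eq_zero.1 (r₁ _ (by linear_combination e₃ + f₁ * hp₂ - f₂ * hp₁))

/-! ### Three forms without common zeros are a regular sequence. -/

namespace MvPolynomial

theorem X_pow_dvd_of_dvd_X_pow_mul (M : ℕ) {x : MvPolynomial (Fin 3) ℂ}
    (h : X 0 ^ M ∣ X 1 ^ M * x) : X 0 ^ M ∣ x := by
  refine (X_prime (i := 0)).pow_dvd_of_dvd_mul_left M ?_ h
  intro h'
  have := (X_prime (R := ℂ) (i := (0 : Fin 3))).dvd_of_dvd_pow h'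
  rw [X_dvd_X] at this
  simp at this

theorem mem_span_X_pow_of_mul_mem (M : ℕ) {x : MvPolynomial (Fin 3) ℂ}
    (h : X 2 ^ M * x ∈ Ideal.span {(X 0 ^ M : MvPolynomial (Fin 3) ℂ), X 1 ^ M}) :
    x ∈ Ideal.span {(X 0 ^ M : MvPolynomial (Fin 3) ℂ), X 1 ^ M} := by
  have himage : ({(X 0 ^ M : MvPolynomial (Fin 3) ℂ), X 1 ^ M} : Set _) =
      (fun s => monomial s 1) '' {Finsupp.single (0 : Fin 3) M, Finsupp.single 1 M} := by
    rw [Set.image_pair, X_pow_eq_monomial, X_pow_eq_monomial]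
  rw [himage] at h ⊢
  rw [mem_ideal_span_monomial_image] at h ⊢
  intro n hn
  obtain ⟨s, hs, hle⟩ := h (Finsupp.single 2 M + n) (by
    rw [mem_support_iff, X_pow_eq_monomial, coeff_monomial_mul, one_mul]
    exact mem_support_iff.1 hn)
  refine ⟨s, hs, ?_⟩
  rcases hs with rfl | rfl
  · rw [Finsupp.single_le_iff] at hle ⊢
    simpa using hle
  · rw [Finsupp.single_le_iff] at hle ⊢
    simpa using hle

/-- Nullstellensatz: each variable vanishes on the zero locus, which is contained in the origin. A
common exponent is obtained by adding the three. -/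
theorem exists_X_pow_mem {f₁ f₂ f₃ : MvPolynomial (Fin 3) ℂ}
    (h : ∀ p : Fin 3 → ℂ, eval p f₁ = 0 → eval p f₂ = 0 → eval p f₃ = 0 → p = 0) :
    ∃ M, ∀ i : Fin 3, (X i : MvPolynomial (Fin 3) ℂ) ^ M ∈ Ideal.span {f₁, f₂, f₃} := by
  have key : ∀ i : Fin 3, ∃ M, (X i : MvPolynomial (Fin 3) ℂ) ^ M ∈ Ideal.span {f₁, f₂, f₃} := by
    intro i
    rw [← Ideal.mem_radical_iff, ← vanishingIdeal_zeroLocus_eq_radical (K := ℂ),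
      mem_vanishingIdeal_iff]
    intro p hp
    rw [mem_zeroLocus_iff] at hp
    have := h p (hp f₁ (Ideal.subset_span (by simp))) (hp f₂ (Ideal.subset_span (by simp)))
      (hp f₃ (Ideal.subset_span (by simp)))
    simp [this]
  choose M hM using key
  refine ⟨M 0 + M 1 + M 2, fun i => Ideal.pow_mem_of_pow_mem _ (hM i) ?_⟩
  fin_cases i <;> simp <;> omega

/-- The ideal contains x^M, y^M, z^M, which form a regular sequence, so the first Koszul homology of
f₁, f₂, f₃ vanishes. -/
theorem exists_cross_of_dot_eq_zero {f₁ f₂ f₃ : MvPolynomial (Fin 3) ℂ}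
    (h0 : ∀ p : Fin 3 → ℂ, eval p f₁ = 0 → eval p f₂ = 0 → eval p f₃ = 0 → p = 0)
    {h₁ h₂ h₃ : MvPolynomial (Fin 3) ℂ} (h : f₁ * h₁ + f₂ * h₂ + f₃ * h₃ = 0) :
    ∃ k₁ k₂ k₃, h₁ = f₂ * k₃ - f₃ * k₂ ∧ h₂ = f₃ * k₁ - f₁ * k₃ ∧ h₃ = f₁ * k₂ - f₂ * k₁ := by
  obtain ⟨M, hM⟩ := exists_X_pow_mem h0
  refine _root_.exists_cross_of_dot_eq_zero (hM 0) (hM 1) (hM 2) ?_ ?_ ?_ h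
  · intro x hx
    exact (mul_eq_zero.1 hx).resolve_left (pow_ne_zero _ (X_ne_zero _))
  · exact fun x => X_pow_dvd_of_dvd_X_pow_mul M
  · exact fun x => mem_span_X_pow_of_mul_mem M

variable {w : Fin 3 → ℕ}

theorem weightedHomogeneousComponent_mul {s : ℕ} {f : MvPolynomial (Fin 3) ℂ}
    (hf : f.IsWeightedHomogeneous w s) (n : ℕ) (g : MvPolynomial (Fin 3) ℂ) :
    weightedHomogeneousComponent w (s + n) (f * g) = f * weightedHomogeneousComponent w n g := by
  classical
  induction g using MvPolynomial.induction_on' with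
  | monomial u r =>
    have h1 := isWeightedHomogeneous_monomial (R := ℂ) w u r rfl
    rw [weightedHomogeneousComponent_of_mem (hf.mul h1), weightedHomogeneousComponent_of_mem h1]
    simp [mul_ite]
  | add p q hp hq => rw [mul_add, map_add, hp, hq, map_add, mul_add]

theorem weightedHomogeneousComponent_mul_of_lt {s : ℕ} {f : MvPolynomial (Fin 3) ℂ}
    (hf : f.IsWeightedHomogeneous w s) {m : ℕ} (hm : m < s) (g : MvPolynomial (Fin 3) ℂ) :
    weightedHomogeneousComponent w m (f * g) = 0 := by
  classical
  induction g using MvPolynomial.induction_on' with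
  | monomial u r =>
    have h1 := isWeightedHomogeneous_monomial (R := ℂ) w u r rfl
    rw [weightedHomogeneousComponent_of_mem (hf.mul h1), if_neg (by omega)]
  | add p q hp hq => rw [mul_add, map_add, hp, hq, add_zero]

/-- Two of three forms without common zeros have no common factor. -/
theorem dvd_of_dvd_mul_of_isWeightedHomogeneous {f₁ f₂ f₃ : MvPolynomial (Fin 3) ℂ}
    (h0 : ∀ p : Fin 3 → ℂ, eval p f₁ = 0 → eval p f₂ = 0 → eval p f₃ = 0 → p = 0)
    {s₁ s₂ s₃ : ℕ} (hs : 0 < s₃)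
    (hf₁ : f₁.IsWeightedHomogeneous w s₁) (hf₂ : f₂.IsWeightedHomogeneous w s₂)
    (hf₃ : f₃.IsWeightedHomogeneous w s₃) (n : ℕ) :
    ∀ h : MvPolynomial (Fin 3) ℂ, h.IsWeightedHomogeneous w n → f₁ ∣ f₂ * h → f₁ ∣ h := by
  classical
  induction n using Nat.strong_induction_on with
  | _ n ih =>
    rintro h hh ⟨u, hu⟩
    -- The relation (-u, h, 0) is a Koszul relation, so h = f₃k₁ - f₁k₃ and f₂k₁ = f₁k₂. In weight n
    -- the factor k₁ contributes its component of weight n - s₃ < n, which f₁ divides by induction.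
    obtain ⟨k₁, k₂, k₃, -, e₂, e₃⟩ := exists_cross_of_dot_eq_zero h0
      (h₁ := -u) (h₂ := h) (h₃ := 0) (by linear_combination hu)
    have c₂ := congrArg (weightedHomogeneousComponent w n) e₂
    rw [weightedHomogeneousComponent_of_mem hh, if_pos rfl, map_sub] at c₂
    have d₁ : f₁ ∣ weightedHomogeneousComponent w n (f₁ * k₃) := by
      rcases lt_or_ge n s₁ with h1 | h1
      · rw [weightedHomogeneousComponent_mul_of_lt hf₁ h1]; exact dvd_zero _
      · obtain ⟨m, rfl⟩ := exists_add_of_le h1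
        rw [weightedHomogeneousComponent_mul hf₁]
        exact dvd_mul_right _ _
    rcases lt_or_ge n s₃ with h3 | h3
    · rw [weightedHomogeneousComponent_mul_of_lt hf₃ h3, zero_sub] at c₂
      rw [c₂]
      exact (dvd_neg).2 d₁
    · obtain ⟨m, rfl⟩ := exists_add_of_le h3
      rw [weightedHomogeneousComponent_mul hf₃] at c₂
      rw [c₂]
      refine dvd_sub (Dvd.dvd.mul_left (ih m (by omega) _
        (weightedHomogeneousComponent_isWeightedHomogeneous m k₁) ?_) _) d₁
      rw [← weightedHomogeneousComponent_mul hf₂,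
        show f₂ * k₁ = f₁ * k₂ by linear_combination e₃]
      rcases lt_or_ge (s₂ + m) s₁ with h1 | h1
      · rw [weightedHomogeneousComponent_mul_of_lt hf₁ h1]; exact dvd_zero _
      · obtain ⟨l, hl⟩ := exists_add_of_le h1
        rw [hl, weightedHomogeneousComponent_mul hf₁]
        exact dvd_mul_right _ _

theorem mem_span_pair_of_mul_mem {f₁ f₂ f₃ : MvPolynomial (Fin 3) ℂ}
    (h0 : ∀ p : Fin 3 → ℂ, eval p f₁ = 0 → eval p f₂ = 0 → eval p f₃ = 0 → p = 0)
    {h : MvPolynomial (Fin 3) ℂ} (hh : f₃ * h ∈ Ideal.span {f₁, f₂}) :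
    h ∈ Ideal.span {f₁, f₂} := by
  obtain ⟨u, v, huv⟩ := Ideal.mem_span_pair.1 hh
  obtain ⟨k₁, k₂, k₃, -, -, e₃⟩ := exists_cross_of_dot_eq_zero h0
      (h₁ := -u) (h₂ := -v) (h₃ := h) (by linear_combination -huv)
  exact Ideal.mem_span_pair.2 ⟨k₂, -k₁, by rw [e₃]; ring⟩

end MvPolynomial

/-- A family of vectors that spans a complement of a subspace. -/
theorem exists_family_spanning_quotient {V : Type*} [AddCommGroup V] [Module ℂ V]
    [Module.Finite ℂ V] (p : Submodule ℂ V) :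
    ∃ n, n + Module.finrank ℂ p = Module.finrank ℂ V ∧
      ∃ b : Fin n → V, ∀ v, ∃ c : Fin n → ℂ, v - ∑ i, c i • b i ∈ p := by
  obtain ⟨q, hq⟩ := Submodule.exists_isCompl p
  refine ⟨Module.finrank ℂ q, by rw [add_comm]; exact Submodule.finrank_add_eq_of_isCompl hq,
    fun i => Module.finBasis ℂ q i, fun v => ?_⟩
  have : v ∈ p ⊔ q := by rw [hq.sup_eq_top]; trivial
  obtain ⟨y, hy, z, hz, rfl⟩ := Submodule.mem_sup.1 this
  refine ⟨(Module.finBasis ℂ q).repr ⟨z, hz⟩, ?_⟩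
  have h1 := congrArg Subtype.val ((Module.finBasis ℂ q).sum_repr ⟨z, hz⟩)
  simp only [Submodule.coe_sum, Submodule.coe_smul] at h1
  rw [h1, add_sub_cancel_right]
  exact hy

/-! ### Hilbert series of complete intersections. -/

namespace MvPolynomial

variable {w : Fin 3 → ℕ}

/-- The number of monomials of weight `m`. -/
def monomialCount (w : Fin 3 → ℕ) (m : ℕ) : ℕ := Nat.card {n : Fin 3 →₀ ℕ // Finsupp.weight w n = m}

theorem finite_weight_eq (hw : ∀ i, w i ≠ 0) (m : ℕ) :
    Finite {n : Fin 3 →₀ ℕ // Finsupp.weight w n = m} :=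
  (Finsupp.finite_of_nat_weight_eq w hw m).to_subtype

theorem finite_weightedHomogeneousSubmodule (hw : ∀ i, w i ≠ 0) (m : ℕ) :
    Module.Finite ℂ (weightedHomogeneousSubmodule ℂ w m) :=
  Module.Finite.iff_fg.2 (weightedHomogeneousSubmodule_fg ℂ w hw m)

theorem finrank_weightedHomogeneousSubmodule (m : ℕ) :
    Module.finrank ℂ (weightedHomogeneousSubmodule ℂ w m) = monomialCount w m := by
  rw [weightedHomogeneousSubmodule_eq_finsupp_supported]
  exact Module.finrank_eq_nat_card_basis
    (basisRestrictSupport ℂ {d : Fin 3 →₀ ℕ | Finsupp.weight w d = m})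

/-- The homogeneous elements of weight `m` in an ideal. -/
def idealPiece (w : Fin 3 → ℕ) (I : Ideal (MvPolynomial (Fin 3) ℂ)) (m : ℕ) :
    Submodule ℂ (MvPolynomial (Fin 3) ℂ) :=
  I.restrictScalars ℂ ⊓ weightedHomogeneousSubmodule ℂ w m

/-- The Hilbert series of the quotient by an ideal. -/
def hilbertSeries (w : Fin 3 → ℕ) (I : Ideal (MvPolynomial (Fin 3) ℂ)) : PowerSeries ℚ :=
  PowerSeries.mk fun m => (monomialCount w m : ℚ) - Module.finrank ℂ (idealPiece w I m)

theorem hilbertSeries_bot : hilbertSeries w ⊥ = PowerSeries.mk fun m => (monomialCount w m : ℚ) := by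
  ext m
  have : idealPiece w ⊥ m = ⊥ := by
    rw [eq_bot_iff]
    intro x hx
    exact hx.1
  rw [hilbertSeries, PowerSeries.coeff_mk, PowerSeries.coeff_mk, this, finrank_bot]
  simp

/-- An ideal that contains the weighted homogeneous components of its elements. -/
def IsGradedIdeal (w : Fin 3 → ℕ) (I : Ideal (MvPolynomial (Fin 3) ℂ)) : Prop :=
  ∀ f ∈ I, ∀ m, weightedHomogeneousComponent w m f ∈ I

theorem isGradedIdeal_bot : IsGradedIdeal w ⊥ := by
  intro f hf m
  rw [Ideal.mem_bot] at hf
  simp [hf]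

theorem mem_sup_span_singleton {I : Ideal (MvPolynomial (Fin 3) ℂ)}
    {f x : MvPolynomial (Fin 3) ℂ} :
    x ∈ I ⊔ Ideal.span {f} ↔ ∃ y ∈ I, ∃ g, x = y + f * g := by
  rw [Submodule.mem_sup]
  constructor
  · rintro ⟨y, hy, z, hz, rfl⟩
    obtain ⟨g, rfl⟩ := Ideal.mem_span_singleton.1 hz
    exact ⟨y, hy, g, rfl⟩
  · rintro ⟨y, hy, g, rfl⟩
    exact ⟨y, hy, _, Ideal.mem_span_singleton.2 (dvd_mul_right _ _), rfl⟩

theorem IsGradedIdeal.sup_span_singleton {I : Ideal (MvPolynomial (Fin 3) ℂ)}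
    (hI : IsGradedIdeal w I) {s : ℕ} {f : MvPolynomial (Fin 3) ℂ}
    (hf : f.IsWeightedHomogeneous w s) : IsGradedIdeal w (I ⊔ Ideal.span {f}) := by
  intro x hx m
  obtain ⟨y, hy, g, rfl⟩ := mem_sup_span_singleton.1 hx
  rw [map_add]
  rcases lt_or_ge m s with h | h
  · rw [weightedHomogeneousComponent_mul_of_lt hf h]
    exact mem_sup_span_singleton.2 ⟨_, hI y hy m, 0, by simp⟩
  · obtain ⟨l, rfl⟩ := exists_add_of_le h
    rw [weightedHomogeneousComponent_mul hf]
    exact mem_sup_span_singleton.2 ⟨_, hI y hy _, _, rfl⟩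

theorem idealPiece_sup_of_lt {I : Ideal (MvPolynomial (Fin 3) ℂ)} (hI : IsGradedIdeal w I)
    {s : ℕ} {f : MvPolynomial (Fin 3) ℂ} (hf : f.IsWeightedHomogeneous w s) {m : ℕ} (hm : m < s) :
    idealPiece w (I ⊔ Ideal.span {f}) m = idealPiece w I m := by
  ext x
  constructor
  · rintro ⟨hx, hxm⟩
    refine ⟨?_, hxm⟩
    obtain ⟨y, hy, g, rfl⟩ := mem_sup_span_singleton.1 hx
    have := weightedHomogeneousComponent_eq_self hxm
    rw [map_add, weightedHomogeneousComponent_mul_of_lt hf hm, add_zero] at this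
    rw [← this]
    exact hI y hy m
  · rintro ⟨hx, hxm⟩
    exact ⟨(le_sup_left : I ≤ _) hx, hxm⟩

/-- Rank-nullity for (x, y) ↦ fx + y from forms of weight l and I in weight s + l onto I + (f) in
weight s + l. A kernel element has fx ∈ I, so regularity identifies the kernel with I in weight l.
-/
theorem finrank_idealPiece_sup (hw : ∀ i, w i ≠ 0) {I : Ideal (MvPolynomial (Fin 3) ℂ)}
    (hI : IsGradedIdeal w I) {s : ℕ} {f : MvPolynomial (Fin 3) ℂ}
    (hf : f.IsWeightedHomogeneous w s)
    (hreg : ∀ (n : ℕ) (x), IsWeightedHomogeneous w x n → f * x ∈ I → x ∈ I) (l : ℕ) :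
    Module.finrank ℂ (idealPiece w (I ⊔ Ideal.span {f}) (s + l)) +
      Module.finrank ℂ (idealPiece w I l) =
    Module.finrank ℂ (idealPiece w I (s + l)) + monomialCount w l := by
  have hfin := finite_weightedHomogeneousSubmodule hw
  have hfinI : ∀ m, Module.Finite ℂ (idealPiece w I m) := fun m =>
    Submodule.finiteDimensional_of_le (inf_le_right : idealPiece w I m ≤ _)
  let φ : (weightedHomogeneousSubmodule ℂ w l) × (idealPiece w I (s + l)) →ₗ[ℂ]
      MvPolynomial (Fin 3) ℂ :=
    (LinearMap.mulLeft ℂ f ∘ₗ Submodule.subtype _).coprod (Submodule.subtype _)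
  have hφ : ∀ x, φ x = f * x.1.1 + x.2.1 := fun x => rfl
  have hrange : LinearMap.range φ = idealPiece w (I ⊔ Ideal.span {f}) (s + l) := by
    ext z
    constructor
    · rintro ⟨⟨⟨x, hx⟩, ⟨y, hy⟩⟩, rfl⟩
      rw [hφ]
      refine ⟨mem_sup_span_singleton.2 ⟨y, hy.1, x, add_comm _ _⟩, ?_⟩
      exact (hf.mul hx).add hy.2
    · rintro ⟨hz, hzm⟩
      obtain ⟨y, hy, g, rfl⟩ := mem_sup_span_singleton.1 hz
      have := weightedHomogeneousComponent_eq_self hzm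
      rw [map_add, weightedHomogeneousComponent_mul hf] at this
      refine ⟨⟨⟨weightedHomogeneousComponent w l g,
        weightedHomogeneousComponent_isWeightedHomogeneous _ _⟩,
        ⟨weightedHomogeneousComponent w (s + l) y, hI y hy _,
          weightedHomogeneousComponent_isWeightedHomogeneous _ _⟩⟩, ?_⟩
      rw [hφ, ← this, add_comm]
  have hker : Module.finrank ℂ (LinearMap.ker φ) = Module.finrank ℂ (idealPiece w I l) := by
    let e : LinearMap.ker φ ≃ₗ[ℂ] idealPiece w I l :=
      { toFun := fun x => ⟨x.1.1.1, by
          refine ⟨hreg l _ x.1.1.2 ?_, x.1.1.2⟩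
          have : f * x.1.1.1 + x.1.2.1 = 0 := x.2
          rw [eq_neg_of_add_eq_zero_left this]
          exact I.neg_mem x.1.2.2.1⟩
        map_add' := fun _ _ => rfl
        map_smul' := fun _ _ => rfl
        invFun := fun x => ⟨⟨⟨x.1, x.2.2⟩, ⟨-(f * x.1), I.neg_mem (I.mul_mem_left _ x.2.1),
          (hf.mul x.2.2).neg⟩⟩, by
            rw [LinearMap.mem_ker, hφ]; exact add_neg_cancel _⟩
        left_inv := by
          rintro ⟨⟨⟨x, hx⟩, ⟨y, hy⟩⟩, h⟩
          have : f * x + y = 0 := h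
          simp only [Subtype.mk.injEq, Prod.mk.injEq, true_and]
          exact Subtype.ext (eq_neg_of_add_eq_zero_right this).symm
        right_inv := fun x => rfl }
    exact e.finrank_eq
  have := LinearMap.finrank_range_add_finrank_ker φ
  rw [hrange, hker, Module.finrank_prod, finrank_weightedHomogeneousSubmodule] at this
  rw [this, add_comm]

theorem hilbertSeries_sup (hw : ∀ i, w i ≠ 0) {I : Ideal (MvPolynomial (Fin 3) ℂ)}
    (hI : IsGradedIdeal w I) {s : ℕ} {f : MvPolynomial (Fin 3) ℂ}
    (hf : f.IsWeightedHomogeneous w s)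
    (hreg : ∀ (n : ℕ) (x), IsWeightedHomogeneous w x n → f * x ∈ I → x ∈ I) :
    hilbertSeries w (I ⊔ Ideal.span {f}) = (1 - PowerSeries.X ^ s) * hilbertSeries w I := by
  ext m
  rw [sub_mul, one_mul, map_sub, PowerSeries.coeff_X_pow_mul']
  simp only [hilbertSeries, PowerSeries.coeff_mk]
  split_ifs with h
  · obtain ⟨l, rfl⟩ := exists_add_of_le h
    have := finrank_idealPiece_sup hw hI hf hreg l
    rw [Nat.add_sub_cancel_left]
    have h2 : ((Module.finrank ℂ (idealPiece w (I ⊔ Ideal.span {f}) (s + l)) : ℕ) : ℚ) +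
      (Module.finrank ℂ (idealPiece w I l) : ℕ) =
      (Module.finrank ℂ (idealPiece w I (s + l)) : ℕ) + monomialCount w l := by exact_mod_cast this
    linarith
  · rw [idealPiece_sup_of_lt hI hf (by omega)]
    simp

/-- The Hilbert series of the quotient by three forms without common zeros. -/
theorem hilbertSeries_of_no_common_zero (hw : ∀ i, w i ≠ 0) {f₁ f₂ f₃ : MvPolynomial (Fin 3) ℂ}
    (h0 : ∀ p : Fin 3 → ℂ, eval p f₁ = 0 → eval p f₂ = 0 → eval p f₃ = 0 → p = 0)
    {s₁ s₂ s₃ : ℕ} (hs : 0 < s₃)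
    (hf₁ : f₁.IsWeightedHomogeneous w s₁) (hf₂ : f₂.IsWeightedHomogeneous w s₂)
    (hf₃ : f₃.IsWeightedHomogeneous w s₃) (n₁ : f₁ ≠ 0) :
    hilbertSeries w (Ideal.span {f₁, f₂, f₃}) = (1 - PowerSeries.X ^ s₃) *
      ((1 - PowerSeries.X ^ s₂) * ((1 - PowerSeries.X ^ s₁) *
        PowerSeries.mk fun m => (monomialCount w m : ℚ))) ∧
    IsGradedIdeal w (Ideal.span {f₁, f₂, f₃}) := by
  have e : Ideal.span {f₁, f₂, f₃} =
      ((⊥ ⊔ Ideal.span {f₁}) ⊔ Ideal.span {f₂}) ⊔ Ideal.span {f₃} := by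
    rw [bot_sup_eq, ← Ideal.span_union, ← Ideal.span_union]
    congr 1
    ext x
    simp only [Set.mem_insert_iff, Set.mem_singleton_iff, Set.mem_union]
    tauto
  have g₁ := isGradedIdeal_bot.sup_span_singleton hf₁
  have g₂ := g₁.sup_span_singleton hf₂
  have g₃ := g₂.sup_span_singleton hf₃
  rw [e]
  refine ⟨?_, g₃⟩
  rw [hilbertSeries_sup hw g₂ hf₃, hilbertSeries_sup hw g₁ hf₂,
    hilbertSeries_sup hw isGradedIdeal_bot hf₁, hilbertSeries_bot]
  · intro n x _ hx
    rw [Ideal.mem_bot] at hx ⊢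
    exact (mul_eq_zero.1 hx).resolve_left n₁
  · intro n x hx hfx
    rw [bot_sup_eq, Ideal.mem_span_singleton] at hfx ⊢
    exact dvd_of_dvd_mul_of_isWeightedHomogeneous h0 hs hf₁ hf₂ hf₃ n x hx hfx
  · intro n x hx hfx
    rw [bot_sup_eq, ← Ideal.span_insert] at hfx ⊢
    exact mem_span_pair_of_mul_mem h0 hfx

/-- A graded complement of the ideal of three forms without common zeros. -/
theorem exists_graded_complement (hw : ∀ i, w i ≠ 0) {f₁ f₂ f₃ : MvPolynomial (Fin 3) ℂ}
    (h0 : ∀ p : Fin 3 → ℂ, eval p f₁ = 0 → eval p f₂ = 0 → eval p f₃ = 0 → p = 0)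
    {s₁ s₂ s₃ : ℕ} (hs : 0 < s₃)
    (hf₁ : f₁.IsWeightedHomogeneous w s₁) (hf₂ : f₂.IsWeightedHomogeneous w s₂)
    (hf₃ : f₃.IsWeightedHomogeneous w s₃) (n₁ : f₁ ≠ 0) :
    ∃ (e : ℕ → ℕ) (E : ∀ l, Fin (e l) → MvPolynomial (Fin 3) ℂ),
      (∀ l i, (E l i).IsWeightedHomogeneous w l) ∧
      (∀ l (f : MvPolynomial (Fin 3) ℂ), f.IsWeightedHomogeneous w l →
        ∃ c : Fin (e l) → ℂ, f - ∑ i, c i • E l i ∈ Ideal.span {f₁, f₂, f₃}) ∧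
      (PowerSeries.mk fun l => (e l : ℚ)) = (1 - PowerSeries.X ^ s₃) *
        ((1 - PowerSeries.X ^ s₂) * ((1 - PowerSeries.X ^ s₁) *
          PowerSeries.mk fun m => (monomialCount w m : ℚ))) := by
  obtain ⟨hser, -⟩ := hilbertSeries_of_no_common_zero hw h0 hs hf₁ hf₂ hf₃ n₁
  set J := Ideal.span {f₁, f₂, f₃} with hJ
  have hfin := finite_weightedHomogeneousSubmodule hw
  choose e he b hb using fun l => exists_family_spanning_quotient
    ((J.restrictScalars ℂ).comap (weightedHomogeneousSubmodule ℂ w l).subtype)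
  refine ⟨e, fun l i => (b l i).1, fun l i => (b l i).2, ?_, ?_⟩
  · intro l f hf
    obtain ⟨c, hc⟩ := hb l ⟨f, hf⟩
    refine ⟨c, ?_⟩
    simpa using hc
  · rw [← hser]
    ext l
    rw [hilbertSeries, PowerSeries.coeff_mk, PowerSeries.coeff_mk]
    have h1 := he l
    have h2 : Module.finrank ℂ ((J.restrictScalars ℂ).comap
        (weightedHomogeneousSubmodule ℂ w l).subtype) = Module.finrank ℂ (idealPiece w J l) := by
      have := (Submodule.equivSubtypeMap (weightedHomogeneousSubmodule ℂ w l)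
        ((J.restrictScalars ℂ).comap (weightedHomogeneousSubmodule ℂ w l).subtype)).finrank_eq
      rw [this, Submodule.map_comap_subtype, inf_comm]
      rfl
    rw [h2, finrank_weightedHomogeneousSubmodule] at h1
    rw [← h1]
    push_cast
    ring

end MvPolynomial

/-! ### Generating functions of weighted sets -/

namespace WeightCount

/-- A weight function takes every value finitely often. -/
def FiniteFibers {K : Type*} (w : K → ℕ) : Prop := ∀ m, Finite {k // w k = m}

/-- The formal sum of `t ^ (w k)` over all `k`. -/
def genFun {K : Type*} (w : K → ℕ) : PowerSeries ℚ :=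
  PowerSeries.mk fun m => (Nat.card {k // w k = m} : ℚ)

variable {K L : Type*} {w : K → ℕ} {v : L → ℕ}

/-- The fibres of weight functions that correspond to each other. -/
def fiberEquiv (e : K ≃ L) (h : ∀ k, v (e k) = w k) (m : ℕ) : {k // w k = m} ≃ {k // v k = m} :=
  e.subtypeEquiv fun k => by rw [h]

theorem genFun_equiv (e : K ≃ L) (h : ∀ k, v (e k) = w k) : genFun w = genFun v := by
  ext m
  rw [genFun, genFun, PowerSeries.coeff_mk, PowerSeries.coeff_mk, Nat.card_congr (fiberEquiv e h m)]

/-- The fibres of a weight function on a disjoint union. -/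
def sumFiberEquiv (w : K → ℕ) (v : L → ℕ) (m : ℕ) :
    {k // Sum.elim w v k = m} ≃ {k // w k = m} ⊕ {k // v k = m} :=
  Equiv.subtypeSum

theorem FiniteFibers.sum (hw : FiniteFibers w) (hv : FiniteFibers v) :
    FiniteFibers (Sum.elim w v) := fun m =>
  have := hw m
  have := hv m
  Finite.of_equiv _ (sumFiberEquiv w v m).symm

theorem genFun_sum (hw : FiniteFibers w) (hv : FiniteFibers v) :
    genFun (Sum.elim w v) = genFun w + genFun v := by
  ext m
  have := hw m
  have := hv m
  rw [map_add]
  simp only [genFun, PowerSeries.coeff_mk]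
  rw [Nat.card_congr (sumFiberEquiv w v m), Nat.card_sum, Nat.cast_add]

/-- The fibres of a sum of weight functions on a product. -/
def prodFiberEquiv (w : K → ℕ) (v : L → ℕ) (m : ℕ) :
    {k : K × L // w k.1 + v k.2 = m} ≃
      Σ p : {p : ℕ × ℕ // p ∈ Finset.HasAntidiagonal.antidiagonal m}, {k // w k = p.1.1} × {k // v k = p.1.2} where
  toFun k := ⟨⟨(w k.1.1, v k.1.2), by rw [Finset.HasAntidiagonal.mem_antidiagonal]; exact k.2⟩,
    ⟨k.1.1, rfl⟩, ⟨k.1.2, rfl⟩⟩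
  invFun x := ⟨(x.2.1.1, x.2.2.1), by
    rw [x.2.1.2, x.2.2.2]; exact Finset.HasAntidiagonal.mem_antidiagonal.1 x.1.2⟩
  left_inv _ := rfl
  right_inv := by
    rintro ⟨⟨⟨i, j⟩, h⟩, ⟨k, hk⟩, ⟨l, hl⟩⟩
    obtain rfl : w k = i := hk
    obtain rfl : v l = j := hl
    rfl

theorem FiniteFibers.prod (hw : FiniteFibers w) (hv : FiniteFibers v) :
    FiniteFibers (fun k : K × L => w k.1 + v k.2) := fun m =>
  have := hw
  have : ∀ p : {p : ℕ × ℕ // p ∈ Finset.HasAntidiagonal.antidiagonal m},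
      Finite ({k // w k = p.1.1} × {k // v k = p.1.2}) := fun p =>
    have := hw p.1.1
    have := hv p.1.2
    inferInstance
  Finite.of_equiv _ (prodFiberEquiv w v m).symm

theorem genFun_prod (hw : FiniteFibers w) (hv : FiniteFibers v) :
    genFun (fun k : K × L => w k.1 + v k.2) = genFun w * genFun v := by
  ext m
  have : ∀ p : {p : ℕ × ℕ // p ∈ Finset.HasAntidiagonal.antidiagonal m},
      Finite ({k // w k = p.1.1} × {k // v k = p.1.2}) := fun p =>
    have := hw p.1.1
    have := hv p.1.2
    inferInstance
  rw [PowerSeries.coeff_mul]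
  simp only [genFun, PowerSeries.coeff_mk]
  rw [Nat.card_congr (prodFiberEquiv w v m), Nat.card_sigma, Nat.cast_sum]
  simp only [Nat.card_prod, Nat.cast_mul]
  exact Finset.sum_coe_sort (Finset.HasAntidiagonal.antidiagonal m) (fun p : ℕ × ℕ =>
    (Nat.card {k // w k = p.1} : ℚ) * (Nat.card {k // v k = p.2} : ℚ))

theorem FiniteFibers.add_const (hw : FiniteFibers w) (s : ℕ) :
    FiniteFibers (fun k => w k + s) := fun m =>
  have := hw (m - s)
  Finite.of_injective (fun k : {k // w k + s = m} => (⟨k.1, by have := k.2; omega⟩ :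
    {k // w k = m - s})) fun k l h => Subtype.ext (by simpa using h)

theorem genFun_add_const (s : ℕ) : genFun (fun k => w k + s) = PowerSeries.X ^ s * genFun w := by
  ext m
  rw [PowerSeries.coeff_X_pow_mul']
  simp only [genFun, PowerSeries.coeff_mk]
  split_ifs with h
  · congr 1
    exact Nat.card_congr (Equiv.subtypeEquivRight fun k => by omega)
  · have : IsEmpty {k // w k + s = m} := ⟨fun k => by have := k.2; omega⟩
    rw [Nat.card_of_isEmpty, Nat.cast_zero]

theorem finiteFibers_mul {a : ℕ} (ha : 0 < a) : FiniteFibers (fun n : ℕ => n * a) := fun m =>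
  have : Subsingleton {n : ℕ // n * a = m} :=
    ⟨fun k l => Subtype.ext (Nat.eq_of_mul_eq_mul_right ha (k.2.trans l.2.symm))⟩
  inferInstance

/-- The natural numbers are a point of weight zero together with a copy of themselves shifted by a.
-/
theorem one_sub_mul_genFun_mul {a : ℕ} (ha : 0 < a) :
    (1 - PowerSeries.X ^ a) * genFun (fun n : ℕ => n * a) = 1 := by
  have h : genFun (fun n : ℕ => n * a) = 1 + PowerSeries.X ^ a * genFun (fun n : ℕ => n * a) := by
    rw [← genFun_add_const]
    have h0 : FiniteFibers (fun _ : Unit => 0) := fun m => inferInstance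
    have h1 : genFun (fun _ : Unit => 0) = 1 := by
      ext m
      rw [genFun, PowerSeries.coeff_mk, PowerSeries.coeff_one]
      split_ifs with h
      · subst h
        simp
      · have : IsEmpty {k : Unit // 0 = m} := ⟨fun k => h k.2.symm⟩
        rw [Nat.card_of_isEmpty, Nat.cast_zero]
    rw [add_comm, ← h1, ← genFun_sum ((finiteFibers_mul ha).add_const a) h0]
    refine genFun_equiv Equiv.natEquivNatSumPUnit ?_
    intro k
    cases k with
    | zero => exact (zero_mul a).symm
    | succ n => exact (Nat.succ_mul n a).symm
  linear_combination h

theorem genFun_sigma_fin (e : ℕ → ℕ) :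
    genFun (fun j : Σ l, Fin (e l) => j.1) = PowerSeries.mk fun l => (e l : ℚ) := by
  ext m
  rw [genFun, PowerSeries.coeff_mk, PowerSeries.coeff_mk,
    Nat.card_congr (Equiv.sigmaSubtype m), Nat.card_fin]

theorem finiteFibers_sigma_fin (e : ℕ → ℕ) : FiniteFibers (fun j : Σ l, Fin (e l) => j.1) :=
  fun m => Finite.of_equiv _ (Equiv.sigmaSubtype (β := fun l => Fin (e l)) m).symm

/-- Monomials in three variables as triples of exponents. -/
def exponentsEquiv : (Fin 3 →₀ ℕ) ≃ (ℕ × ℕ) × ℕ where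
  toFun n := ((n 0, n 1), n 2)
  invFun x := Finsupp.equivFunOnFinite.symm ![x.1.1, x.1.2, x.2]
  left_inv n := by ext i; fin_cases i <;> rfl
  right_inv x := rfl

/-- The power series `∑ t ^ (weight of n)` over all monomials. -/
theorem one_sub_mul_genFun_weight {a b c : ℕ} (ha : 0 < a) (hb : 0 < b) (hc : 0 < c) :
    (1 - PowerSeries.X ^ a) * (1 - PowerSeries.X ^ b) * (1 - PowerSeries.X ^ c) *
      genFun (fun n : Fin 3 →₀ ℕ => Finsupp.weight ![a, b, c] n) = 1 := by
  have h : genFun (fun n : Fin 3 →₀ ℕ => Finsupp.weight ![a, b, c] n) =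
      genFun (fun n : ℕ => n * a) * genFun (fun n : ℕ => n * b) * genFun (fun n : ℕ => n * c) := by
    rw [← genFun_prod (finiteFibers_mul ha) (finiteFibers_mul hb),
      ← genFun_prod ((finiteFibers_mul ha).prod (finiteFibers_mul hb)) (finiteFibers_mul hc)]
    exact genFun_equiv exponentsEquiv fun n => (MvPolynomial.weight_fin_three a b c n).symm
  rw [h]
  have h1 := one_sub_mul_genFun_mul ha
  have h2 := one_sub_mul_genFun_mul hb
  have h3 := one_sub_mul_genFun_mul hc
  set A := genFun (fun n : ℕ => n * a)
  set B := genFun (fun n : ℕ => n * b)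
  set C := genFun (fun n : ℕ => n * c)
  linear_combination h1 * ((1 - PowerSeries.X ^ b) * B * ((1 - PowerSeries.X ^ c) * C)) +
    h2 * ((1 - PowerSeries.X ^ c) * C) + h3

theorem finiteFibers_weight {a b c : ℕ} (ha : 0 < a) (hb : 0 < b) (hc : 0 < c) :
    FiniteFibers (fun n : Fin 3 →₀ ℕ => Finsupp.weight ![a, b, c] n) := fun m =>
  MvPolynomial.finite_weight_eq (by
    intro i; fin_cases i
    · exact ha.ne'
    · exact hb.ne'
    · exact hc.ne') m

/-- The index set of the basis adapted to the operators: triples `(r, s, j)`, monomials in `x, y`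
and all monomials. -/
abbrev BasisIndex (e : ℕ → ℕ) : Type :=
  ((ℕ × ℕ) × (Σ l, Fin (e l))) ⊕ ((ℕ × ℕ) ⊕ (Fin 3 →₀ ℕ))

/-- The weights of the elements of the adapted basis. -/
def basisWeight (a b c d : ℕ) (e : ℕ → ℕ) : BasisIndex e → ℕ :=
  Sum.elim (fun k => (k.1.1 * (d - a) + k.1.2 * (d - b)) + k.2.1)
    (Sum.elim (fun k => (k.1 * a + k.2 * b) + (d - c)) fun n => Finsupp.weight ![a, b, c] n + d)

theorem finiteFibers_basisWeight {a b c d : ℕ} (ha : 0 < a) (hab : a ≤ b) (hbc : b ≤ c)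
    (hcd : c < d) (e : ℕ → ℕ) : FiniteFibers (basisWeight a b c d e) :=
  (((finiteFibers_mul (by omega)).prod (finiteFibers_mul (by omega))).prod
    (finiteFibers_sigma_fin e)).sum
    ((((finiteFibers_mul ha).prod (finiteFibers_mul (by omega))).add_const _).sum
      ((finiteFibers_weight ha (by omega) (by omega)).add_const _))

/-- This count turns the spanning family into a basis. If R is the series of all monomials, the
elements A^r B^s e_j contribute (1 - t^(d-c))R, the elements Q_z x^i y^j contribute t^(d-c)(1 -
t^c)R, the multiples of Q contribute t^d R, and these add up to R. -/
theorem card_basisWeight {a b c d : ℕ} (ha : 0 < a) (hab : a ≤ b) (hbc : b ≤ c) (hcd : c < d)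
    (e : ℕ → ℕ) (he : (PowerSeries.mk fun l => (e l : ℚ)) = (1 - PowerSeries.X ^ (d - c)) *
      ((1 - PowerSeries.X ^ (d - b)) * ((1 - PowerSeries.X ^ (d - a)) *
        PowerSeries.mk fun m => (MvPolynomial.monomialCount ![a, b, c] m : ℚ)))) (m : ℕ) :
    Nat.card {k // basisWeight a b c d e k = m} = MvPolynomial.monomialCount ![a, b, c] m := by
  have hb : 0 < b := by omega
  have hc : 0 < c := by omega
  have hda : 0 < d - a := by omega
  have hdb : 0 < d - b := by omega
  have hR : (PowerSeries.mk fun m => (MvPolynomial.monomialCount ![a, b, c] m : ℚ)) =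
      genFun (fun n : Fin 3 →₀ ℕ => Finsupp.weight ![a, b, c] n) := rfl
  have key : genFun (basisWeight a b c d e) =
      genFun (fun n : Fin 3 →₀ ℕ => Finsupp.weight ![a, b, c] n) := by
    unfold basisWeight
    rw [genFun_sum (((finiteFibers_mul hda).prod (finiteFibers_mul hdb)).prod
      (finiteFibers_sigma_fin e)) ((((finiteFibers_mul ha).prod (finiteFibers_mul hb)).add_const _).sum
      ((finiteFibers_weight ha hb hc).add_const _)),
      genFun_sum (((finiteFibers_mul ha).prod (finiteFibers_mul hb)).add_const _)
      ((finiteFibers_weight ha hb hc).add_const _), genFun_add_const, genFun_add_const,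
      genFun_prod (w := fun k : ℕ × ℕ => k.1 * (d - a) + k.2 * (d - b))
        ((finiteFibers_mul hda).prod (finiteFibers_mul hdb)) (finiteFibers_sigma_fin e),
      genFun_prod (finiteFibers_mul hda) (finiteFibers_mul hdb),
      genFun_prod (finiteFibers_mul ha) (finiteFibers_mul hb), genFun_sigma_fin, he, hR]
    have h1 := one_sub_mul_genFun_mul ha
    have h2 := one_sub_mul_genFun_mul hb
    have h3 := one_sub_mul_genFun_mul hda
    have h4 := one_sub_mul_genFun_mul hdb
    have h5 := one_sub_mul_genFun_weight ha hb hc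
    have h6 : (PowerSeries.X : PowerSeries ℚ) ^ d = PowerSeries.X ^ (d - c) * PowerSeries.X ^ c := by
      rw [← pow_add]; congr 1; omega
    set R := genFun (fun n : Fin 3 →₀ ℕ => Finsupp.weight ![a, b, c] n)
    set A := genFun (fun n : ℕ => n * a)
    set B := genFun (fun n : ℕ => n * b)
    set A' := genFun (fun n : ℕ => n * (d - a))
    set B' := genFun (fun n : ℕ => n * (d - b))
    have h7 : A * B = (1 - PowerSeries.X ^ c) * R := by
      linear_combination (-A * B) * h5 + (1 - PowerSeries.X ^ c) * R * (1 - PowerSeries.X ^ b) * B * h1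
        + (1 - PowerSeries.X ^ c) * R * h2
    rw [h7, h6]
    linear_combination (1 - PowerSeries.X ^ (d - c)) * R *
      ((1 - PowerSeries.X ^ (d - b)) * B' * h3 + h4)
  have := congrArg (PowerSeries.coeff m) key
  simp only [genFun, PowerSeries.coeff_mk] at this
  exact_mod_cast this

end WeightCount

/-! ### The character series -/

/-- A power series in one variable as a power series in `t = X 0`. -/
def liftT (f : PowerSeries ℚ) : MvPowerSeries (Fin 2) ℚ :=
  fun n => if n 1 = 0 then PowerSeries.coeff (n 0) f else 0

theorem coeff_liftT (f : PowerSeries ℚ) (n : Fin 2 →₀ ℕ) :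
    MvPowerSeries.coeff n (liftT f) = if n 1 = 0 then PowerSeries.coeff (n 0) f else 0 := rfl

theorem liftT_one : liftT 1 = 1 := by
  classical
  ext n
  rw [coeff_liftT, MvPowerSeries.coeff_one, PowerSeries.coeff_one]
  have : n = 0 ↔ n 1 = 0 ∧ n 0 = 0 :=
    ⟨fun h => by simp [h], fun h => by ext i; fin_cases i <;> simp [h.1, h.2]⟩
  simp only [this]
  split_ifs <;> simp_all

theorem liftT_one_sub_mul (a : ℕ) (f : PowerSeries ℚ) :
    liftT ((1 - PowerSeries.X ^ a) * f) = (1 - MvPowerSeries.X 0 ^ a) * liftT f := by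
  classical
  ext n
  rw [sub_mul, sub_mul, one_mul, one_mul, map_sub, MvPowerSeries.X_pow_eq,
    MvPowerSeries.coeff_monomial_mul, one_mul, coeff_liftT, coeff_liftT, coeff_liftT, map_sub,
    PowerSeries.coeff_X_pow_mul']
  simp only [Finsupp.single_le_iff, Finsupp.coe_tsub, Pi.sub_apply, Finsupp.single_eq_same, ne_eq, one_ne_zero,
    not_false_eq_true, Finsupp.single_eq_of_ne, tsub_zero]
  split_ifs <;> simp

/-- The power series `∑ e(l) t ^ (l + k u) s ^ k`. -/
def geometricSeries (u : ℕ) (f : PowerSeries ℚ) : MvPowerSeries (Fin 2) ℚ :=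
  fun n => if n 1 * u ≤ n 0 then PowerSeries.coeff (n 0 - n 1 * u) f else 0

theorem coeff_geometricSeries (u : ℕ) (f : PowerSeries ℚ) (n : Fin 2 →₀ ℕ) :
    MvPowerSeries.coeff n (geometricSeries u f) =
      if n 1 * u ≤ n 0 then PowerSeries.coeff (n 0 - n 1 * u) f else 0 := rfl

theorem geometricSeries_mul (u : ℕ) (f : PowerSeries ℚ) :
    (1 - MvPowerSeries.X 0 ^ u * MvPowerSeries.X 1) * geometricSeries u f = liftT f := by
  classical
  ext n
  have : (MvPowerSeries.X 0 ^ u * MvPowerSeries.X 1 : MvPowerSeries (Fin 2) ℚ) =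
      MvPowerSeries.monomial (Finsupp.single 0 u + Finsupp.single 1 1) 1 := by
    rw [MvPowerSeries.X_pow_eq, MvPowerSeries.X, MvPowerSeries.monomial_mul_monomial, one_mul]
  rw [this, sub_mul, one_mul, map_sub, MvPowerSeries.coeff_monomial_mul, one_mul,
    coeff_geometricSeries, coeff_geometricSeries, coeff_liftT]
  have hle : Finsupp.single 0 u + Finsupp.single 1 1 ≤ n ↔ u ≤ n 0 ∧ 1 ≤ n 1 := by
    constructor
    · intro h
      exact ⟨by simpa using h 0, by simpa using h 1⟩
    · rintro ⟨h0, h1⟩ i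
      fin_cases i
      · simpa using h0
      · simpa using h1
  simp only [hle, Finsupp.coe_tsub, Pi.sub_apply, Finsupp.coe_add, Pi.add_apply,
    Finsupp.single_eq_same]
  simp
  obtain h | ⟨k, h⟩ : n 1 = 0 ∨ ∃ k, n 1 = k + 1 := by
    cases h : n 1 with
    | zero => simp
    | succ k => simp
  · simp [h]
  · rw [h, add_mul, one_mul]
    by_cases h1 : k * u + u ≤ n 0
    · have h2 : u ≤ n 0 := by nlinarith
      have h3 : k * u ≤ n 0 - u := by omega
      rw [if_pos h1, if_pos ⟨h2, by omega⟩, if_neg (Nat.succ_ne_zero k), Nat.add_sub_cancel,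
        if_pos h3, Nat.sub_sub, add_comm (k * u), sub_self]
    · have h3 : ¬ (u ≤ n 0 ∧ k * u ≤ n 0 - u) := by omega
      simp [h1]
      intro h4 h5
      exact absurd ⟨h4, h5⟩ h3

namespace QHSurface

/-- The factors in t alone make up f, because the monomial count is the expansion of 1/((1 - t^a)(1
- t^b)(1 - t^c)); the remaining factor is a geometric series in t^(d-a) s. -/
theorem characterSeries_eq (S : QHSurface) (f : PowerSeries ℚ)
    (hf : f = (1 - PowerSeries.X ^ (S.d - S.c)) * ((1 - PowerSeries.X ^ (S.d - S.b)) *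
      ((1 - PowerSeries.X ^ (S.d - S.a)) *
        PowerSeries.mk fun m => (MvPolynomial.monomialCount ![S.a, S.b, S.c] m : ℚ)))) :
    S.characterSeries = geometricSeries (S.d - S.a) f := by
  have ha := S.a_pos
  have hab := S.a_le_b
  have hbc := S.b_le_c
  unfold characterSeries
  symm
  rw [MvPowerSeries.eq_mul_inv_iff_mul_eq]
  · have h1 := geometricSeries_mul (S.d - S.a) f
    have h2 := congrArg liftT (WeightCount.one_sub_mul_genFun_weight ha (b := S.b) (by omega)
      (c := S.c) (by omega))
    rw [mul_assoc, mul_assoc, liftT_one_sub_mul, liftT_one_sub_mul, liftT_one_sub_mul,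
      liftT_one] at h2
    have h3 := congrArg liftT hf
    rw [liftT_one_sub_mul, liftT_one_sub_mul, liftT_one_sub_mul] at h3
    change liftT f = _ * (_ * (_ * liftT (WeightCount.genFun _))) at h3
    rw [h3] at h1
    set G := geometricSeries (S.d - S.a) f
    set R := liftT (WeightCount.genFun fun n : Fin 3 →₀ ℕ => Finsupp.weight ![S.a, S.b, S.c] n)
    linear_combination (1 - MvPowerSeries.X 0 ^ S.a) * (1 - MvPowerSeries.X 0 ^ S.b) *
      (1 - MvPowerSeries.X 0 ^ S.c) * h1 + (1 - MvPowerSeries.X 0 ^ (S.d - S.a)) *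
      (1 - MvPowerSeries.X 0 ^ (S.d - S.b)) * (1 - MvPowerSeries.X 0 ^ (S.d - S.c)) * h2
  · simp only [map_mul, map_sub, map_one, map_pow, MvPowerSeries.constantCoeff_X]
    simp [zero_pow (show S.a ≠ 0 by omega), zero_pow (show S.b ≠ 0 by omega),
      zero_pow (show S.c ≠ 0 by omega)]

end QHSurface

/-! ### The weight grading of power series -/

namespace MvPowerSeries

variable {σ : Type*} (w : σ → ℕ)

/-- The power series with terms of weight at least `M`. -/
def weightOrd (M : ℕ) : Submodule ℂ (MvPowerSeries σ ℂ) where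
  carrier := {f | ∀ n, Finsupp.weight w n < M → coeff n f = 0}
  zero_mem' := fun n _ => by simp
  add_mem' := fun hf hg n hn => by rw [map_add, hf n hn, hg n hn, add_zero]
  smul_mem' := fun r f hf n hn => by rw [map_smul, hf n hn, smul_zero]

/-- The power series all of whose terms have weight `m`. -/
def weightHom (m : ℕ) : Submodule ℂ (MvPowerSeries σ ℂ) where
  carrier := {f | ∀ n, Finsupp.weight w n ≠ m → coeff n f = 0}
  zero_mem' := fun n _ => by simp
  add_mem' := fun hf hg n hn => by rw [map_add, hf n hn, hg n hn, add_zero]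
  smul_mem' := fun r f hf n hn => by rw [map_smul, hf n hn, smul_zero]

/-- The component of weight `m`. -/
def weightComp (m : ℕ) : Module.End ℂ (MvPowerSeries σ ℂ) where
  toFun f := fun n => if Finsupp.weight w n = m then coeff n f else 0
  map_add' f g := by
    funext n
    change (if Finsupp.weight w n = m then coeff n (f + g) else 0) =
      (if Finsupp.weight w n = m then _ else _) + (if Finsupp.weight w n = m then _ else _)
    split_ifs <;> simp
  map_smul' r f := by
    funext n
    change (if Finsupp.weight w n = m then coeff n (r • f) else 0) =
      r * (if Finsupp.weight w n = m then _ else _)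
    split_ifs <;> simp

variable {w}

theorem coeff_weightComp (m : ℕ) (f : MvPowerSeries σ ℂ) (n : σ →₀ ℕ) :
    coeff n (weightComp w m f) = if Finsupp.weight w n = m then coeff n f else 0 := rfl

theorem weightComp_mem (m : ℕ) (f : MvPowerSeries σ ℂ) : weightComp w m f ∈ weightHom w m :=
  fun n hn => by rw [coeff_weightComp, if_neg hn]

theorem weightComp_of_mem {m : ℕ} {f : MvPowerSeries σ ℂ} (hf : f ∈ weightHom w m) :
    weightComp w m f = f := by
  ext n
  rw [coeff_weightComp]
  split_ifs with h
  · rfl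
  · exact (hf n h).symm

theorem weightComp_of_mem_of_ne {m l : ℕ} {f : MvPowerSeries σ ℂ} (hf : f ∈ weightHom w m)
    (h : m ≠ l) : weightComp w l f = 0 := by
  ext n
  rw [coeff_weightComp]
  split_ifs with h'
  · rw [map_zero, hf n (by omega)]
  · simp

theorem weightComp_of_mem_weightOrd {m l : ℕ} {f : MvPowerSeries σ ℂ} (hf : f ∈ weightOrd w m)
    (h : l < m) : weightComp w l f = 0 := by
  ext n
  rw [coeff_weightComp]
  split_ifs with h'
  · rw [map_zero, hf n (by omega)]
  · simp

theorem weightOrd_mono {M N : ℕ} (h : M ≤ N) : weightOrd (σ := σ) w N ≤ weightOrd w M :=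
  fun _ hf n hn => hf n (hn.trans_le h)

theorem weightHom_le_weightOrd {m M : ℕ} (h : M ≤ m) : weightHom (σ := σ) w m ≤ weightOrd w M :=
  fun _ hf n hn => hf n (by omega)

theorem eq_zero_of_forall_mem_weightOrd {f : MvPowerSeries σ ℂ} (h : ∀ M, f ∈ weightOrd w M) :
    f = 0 := by
  ext n
  exact h (Finsupp.weight w n + 1) n (by omega)

theorem sub_sum_weightComp_mem (M : ℕ) (f : MvPowerSeries σ ℂ) :
    f - ∑ m ∈ Finset.range M, weightComp w m f ∈ weightOrd w M := by
  intro n hn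
  simp only [map_sub, map_sum, coeff_weightComp]
  rw [Finset.sum_ite_eq, if_pos (Finset.mem_range.2 hn), sub_self]

theorem monomial_mem_weightHom (n : σ →₀ ℕ) (r : ℂ) :
    monomial n r ∈ weightHom w (Finsupp.weight w n) := by
  classical
  intro k hk
  rw [coeff_monomial, if_neg]
  rintro rfl
  exact hk rfl

theorem coe_mem_weightHom {p : MvPolynomial σ ℂ} {m : ℕ} (hp : p.IsWeightedHomogeneous w m) :
    (p : MvPowerSeries σ ℂ) ∈ weightHom w m := by
  intro n hn
  rw [MvPolynomial.coeff_coe]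
  by_contra h
  exact hn (hp h)

section Finite

variable [Finite σ] (hw : ∀ i, w i ≠ 0)
include hw

theorem exists_coe_of_mem_weightHom {m : ℕ} {f : MvPowerSeries σ ℂ} (hf : f ∈ weightHom w m) :
    ∃ p : MvPolynomial σ ℂ, p.IsWeightedHomogeneous w m ∧ (p : MvPowerSeries σ ℂ) = f := by
  classical
  have hfin := Finsupp.finite_of_nat_weight_eq w hw m
  refine ⟨∑ n ∈ hfin.toFinset, MvPolynomial.monomial n (coeff n f), ?_, ?_⟩
  · refine MvPolynomial.IsWeightedHomogeneous.sum _ _ _ fun n hn => ?_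
    exact MvPolynomial.isWeightedHomogeneous_monomial _ _ _ (hfin.mem_toFinset.1 hn)
  · ext n
    rw [MvPolynomial.coeff_coe, MvPolynomial.coeff_sum]
    simp only [MvPolynomial.coeff_monomial]
    rw [Finset.sum_ite_eq']
    split_ifs with h
    · rfl
    · exact (hf n fun h' => h (hfin.mem_toFinset.2 h')).symm

theorem weightHom_le_span_monomial (m : ℕ) :
    weightHom w m ≤ Submodule.span ℂ (Set.range fun n : σ →₀ ℕ => (monomial n (1 : ℂ))) := by
  classical
  intro f hf
  have hfin := Finsupp.finite_of_nat_weight_eq w hw m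
  have : f = ∑ n ∈ hfin.toFinset, coeff n f • monomial n (1 : ℂ) := by
    ext n
    simp only [map_sum, map_smul, coeff_monomial, smul_eq_mul, mul_ite, mul_one, mul_zero]
    rw [Finset.sum_ite_eq]
    split_ifs with h
    · rfl
    · exact hf n fun h' => h (hfin.mem_toFinset.2 h')
  rw [this]
  exact Submodule.sum_mem _ fun n _ => Submodule.smul_mem _ _ (Submodule.subset_span ⟨n, rfl⟩)

theorem finrank_weightHom (m : ℕ) :
    Module.Finite ℂ (weightHom w m) ∧
      Module.finrank ℂ (weightHom w m) = Nat.card {n : σ →₀ ℕ // Finsupp.weight w n = m} := by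
  have hfin : Finite {n : σ →₀ ℕ // Finsupp.weight w n = m} :=
    (Finsupp.finite_of_nat_weight_eq w hw m).to_subtype
  let φ : ({n : σ →₀ ℕ // Finsupp.weight w n = m} → ℂ) ≃ₗ[ℂ] weightHom w m :=
    { toFun := fun g => ⟨fun n => if h : Finsupp.weight w n = m then g ⟨n, h⟩ else 0, fun n hn => by
        change (if h : Finsupp.weight w n = m then _ else _) = _
        rw [dif_neg hn]⟩
      invFun := fun f n => coeff n.1 f.1
      map_add' := fun g g' => by
        ext n
        change (if h : Finsupp.weight w n = m then (g + g') ⟨n, h⟩ else 0) =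
          (if h : Finsupp.weight w n = m then g ⟨n, h⟩ else 0) +
          (if h : Finsupp.weight w n = m then g' ⟨n, h⟩ else 0)
        split_ifs <;> simp
      map_smul' := fun r g => by
        ext n
        change (if h : Finsupp.weight w n = m then (r • g) ⟨n, h⟩ else 0) =
          r * (if h : Finsupp.weight w n = m then g ⟨n, h⟩ else 0)
        split_ifs <;> simp
      left_inv := fun g => by
        funext n
        change (if h : Finsupp.weight w n.1 = m then _ else _) = _
        rw [dif_pos n.2]
      right_inv := fun f => by
        ext n
        change (if h : Finsupp.weight w n = m then _ else _) = _
        split_ifs with h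
        · rfl
        · exact (f.2 n h).symm }
  refine ⟨Module.Finite.equiv φ, ?_⟩
  have := Fintype.ofFinite {n : σ →₀ ℕ // Finsupp.weight w n = m}
  rw [← φ.finrank_eq, Module.finrank_fintype_fun_eq_card, Nat.card_eq_fintype_card]

end Finite

/-! #### Homogeneous operators -/

variable (w) in
/-- The operator `T` shifts the weights by `s`. -/
def IsHomOp (s : ℤ) (T : Module.End ℂ (MvPowerSeries σ ℂ)) : Prop :=
  ∀ f n, (∀ n', (Finsupp.weight w n' : ℤ) + s = Finsupp.weight w n → coeff n' f = 0) →
    coeff n (T f) = 0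

variable {s t : ℤ} {T U : Module.End ℂ (MvPowerSeries σ ℂ)}

theorem IsHomOp.mul (hT : IsHomOp w s T) (hU : IsHomOp w t U) : IsHomOp w (s + t) (T * U) :=
  fun f n h => hT _ n fun n' hn' => hU f n' fun k hk => h k (by omega)

theorem IsHomOp.sub (hT : IsHomOp w s T) (hU : IsHomOp w s U) : IsHomOp w s (T - U) :=
  fun f n h => by rw [LinearMap.sub_apply, map_sub, hT f n h, hU f n h, sub_zero]

theorem isHomOp_one : IsHomOp w 0 (1 : Module.End ℂ (MvPowerSeries σ ℂ)) :=
  fun _ n h => h n (by simp)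

theorem IsHomOp.pow (hT : IsHomOp w s T) (k : ℕ) : IsHomOp w (k * s) (T ^ k) := by
  induction k with
  | zero => simpa using isHomOp_one
  | succ k ih =>
    rw [pow_succ]
    convert ih.mul hT using 1
    push_cast
    ring

theorem IsHomOp.map_weightHom (hT : IsHomOp w s T) {m l : ℕ} (h : (m : ℤ) + s = l)
    {f : MvPowerSeries σ ℂ} (hf : f ∈ weightHom w m) : T f ∈ weightHom w l :=
  fun n hn => hT f n fun n' hn' => hf n' fun h' => hn (by omega)

theorem IsHomOp.map_weightOrd (hT : IsHomOp w s T) {m l : ℕ} (h : (l : ℤ) ≤ m + s)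
    {f : MvPowerSeries σ ℂ} (hf : f ∈ weightOrd w m) : T f ∈ weightOrd w l :=
  fun n hn => hT f n fun n' hn' => hf n' (by omega)

theorem IsHomOp.map_weightHom_eq_zero (hT : IsHomOp w s T) {m : ℕ} (h : (m : ℤ) + s < 0)
    {f : MvPowerSeries σ ℂ} (hf : f ∈ weightHom w m) : T f = 0 := by
  ext n
  exact hT f n fun n' hn' => hf n' fun h' => by omega

theorem isHomOp_mulLeft {s : ℕ} {p : MvPowerSeries σ ℂ} (hp : p ∈ weightHom w s) :
    IsHomOp w s (LinearMap.mulLeft ℂ p) := by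
  classical
  intro f n h
  rw [LinearMap.mulLeft_apply, coeff_mul]
  refine Finset.sum_eq_zero fun x hx => ?_
  rw [Finset.HasAntidiagonal.mem_antidiagonal] at hx
  by_cases h1 : Finsupp.weight w x.1 = s
  · rw [h x.2, mul_zero]
    rw [← hx, map_add, h1]
    push_cast
    ring
  · rw [hp _ h1, zero_mul]

theorem isHomOp_pderiv (i : σ) :
    IsHomOp w (-(w i)) (pderiv ℂ i : Derivation ℂ _ (MvPowerSeries σ ℂ)).toLinearMap := by
  intro f n h
  change coeff n (pderiv ℂ i f) = 0
  rw [coeff_pderiv, h _ (by simp [Finsupp.weight_apply, Finsupp.sum_add_index', add_mul]), zero_mul]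

/-! #### Convergent sums -/

variable (w) in
/-- The power series `f` is the sum of the family `F` in the weight topology. -/
def HasWeightSum {ι : Type*} (F : ι → MvPowerSeries σ ℂ) (f : MvPowerSeries σ ℂ) : Prop :=
  ∀ M, ∃ s : Finset ι, ∀ t, s ⊆ t → f - ∑ i ∈ t, F i ∈ weightOrd w M

variable {ι κ : Type*} {F : ι → MvPowerSeries σ ℂ} {f : MvPowerSeries σ ℂ}

theorem HasWeightSum.unique {g : MvPowerSeries σ ℂ} (hf : HasWeightSum w F f)
    (hg : HasWeightSum w F g) : f = g := by
  classical
  rw [← sub_eq_zero]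
  refine eq_zero_of_forall_mem_weightOrd (w := w) fun M => ?_
  obtain ⟨s, hs⟩ := hf M
  obtain ⟨t, ht⟩ := hg M
  have := Submodule.sub_mem _ (hs (s ∪ t) Finset.subset_union_left)
    (ht (s ∪ t) Finset.subset_union_right)
  rwa [sub_sub_sub_cancel_right] at this

theorem exists_hasWeightSum (h : ∀ M, {i | F i ∉ weightOrd w M}.Finite) :
    ∃ f, HasWeightSum w F f := by
  let f : MvPowerSeries σ ℂ := fun n =>
    ∑ i ∈ (h (Finsupp.weight w n + 1)).toFinset, coeff n (F i)
  refine ⟨f, fun M => ⟨(h M).toFinset, fun t ht n hn => ?_⟩⟩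
  rw [map_sub, map_sum, sub_eq_zero]
  change ∑ i ∈ (h (Finsupp.weight w n + 1)).toFinset, coeff n (F i) = _
  refine Finset.sum_subset ?_ fun i _ hi => ?_
  · refine Finset.Subset.trans ?_ ht
    intro i hi
    rw [Set.Finite.mem_toFinset] at hi ⊢
    exact fun h' => hi (weightOrd_mono hn h')
  · rw [Set.Finite.mem_toFinset, Set.mem_ofPred_eq, not_not] at hi
    exact hi n (by omega)

theorem HasWeightSum.add {G : ι → MvPowerSeries σ ℂ} {g : MvPowerSeries σ ℂ}
    (hf : HasWeightSum w F f) (hg : HasWeightSum w G g) :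
    HasWeightSum w (fun i => F i + G i) (f + g) := by
  classical
  intro M
  obtain ⟨s, hs⟩ := hf M
  obtain ⟨s', hs'⟩ := hg M
  refine ⟨s ∪ s', fun t ht => ?_⟩
  rw [Finset.sum_add_distrib, add_sub_add_comm]
  exact Submodule.add_mem _ (hs t (Finset.union_subset_left ht))
    (hs' t (Finset.union_subset_right ht))

variable (w) in
/-- Continuity of an operator for the weight topology. -/
def WeightContinuous (T : Module.End ℂ (MvPowerSeries σ ℂ)) : Prop :=
  ∀ M, ∃ N, ∀ f ∈ weightOrd w N, T f ∈ weightOrd w M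

theorem IsHomOp.weightContinuous (hT : IsHomOp w s T) : WeightContinuous w T :=
  fun M => ⟨(M - s).toNat, fun _ hf => hT.map_weightOrd (by omega) hf⟩

theorem WeightContinuous.sub (hT : WeightContinuous w T) (hU : WeightContinuous w U) :
    WeightContinuous w (T - U) := fun M => by
  obtain ⟨N, hN⟩ := hT M
  obtain ⟨N', hN'⟩ := hU M
  exact ⟨max N N', fun f hf => Submodule.sub_mem _ (hN f (weightOrd_mono (le_max_left _ _) hf))
    (hN' f (weightOrd_mono (le_max_right _ _) hf))⟩

theorem WeightContinuous.smul (r : ℂ) (hT : WeightContinuous w T) :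
    WeightContinuous w (r • T) := fun M => by
  obtain ⟨N, hN⟩ := hT M
  exact ⟨N, fun f hf => Submodule.smul_mem _ _ (hN f hf)⟩

theorem HasWeightSum.map (hT : WeightContinuous w T) (hf : HasWeightSum w F f) :
    HasWeightSum w (fun i => T (F i)) (T f) := by
  intro M
  obtain ⟨N, hN⟩ := hT M
  obtain ⟨s, hs⟩ := hf N
  refine ⟨s, fun t ht => ?_⟩
  rw [← map_sum, ← map_sub]
  exact hN _ (hs t ht)

theorem HasWeightSum.sum_elim {G : κ → MvPowerSeries σ ℂ} {g : MvPowerSeries σ ℂ}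
    (hf : HasWeightSum w F f) (hg : HasWeightSum w G g) :
    HasWeightSum w (Sum.elim F G) (f + g) := by
  classical
  intro M
  obtain ⟨s, hs⟩ := hf M
  obtain ⟨s', hs'⟩ := hg M
  refine ⟨s.disjSum s', fun t ht => ?_⟩
  rw [← Finset.toLeft_disjSum_toRight (u := t), Finset.sum_disjSum]
  simp only [Sum.elim_inl, Sum.elim_inr]
  rw [add_sub_add_comm]
  refine Submodule.add_mem _ (hs _ fun i hi => ?_) (hs' _ fun i hi => ?_)
  · exact Finset.mem_toLeft.2 (ht (Finset.inl_mem_disjSum.2 hi))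
  · exact Finset.mem_toRight.2 (ht (Finset.inr_mem_disjSum.2 hi))

variable (w) in
/-- Continuity of a functional for the weight topology. -/
def WeightContinuousFunctional (l : MvPowerSeries σ ℂ →ₗ[ℂ] ℂ) : Prop :=
  ∃ M, ∀ f ∈ weightOrd w M, l f = 0

theorem WeightContinuousFunctional.comp {l : MvPowerSeries σ ℂ →ₗ[ℂ] ℂ}
    (hl : WeightContinuousFunctional w l) (hT : WeightContinuous w T) :
    WeightContinuousFunctional w (l ∘ₗ T) := by
  obtain ⟨M, hM⟩ := hl
  obtain ⟨N, hN⟩ := hT M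
  exact ⟨N, fun f hf => hM _ (hN f hf)⟩

/-- A continuous functional kills all terms of high weight, and what remains of a series is a finite
sum of homogeneous components in the span of b. Identities between functionals can thus be checked
on any homogeneous spanning family, and different families are convenient for different identities.
-/
theorem WeightContinuousFunctional.eq_zero {l : MvPowerSeries σ ℂ →ₗ[ℂ] ℂ}
    (hl : WeightContinuousFunctional w l) {b : κ → MvPowerSeries σ ℂ}
    (hb : ∀ m, weightHom w m ≤ Submodule.span ℂ (Set.range b)) (h : ∀ k, l (b k) = 0) :
    l = 0 := by
  obtain ⟨M, hM⟩ := hl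
  ext f
  have h1 : Submodule.span ℂ (Set.range b) ≤ LinearMap.ker l := by
    rw [Submodule.span_le]
    rintro _ ⟨k, rfl⟩
    exact h k
  have h2 := hM _ (sub_sum_weightComp_mem M f)
  rw [map_sub, map_sum, Finset.sum_eq_zero, sub_zero] at h2
  · exact h2
  · intro m _
    exact h1 (hb m (weightComp_mem m f))

theorem HasWeightSum.functional_eq {l : MvPowerSeries σ ℂ →ₗ[ℂ] ℂ}
    (hl : WeightContinuousFunctional w l) (hf : HasWeightSum w F f) (i : ι)
    (h : ∀ j, j ≠ i → l (F j) = 0) : l f = l (F i) := by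
  classical
  obtain ⟨M, hM⟩ := hl
  obtain ⟨s, hs⟩ := hf M
  have := hM _ (hs (insert i s) (Finset.subset_insert _ _))
  rw [map_sub, map_sum, Finset.sum_eq_single i (fun j _ hj => h j hj)
    (fun h => absurd (Finset.mem_insert_self i s) h), sub_eq_zero] at this
  exact this

theorem span_range_inf_weightHom_le {b : κ → MvPowerSeries σ ℂ} {v : κ → ℕ}
    (hb : ∀ k, b k ∈ weightHom w (v k)) (m : ℕ) {f : MvPowerSeries σ ℂ}
    (hf : f ∈ Submodule.span ℂ (Set.range b)) :
    weightComp w m f ∈ Submodule.span ℂ (Set.range fun k : {k // v k = m} => b k.1) := by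
  induction hf using Submodule.span_induction with
  | mem x hx =>
    obtain ⟨k, rfl⟩ := hx
    by_cases h : v k = m
    · subst h
      rw [weightComp_of_mem (hb k)]
      exact Submodule.subset_span ⟨⟨k, rfl⟩, rfl⟩
    · rw [weightComp_of_mem_of_ne (hb k) h]
      exact Submodule.zero_mem _
  | zero => rw [map_zero]; exact Submodule.zero_mem _
  | add x y _ _ hx hy => rw [map_add]; exact Submodule.add_mem _ hx hy
  | smul r x _ hx => rw [map_smul]; exact Submodule.smul_mem _ _ hx

/-- In each weight the vectors b k span a space whose dimension is their number, so they are a basis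
of it. The coordinate `L k` is the basis coordinate of the component of weight `v k`, and finiteness
in every weight makes the expansion converge. -/
theorem exists_coordinates [Finite σ] (hw : ∀ i, w i ≠ 0) {b : κ → MvPowerSeries σ ℂ} {v : κ → ℕ}
    (hb : ∀ k, b k ∈ weightHom w (v k)) (hv : ∀ m, Finite {k // v k = m})
    (hspan : ∀ m, weightHom w m ≤ Submodule.span ℂ (Set.range b))
    (hcard : ∀ m, Nat.card {k // v k = m} = Nat.card {n : σ →₀ ℕ // Finsupp.weight w n = m}) :
    ∃ L : κ → MvPowerSeries σ ℂ →ₗ[ℂ] ℂ,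
      (∀ k f, L k f = L k (weightComp w (v k) f)) ∧
      (∀ k, L k (b k) = 1) ∧ (∀ k k', k' ≠ k → L k (b k') = 0) ∧
      ∀ f, HasWeightSum w (fun k => L k f • b k) f := by
  classical
  have key : ∀ m, ∃ B : Module.Basis {k // v k = m} ℂ (weightHom w m), ∀ k, (B k).1 = b k.1 := by
    intro m
    have := Fintype.ofFinite {k // v k = m}
    obtain ⟨h1, h2⟩ := finrank_weightHom hw m
    let c : {k // v k = m} → weightHom w m := fun k => ⟨b k.1, by
      have := hb k.1
      rwa [k.2] at this⟩
    have hc : ⊤ ≤ Submodule.span ℂ (Set.range c) := by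
      rintro ⟨f, hf⟩ -
      have h3 := span_range_inf_weightHom_le hb m (hspan m hf)
      rw [weightComp_of_mem hf] at h3
      have h4 : (Set.range fun k : {k // v k = m} => b k.1) =
          (weightHom w m).subtype '' Set.range c := by
        rw [← Set.range_comp]
        rfl
      rw [h4, ← Submodule.map_span] at h3
      obtain ⟨g, hg, hgf⟩ := h3
      have : g = ⟨f, hf⟩ := Subtype.ext hgf
      rwa [← this]
    have h5 : Fintype.card {k // v k = m} = Module.finrank ℂ (weightHom w m) := by
      rw [h2, ← hcard, Nat.card_eq_fintype_card]
    refine ⟨basisOfTopLeSpanOfCardEqFinrank c hc h5, fun k => ?_⟩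
    rw [coe_basisOfTopLeSpanOfCardEqFinrank]
  choose B hB using key
  let proj : ∀ m, MvPowerSeries σ ℂ →ₗ[ℂ] weightHom w m := fun m =>
    (weightComp w m).codRestrict _ (weightComp_mem m)
  let L : κ → MvPowerSeries σ ℂ →ₗ[ℂ] ℂ := fun k => (B (v k)).coord ⟨k, rfl⟩ ∘ₗ proj (v k)
  have hproj : ∀ m (k : {k // v k = m}), proj m (b k.1) = B m k := by
    rintro m ⟨k, rfl⟩
    apply Subtype.ext
    rw [hB]
    exact weightComp_of_mem (hb k)
  have hL : ∀ m (k : {k // v k = m}) f, L k.1 f = (B m).coord k (proj m f) := by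
    rintro m ⟨k, rfl⟩ f
    rfl
  have hLcomp : ∀ k f, L k f = L k (weightComp w (v k) f) := by
    intro k f
    have : proj (v k) (weightComp w (v k) f) = proj (v k) f := by
      apply Subtype.ext
      exact weightComp_of_mem (weightComp_mem _ _)
    change (B (v k)).coord ⟨k, rfl⟩ (proj (v k) f) = (B (v k)).coord ⟨k, rfl⟩ (proj (v k) _)
    rw [this]
  refine ⟨L, hLcomp, fun k => ?_, fun k k' hk => ?_, fun f => ?_⟩
  · change (B (v k)).coord ⟨k, rfl⟩ (proj (v k) (b k)) = 1
    rw [hproj (v k) ⟨k, rfl⟩]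
    simp
  · by_cases h : v k' = v k
    · rw [hL (v k) ⟨k, rfl⟩, hproj (v k) ⟨k', h⟩]
      simp [hk]
    · rw [hLcomp, weightComp_of_mem_of_ne (hb k') h, map_zero]
  · have hfin : ∀ m, {k | v k = m}.Finite := fun m => Set.finite_coe_iff.1 (hv m)
    have hcomp : ∀ m, weightComp w m f = ∑ k ∈ (hfin m).toFinset, L k f • b k := by
      intro m
      have := Fintype.ofFinite {k // v k = m}
      have h1 := congrArg Subtype.val ((B m).sum_repr (proj m f))
      change _ = weightComp w m f at h1
      rw [← h1, AddSubmonoidClass.coe_finsetSum, Finset.sum_subtype (hfin m).toFinset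
        (fun k => by rw [Set.Finite.mem_toFinset, Set.mem_ofPred_eq])]
      refine Finset.sum_congr rfl fun k _ => ?_
      rw [Submodule.coe_smul, hB, hL m k]
      rfl
    intro M
    -- The vectors of weight less than M reproduce the components of f below M; all others already
    -- lie in `weightOrd w M`.
    refine ⟨(Finset.range M).biUnion fun m => (hfin m).toFinset, fun t ht => ?_⟩
    rw [← Finset.sum_sdiff ht, Finset.sum_biUnion, add_comm, ← sub_sub]
    · refine Submodule.sub_mem _ ?_ (Submodule.sum_mem _ fun k hk => ?_)
      · simp_rw [← hcomp]
        exact sub_sum_weightComp_mem M f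
      · refine Submodule.smul_mem _ _ (weightHom_le_weightOrd ?_ (hb k))
        by_contra! h
        refine (Finset.mem_sdiff.1 hk).2 (Finset.mem_biUnion.2 ⟨v k, Finset.mem_range.2 h, ?_⟩)
        rw [Set.Finite.mem_toFinset]
        rfl
    · intro m _ m' _ hmm
      rw [Function.onFun, Finset.disjoint_left]
      intro k hk hk'
      rw [Set.Finite.mem_toFinset] at hk hk'
      exact hmm (hk.symm.trans hk')

end MvPowerSeries

/-! ### Operators attached to a power series in three variables -/

namespace MvPowerSeries

/-- The antiderivative with respect to the third variable that vanishes on `z = 0`. -/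
def zInt : Module.End ℂ (MvPowerSeries (Fin 3) ℂ) where
  toFun f := fun n => if n 2 = 0 then 0 else coeff (n - Finsupp.single 2 1) f / n 2
  map_add' f g := by
    funext n
    change (if n 2 = 0 then 0 else coeff (n - Finsupp.single 2 1) (f + g) / (n 2 : ℂ)) =
      (if n 2 = 0 then 0 else coeff (n - Finsupp.single 2 1) f / (n 2 : ℂ)) +
        (if n 2 = 0 then 0 else coeff (n - Finsupp.single 2 1) g / (n 2 : ℂ))
    split_ifs <;> simp [add_div]
  map_smul' r f := by
    funext n
    change (if n 2 = 0 then 0 else coeff (n - Finsupp.single 2 1) (r • f) / (n 2 : ℂ)) =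
      r * (if n 2 = 0 then 0 else coeff (n - Finsupp.single 2 1) f / (n 2 : ℂ))
    split_ifs <;> simp [mul_div_assoc]

theorem coeff_zInt (f : MvPowerSeries (Fin 3) ℂ) (n : Fin 3 →₀ ℕ) :
    coeff n (zInt f) = if n 2 = 0 then 0 else coeff (n - Finsupp.single 2 1) f / n 2 := rfl

theorem pderiv_zInt (f : MvPowerSeries (Fin 3) ℂ) : pderiv ℂ 2 (zInt f) = f := by
  ext n
  rw [coeff_pderiv, coeff_zInt, if_neg (by simp), add_tsub_cancel_right]
  simp only [Finsupp.coe_add, Pi.add_apply, Finsupp.single_eq_same]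
  push_cast
  have : (n 2 : ℂ) + 1 ≠ 0 := Nat.cast_add_one_ne_zero _
  field_simp

theorem X_dvd_zInt (f : MvPowerSeries (Fin 3) ℂ) : X 2 ∣ zInt f := by
  rw [X_dvd_iff]
  intro m hm
  rw [coeff_zInt, if_pos hm]

/-- A series divisible by z is determined by its z-derivative. All the identities for `zInt` below
are proved by differentiating both sides. -/
theorem eq_of_pderiv_eq {g h : MvPowerSeries (Fin 3) ℂ} (hg : X 2 ∣ g) (hh : X 2 ∣ h)
    (H : pderiv ℂ 2 g = pderiv ℂ 2 h) : g = h := by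
  rw [X_dvd_iff] at hg hh
  ext n
  by_cases hn : n 2 = 0
  · rw [hg n hn, hh n hn]
  · have h1 : n - Finsupp.single 2 1 + Finsupp.single 2 1 = n :=
      tsub_add_cancel_of_le (Finsupp.single_le_iff.2 (by omega))
    have h2 := congrArg (coeff (n - Finsupp.single 2 1)) H
    rw [coeff_pderiv, coeff_pderiv, h1] at h2
    exact mul_right_cancel₀ (Nat.cast_add_one_ne_zero _) h2

theorem pderiv_comm {σ : Type*} (i j : σ) (f : MvPowerSeries σ ℂ) :
    pderiv ℂ i (pderiv ℂ j f) = pderiv ℂ j (pderiv ℂ i f) := by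
  classical
  obtain rfl | h := eq_or_ne i j
  · rfl
  ext n
  simp only [coeff_pderiv]
  rw [add_right_comm]
  simp [h, h.symm]
  ring

theorem X_dvd_pderiv {i : Fin 3} (hi : i ≠ 2) {f : MvPowerSeries (Fin 3) ℂ} (hf : X 2 ∣ f) :
    X 2 ∣ pderiv ℂ i f := by
  obtain ⟨g, rfl⟩ := hf
  rw [Derivation.leibniz, pderiv_X_of_ne hi.symm, smul_zero, add_zero, smul_eq_mul]
  exact Dvd.intro _ rfl

theorem zInt_X_mul {i : Fin 3} (hi : i ≠ 2) (f : MvPowerSeries (Fin 3) ℂ) :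
    zInt (X i * f) = X i * zInt f :=
  eq_of_pderiv_eq (X_dvd_zInt _) (Dvd.dvd.mul_left (X_dvd_zInt _) _) (by
    rw [pderiv_zInt, Derivation.leibniz, pderiv_zInt, pderiv_X_of_ne hi]
    simp)

theorem pderiv_sub_zInt (f : MvPowerSeries (Fin 3) ℂ) :
    pderiv ℂ 2 (f - zInt (pderiv ℂ 2 f)) = 0 := by
  rw [map_sub, pderiv_zInt, sub_self]

theorem coeff_eq_zero_of_pderiv_eq_zero {f : MvPowerSeries (Fin 3) ℂ} (hf : pderiv ℂ 2 f = 0)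
    {n : Fin 3 →₀ ℕ} (hn : n 2 ≠ 0) : coeff n f = 0 := by
  have h1 : n - Finsupp.single 2 1 + Finsupp.single 2 1 = n :=
    tsub_add_cancel_of_le (Finsupp.single_le_iff.2 (by omega))
  have h2 := congrArg (coeff (n - Finsupp.single 2 1)) hf
  rw [coeff_pderiv, h1, map_zero] at h2
  exact (mul_eq_zero.1 h2).resolve_right (Nat.cast_add_one_ne_zero _)

theorem pderiv_eq_zero_of_coeff {f : MvPowerSeries (Fin 3) ℂ}
    (hf : ∀ n : Fin 3 →₀ ℕ, n 2 ≠ 0 → coeff n f = 0) : pderiv ℂ 2 f = 0 := by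
  ext n
  rw [coeff_pderiv, hf _ (by simp), zero_mul, map_zero]

variable (q : MvPowerSeries (Fin 3) ℂ)

/-- The operator `f ↦ q_i f - q_z ∂_i ∫ f dz`. -/
def crossOp (i : Fin 3) : Module.End ℂ (MvPowerSeries (Fin 3) ℂ) :=
  LinearMap.mulLeft ℂ (pderiv ℂ i q) -
    LinearMap.mulLeft ℂ (pderiv ℂ 2 q) * ((pderiv ℂ i : Derivation ℂ _ _).toLinearMap * zInt)

/-- The operator `f ↦ q_z ∫ f dz`. -/
def zOp : Module.End ℂ (MvPowerSeries (Fin 3) ℂ) := LinearMap.mulLeft ℂ (pderiv ℂ 2 q) * zInt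

theorem crossOp_apply (i : Fin 3) (f : MvPowerSeries (Fin 3) ℂ) :
    crossOp q i f = pderiv ℂ i q * f - pderiv ℂ 2 q * pderiv ℂ i (zInt f) := rfl

theorem zOp_apply (f : MvPowerSeries (Fin 3) ℂ) : zOp q f = pderiv ℂ 2 q * zInt f := rfl

/-- Integration by parts in z: the derivative of the right-hand side is computed with the product
rule and the symmetry of mixed derivatives. -/
theorem zInt_crossOp {i : Fin 3} (hi : i ≠ 2) (f : MvPowerSeries (Fin 3) ℂ) :
    zInt (crossOp q i f) = pderiv ℂ i q * zInt f - pderiv ℂ i (zInt (zOp q f)) :=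
  eq_of_pderiv_eq (X_dvd_zInt _) (dvd_sub (Dvd.dvd.mul_left (X_dvd_zInt _) _)
    (X_dvd_pderiv hi (X_dvd_zInt _))) (by
    rw [pderiv_zInt, map_sub, Derivation.leibniz, pderiv_zInt, pderiv_comm 2 i (zInt _),
      pderiv_zInt, crossOp_apply, zOp_apply, Derivation.leibniz, pderiv_comm 2 i q]
    simp only [smul_eq_mul]
    ring)

/-- With F = ∫f and Z = ∫(q_z F), the formula for `zInt` of `crossOp` turns the composite into q_i
q_j f - q_z(q_i ∂_j F + q_j ∂_i F + q_ij F) + q_z ∂_i ∂_j Z, which is symmetric in i and j. -/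
theorem crossOp_comm {i j : Fin 3} (hi : i ≠ 2) (hj : j ≠ 2) :
    Commute (crossOp q i) (crossOp q j) := by
  refine LinearMap.ext fun f => ?_
  change crossOp q i (crossOp q j f) = crossOp q j (crossOp q i f)
  rw [crossOp_apply q i (crossOp q j f), crossOp_apply q j (crossOp q i f), zInt_crossOp q hi,
    zInt_crossOp q hj, crossOp_apply, crossOp_apply]
  simp only [map_sub, Derivation.leibniz, smul_eq_mul]
  rw [pderiv_comm j i q, pderiv_comm j i (zInt (zOp q f))]
  ring

theorem crossOp_zOp {i : Fin 3} (hi : i ≠ 2) (f : MvPowerSeries (Fin 3) ℂ) :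
    crossOp q i (zOp q f) = zOp q (crossOp q i f) := by
  rw [zOp_apply q (crossOp q i f), zInt_crossOp q hi, crossOp_apply, zOp_apply]
  ring

theorem zInt_mul_self (f : MvPowerSeries (Fin 3) ℂ) :
    zInt (q * f) = q * zInt f - zInt (zOp q f) :=
  eq_of_pderiv_eq (X_dvd_zInt _) (dvd_sub (Dvd.dvd.mul_left (X_dvd_zInt _) _) (X_dvd_zInt _)) (by
    rw [pderiv_zInt, map_sub, Derivation.leibniz, pderiv_zInt, pderiv_zInt, zOp_apply]
    simp only [smul_eq_mul]
    ring)

theorem crossOp_mul_self {i : Fin 3} (f : MvPowerSeries (Fin 3) ℂ) :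
    crossOp q i (q * f) = q * crossOp q i f - crossOp q i (zOp q f) := by
  rw [crossOp_apply, zInt_mul_self, crossOp_apply, crossOp_apply, zOp_apply]
  simp only [map_sub, Derivation.leibniz, smul_eq_mul]
  ring

/-- The commutator of the operator with multiplication by q is minus its composite with `zOp`, and
it commutes with `zOp`. Hence the deformation parameter drops by exactly one; at r = 0 the image is
a multiple of q. -/
theorem crossOp_mul_add {i : Fin 3} (hi : i ≠ 2) (r : ℂ) (f : MvPowerSeries (Fin 3) ℂ) :
    crossOp q i (q * f + (r + 1) • zOp q f) =
      q * crossOp q i f + r • zOp q (crossOp q i f) := by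
  rw [map_add, map_smul, crossOp_mul_self, crossOp_zOp q hi, add_smul, one_smul]
  abel

/-- The restriction of `q` to `z = 0`. -/
def zConst : MvPowerSeries (Fin 3) ℂ := q - zInt (pderiv ℂ 2 q)

theorem zInt_pderiv_mul {c : MvPowerSeries (Fin 3) ℂ} (hc : pderiv ℂ 2 c = 0) :
    zInt (pderiv ℂ 2 q * c) = (q - zConst q) * c :=
  eq_of_pderiv_eq (X_dvd_zInt _) (by
    rw [zConst, sub_sub_cancel]
    exact Dvd.dvd.mul_right (X_dvd_zInt _) _) (by
    rw [pderiv_zInt, zConst, sub_sub_cancel, Derivation.leibniz, hc, pderiv_zInt]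
    simp [mul_comm])

/-- For c free of z one has ∫q_z c = (q - q(x,y,0))c. So the image of q_z c is again q_z times a
series in x, y, except for a multiple of q. -/
theorem crossOp_pderiv_mul {i : Fin 3} {c : MvPowerSeries (Fin 3) ℂ} (hc : pderiv ℂ 2 c = 0) :
    crossOp q i (pderiv ℂ 2 q * c) =
      pderiv ℂ 2 q * (pderiv ℂ i (zConst q * c)) - q * (pderiv ℂ 2 q * pderiv ℂ i c) := by
  rw [crossOp_apply, zInt_pderiv_mul q hc, sub_mul, map_sub, Derivation.leibniz _ q c]
  simp only [smul_eq_mul]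
  ring

theorem zOp_pderiv_mul {c : MvPowerSeries (Fin 3) ℂ} (hc : pderiv ℂ 2 c = 0) :
    zOp q (pderiv ℂ 2 q * c) = q * (pderiv ℂ 2 q * c) - pderiv ℂ 2 q * (zConst q * c) := by
  rw [zOp_apply, zInt_pderiv_mul q hc]
  ring

theorem pderiv_zConst_mul {c : MvPowerSeries (Fin 3) ℂ} (hc : pderiv ℂ 2 c = 0) :
    pderiv ℂ 2 (zConst q * c) = 0 := by
  rw [Derivation.leibniz, hc, zConst, pderiv_sub_zInt, smul_zero, smul_zero, add_zero]

theorem pderiv_pderiv_eq_zero (i : Fin 3) {c : MvPowerSeries (Fin 3) ℂ} (hc : pderiv ℂ 2 c = 0) :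
    pderiv ℂ 2 (pderiv ℂ i c) = 0 := by
  rw [pderiv_comm, hc, map_zero]

/-! #### Homogeneity -/

variable {q} {w : Fin 3 → ℕ} {d : ℕ}

theorem isHomOp_zInt : IsHomOp w (w 2) zInt := by
  intro f n h
  rw [coeff_zInt]
  split_ifs with h2
  · rfl
  · have h1 : n - Finsupp.single 2 1 + Finsupp.single 2 1 = n :=
      tsub_add_cancel_of_le (Finsupp.single_le_iff.2 (by omega))
    rw [h, zero_div]
    conv_rhs => rw [← h1, map_add]
    simp [Finsupp.weight_apply]

theorem pderiv_mem_weightHom (hq : q ∈ weightHom w d) {i : Fin 3} (hi : w i ≤ d) :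
    pderiv ℂ i q ∈ weightHom w (d - w i) :=
  (isHomOp_pderiv i).map_weightHom (by omega) hq

theorem isHomOp_zOp (hq : q ∈ weightHom w d) (h2 : w 2 ≤ d) : IsHomOp w d (zOp q) := by
  convert (isHomOp_mulLeft (pderiv_mem_weightHom hq h2)).mul isHomOp_zInt using 1
  · omega
  · rfl

theorem isHomOp_crossOp (hq : q ∈ weightHom w d) {i : Fin 3} (hi : w i ≤ d) (h2 : w 2 ≤ d) :
    IsHomOp w (d - w i : ℕ) (crossOp q i) := by
  refine (isHomOp_mulLeft (pderiv_mem_weightHom hq hi)).sub ?_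
  convert (isHomOp_mulLeft (pderiv_mem_weightHom hq h2)).mul
    ((isHomOp_pderiv i).mul isHomOp_zInt) using 1
  omega

theorem coeff_X_mul_pderiv {σ : Type*} (i : σ) (f : MvPowerSeries σ ℂ) (n : σ →₀ ℕ) :
    coeff n (X i * pderiv ℂ i f) = n i * coeff n f := by
  classical
  rw [X, coeff_monomial_mul, one_mul]
  split_ifs with h
  · rw [coeff_pderiv, tsub_add_cancel_of_le h, mul_comm]
    congr 1
    have : 1 ≤ n i := Finsupp.single_le_iff.1 h
    simp only [Finsupp.coe_tsub, Pi.sub_apply, Finsupp.single_eq_same]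
    push_cast [this]
    ring
  · have : n i = 0 := by
      by_contra h'
      exact h (Finsupp.single_le_iff.2 (by omega))
    rw [this]
    simp

theorem euler {l : ℕ} {f : MvPowerSeries (Fin 3) ℂ} (hf : f ∈ weightHom w l) :
    (w 0 : ℂ) • (X 0 * pderiv ℂ 0 f) + (w 1 : ℂ) • (X 1 * pderiv ℂ 1 f) +
      (w 2 : ℂ) • (X 2 * pderiv ℂ 2 f) = (l : ℂ) • f := by
  ext n
  simp only [map_add, map_smul, coeff_X_mul_pderiv, smul_eq_mul]
  by_cases h : Finsupp.weight w n = l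
  · rw [← h, Finsupp.weight_apply, Finsupp.sum_fintype _ _ (by simp)]
    simp only [Fin.sum_univ_three, smul_eq_mul]
    push_cast
    ring
  · rw [hf n h]
    ring

/-- Euler's formula for q, of weight d, and for ∫f, of weight l + w₂. In the coefficient of `zOp q
f` the summands w₀ and w₁ come from differentiating the factors x and y in ∫(xf) = x∫f and ∫(yf) =
y∫f. The relation expresses `zOp q f` through qf and images of A and B. -/
theorem smul_mul_eq (hq : q ∈ weightHom w d) {l : ℕ} {f : MvPowerSeries (Fin 3) ℂ}
    (hf : f ∈ weightHom w l) :
    (d : ℂ) • (q * f) = crossOp q 0 ((w 0 : ℂ) • (X 0 * f)) + crossOp q 1 ((w 1 : ℂ) • (X 1 * f)) +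
      ((l + w 0 + w 1 + w 2 : ℕ) : ℂ) • zOp q f := by
  have h1 := euler hq
  have hF : zInt f ∈ weightHom w (l + w 2) := isHomOp_zInt.map_weightHom (by omega) hf
  have h2 := euler hF
  rw [pderiv_zInt] at h2
  rw [map_smul, map_smul, crossOp_apply, crossOp_apply, zInt_X_mul (by decide),
    zInt_X_mul (by decide), zOp_apply]
  simp only [Derivation.leibniz, pderiv_X_self, smul_eq_mul, mul_one]
  simp only [smul_eq_C_mul, Nat.cast_add, map_add] at h1 h2 ⊢
  linear_combination (-f) * h1 + (pderiv ℂ 2 q) * h2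

/-- The coefficients are found recursively in j, starting with zero in the row j = 0; each step
divides by α(j + 1). -/
theorem exists_smul_sub_eq {α : ℂ} (hα : α ≠ 0) (β : ℂ) (C : ℕ → ℕ → ℂ) :
    ∃ G : ℕ → ℕ → ℂ, ∀ i j : ℕ, α * ((j + 1) * G i (j + 1)) - β * ((i + 1) * G (i + 1) j) = C i j := by
  let G : ℕ → ℕ → ℂ := fun j => Nat.rec (fun _ => 0) (fun j g i =>
    (C i j + β * ((i + 1) * g (i + 1))) / (α * (j + 1))) j
  refine ⟨fun i j => G j i, fun i j => ?_⟩
  have : G (j + 1) i = (C i j + β * ((i + 1) * G j (i + 1))) / (α * (j + 1)) := rfl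
  have h : (j : ℂ) + 1 ≠ 0 := Nat.cast_add_one_ne_zero _
  change α * ((j + 1) * G (j + 1) i) - _ = _
  rw [this]
  field_simp
  ring

/-- A nonzero constant vector field in the plane is surjective on power series in x, y. If α = 0 the
roles of x and y are exchanged, with a sign. This is why every Q_z c(x,y) occurs among the brackets.
-/
theorem exists_pderiv_sub_eq {α β : ℂ} (h : α ≠ 0 ∨ β ≠ 0) {c : MvPowerSeries (Fin 3) ℂ}
    (hc : pderiv ℂ 2 c = 0) : ∃ g : MvPowerSeries (Fin 3) ℂ, pderiv ℂ 2 g = 0 ∧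
      α • pderiv ℂ 1 g - β • pderiv ℂ 0 g = c := by
  classical
  let C : ℕ → ℕ → ℂ := fun i j => coeff (Finsupp.single 0 i + Finsupp.single 1 j) c
  have key : ∃ G : ℕ → ℕ → ℂ, ∀ i j : ℕ,
      α * ((j + 1) * G i (j + 1)) - β * ((i + 1) * G (i + 1) j) = C i j := by
    by_cases hα : α = 0
    · obtain ⟨G, hG⟩ := exists_smul_sub_eq (h.resolve_left (by simpa using hα)) α fun i j => C j i
      refine ⟨fun i j => -G j i, fun i j => ?_⟩
      rw [← hG j i]
      ring
    · exact exists_smul_sub_eq hα β C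
  obtain ⟨G, hG⟩ := key
  let g : MvPowerSeries (Fin 3) ℂ := fun n => if n 2 = 0 then G (n 0) (n 1) else 0
  have hg : ∀ n, coeff n g = if n 2 = 0 then G (n 0) (n 1) else 0 := fun n => rfl
  refine ⟨g, pderiv_eq_zero_of_coeff fun n hn => by rw [hg, if_neg hn], ?_⟩
  ext n
  simp only [map_sub, map_smul, coeff_pderiv, hg, smul_eq_mul]
  by_cases hn : n 2 = 0
  · have h1 : n = Finsupp.single 0 (n 0) + Finsupp.single 1 (n 1) := by
      ext i
      fin_cases i <;> simp [hn]
    have h2 := hG (n 0) (n 1)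
    simp only [C, ← h1] at h2
    rw [← h2]
    simp [hn]
    ring
  · rw [coeff_eq_zero_of_pderiv_eq_zero hc hn]
    simp [hn]

end MvPowerSeries

namespace QHSurface

open MvPowerSeries

/-- Only the derivatives of g enter, and g = ∫g_z + g(x,y,0). The first part gives βA - αB applied
to g_z; the second is free of z and meets only the factor Q_z. -/
theorem bracketPS_linear (S : QHSurface) (α β : ℂ) (g : MvPowerSeries (Fin 3) ℂ) :
    S.bracketPS (α • X 0 + β • X 1) g = β • crossOp (S.Q : MvPowerSeries (Fin 3) ℂ) 0 (pderiv ℂ 2 g)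
      - α • crossOp (S.Q : MvPowerSeries (Fin 3) ℂ) 1 (pderiv ℂ 2 g)
      + pderiv ℂ 2 (S.Q : MvPowerSeries (Fin 3) ℂ) *
        (α • pderiv ℂ 1 (g - zInt (pderiv ℂ 2 g)) - β • pderiv ℂ 0 (g - zInt (pderiv ℂ 2 g))) := by
  have h1 : ∀ i j : Fin 3, i ≠ j → pderiv ℂ j (X i : MvPowerSeries (Fin 3) ℂ) = 0 :=
    fun i j h => pderiv_X_of_ne h
  simp only [bracketPS, map_add, map_sub, Derivation.map_smul, pderiv_X_self, h1 0 1 (by decide),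
    h1 0 2 (by decide), h1 1 0 (by decide), h1 1 2 (by decide), crossOp_apply]
  simp only [smul_eq_C_mul]
  ring

end QHSurface

/-! ### A basis of the power series ring adapted to the bracket -/

namespace MvPowerSeries

theorem pderiv_monomial_eq_zero {n : Fin 3 →₀ ℕ} (hn : n 2 = 0) :
    pderiv ℂ 2 (monomial n (1 : ℂ)) = 0 := by
  classical
  refine pderiv_eq_zero_of_coeff fun k hk => ?_
  rw [coeff_monomial, if_neg]
  rintro rfl
  exact hk hn

theorem zConst_monomial (n : Fin 3 →₀ ℕ) :
    zConst (monomial n (1 : ℂ)) = if n 2 = 0 then monomial n (1 : ℂ) else 0 := by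
  classical
  split_ifs with hn
  · rw [zConst, pderiv_monomial_eq_zero hn, map_zero, sub_zero]
  · rw [zConst, sub_eq_zero]
    refine eq_of_pderiv_eq ?_ (X_dvd_zInt _) (pderiv_zInt _).symm
    rw [X_dvd_iff]
    intro m hm
    rw [coeff_monomial, if_neg]
    rintro rfl
    exact hn hm

/-- Restriction to `z = 0` as a linear map. -/
def zConstLin : Module.End ℂ (MvPowerSeries (Fin 3) ℂ) :=
  1 - zInt * (pderiv ℂ 2 : Derivation ℂ _ _).toLinearMap

variable {w : Fin 3 → ℕ}

theorem isHomOp_zConstLin : IsHomOp w 0 zConstLin := by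
  refine isHomOp_one.sub ?_
  convert isHomOp_zInt.mul (isHomOp_pderiv (w := w) 2) using 1
  omega

theorem exists_pderiv_mem (i : Fin 3) {l : ℕ} {f : MvPowerSeries (Fin 3) ℂ}
    (hf : f ∈ weightHom w l) : pderiv ℂ i f ∈ weightHom w (l - w i) := by
  by_cases h : w i ≤ l
  · exact pderiv_mem_weightHom hf h
  · have := (isHomOp_pderiv (w := w) i).map_weightHom_eq_zero (by omega) hf
    change pderiv ℂ i f = 0 at this
    rw [this]
    exact Submodule.zero_mem _

end MvPowerSeries

/-! ### The Jacobian ring of Q and the spanning property of the adapted family. -/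

namespace QHSurface

open MvPowerSeries

variable (S : QHSurface)

/-- The weights of the variables. -/
abbrev wt : Fin 3 → ℕ := ![S.a, S.b, S.c]

/-- The equation as a power series. -/
abbrev q : MvPowerSeries (Fin 3) ℂ := (S.Q : MvPowerSeries (Fin 3) ℂ)

theorem wt_ne_zero (i : Fin 3) : S.wt i ≠ 0 := by
  have := S.a_pos
  have := S.a_le_b
  have := S.b_le_c
  fin_cases i <;> simp <;> omega

theorem wt_le_c (i : Fin 3) : S.wt i ≤ S.c := by
  have := S.a_le_b
  have := S.b_le_c
  fin_cases i <;> simp <;> omega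

theorem q_mem : S.q ∈ weightHom S.wt S.d := coe_mem_weightHom S.homogeneous

/-- By Euler's formula dQ lies in the Jacobian ideal and d ≠ 0, so a common zero of the partial
derivatives is a singular point of X. -/
theorem eq_zero_of_eval_pderiv (hcd : S.c < S.d) {p : Fin 3 → ℂ}
    (h : ∀ i, MvPolynomial.eval p (MvPolynomial.pderiv i S.Q) = 0) : p = 0 := by
  have h1 := congrArg (MvPolynomial.eval p) S.homogeneous.sum_weight_X_mul_pderiv
  simp only [map_sum, map_nsmul, map_mul, h, mul_zero, smul_zero, Finset.sum_const_zero] at h1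
  rw [nsmul_eq_mul] at h1
  have h2 : MvPolynomial.eval p S.Q = 0 :=
    (mul_eq_zero.1 h1.symm).resolve_left (by exact_mod_cast (by omega : S.d ≠ 0))
  have h3 : p ∈ ({0} : Set (Fin 3 → ℂ)) := S.isolated ▸ ⟨h2, h⟩
  exact h3

/-- If Q_x = 0, then (1,0,0) is a relation between the partial derivatives, hence a Koszul relation,
and 1 lies in the ideal of Q_y and Q_z. Both vanish at the origin, which is a singular point. -/
theorem pderiv_zero_ne_zero (hcd : S.c < S.d) : MvPolynomial.pderiv 0 S.Q ≠ 0 := by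
  intro h
  obtain ⟨k₁, k₂, k₃, h1, -, -⟩ := MvPolynomial.exists_cross_of_dot_eq_zero
    (f₁ := MvPolynomial.pderiv 0 S.Q) (f₂ := MvPolynomial.pderiv 1 S.Q)
    (f₃ := MvPolynomial.pderiv 2 S.Q) (h₁ := 1) (h₂ := 0) (h₃ := 0)
    (fun p h0 h1 h2 => S.eq_zero_of_eval_pderiv hcd (fun i => by
      fin_cases i
      · exact h0
      · exact h1
      · exact h2)) (by rw [h]; ring)
  have h2 : (0 : Fin 3 → ℂ) ∈ {p : Fin 3 → ℂ | MvPolynomial.eval p S.Q = 0 ∧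
      ∀ i, MvPolynomial.eval p (MvPolynomial.pderiv i S.Q) = 0} := S.isolated ▸ rfl
  have h3 := congrArg (MvPolynomial.eval 0) h1
  rw [map_sub, map_mul, map_mul, h2.2, h2.2, map_one] at h3
  simp at h3

/-- A homogeneous complement of the Jacobian ideal. -/
structure Generators where
  e : ℕ → ℕ
  E : (Σ l, Fin (e l)) → MvPowerSeries (Fin 3) ℂ
  mem : ∀ j, E j ∈ weightHom S.wt j.1
  reduce : ∀ l, ∀ f ∈ weightHom S.wt l, ∃ (r : Fin (e l) → ℂ) (g : Fin 3 → MvPowerSeries (Fin 3) ℂ),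
    f = ∑ i, r i • E ⟨l, i⟩ + ∑ i, pderiv ℂ i S.q * g i ∧
      ∀ i, (l < S.d - S.wt i → g i = 0) ∧ (S.d - S.wt i ≤ l → g i ∈ weightHom S.wt (l - (S.d - S.wt i)))
  series : (PowerSeries.mk fun l => (e l : ℚ)) = (1 - PowerSeries.X ^ (S.d - S.c)) *
    ((1 - PowerSeries.X ^ (S.d - S.b)) * ((1 - PowerSeries.X ^ (S.d - S.a)) *
      PowerSeries.mk fun m => (MvPolynomial.monomialCount S.wt m : ℚ)))

theorem nonempty_generators (hcd : S.c < S.d) : Nonempty S.Generators := by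
  have hhom : ∀ i, (MvPolynomial.pderiv i S.Q).IsWeightedHomogeneous S.wt (S.d - S.wt i) :=
    fun i => S.homogeneous.pderiv (Nat.sub_add_cancel ((S.wt_le_c i).trans hcd.le))
  obtain ⟨e, E, h1, h2, h3⟩ := MvPolynomial.exists_graded_complement S.wt_ne_zero
    (f₁ := MvPolynomial.pderiv 0 S.Q) (f₂ := MvPolynomial.pderiv 1 S.Q)
    (f₃ := MvPolynomial.pderiv 2 S.Q)
    (fun p h0 h1 h2 => S.eq_zero_of_eval_pderiv hcd (fun i => by
      fin_cases i
      · exact h0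
      · exact h1
      · exact h2)) (s₁ := S.d - S.a) (s₂ := S.d - S.b) (s₃ := S.d - S.c) (by omega)
    (hhom 0) (hhom 1) (hhom 2) (S.pderiv_zero_ne_zero hcd)
  refine ⟨⟨e, fun j => (E j.1 j.2 : MvPolynomial (Fin 3) ℂ), fun j => coe_mem_weightHom (h1 _ _),
    fun l f hf => ?_, h3⟩⟩
  obtain ⟨p, hp, rfl⟩ := exists_coe_of_mem_weightHom S.wt_ne_zero hf
  obtain ⟨r, hr⟩ := h2 l p hp
  obtain ⟨g0, t0, ht0, hr⟩ := Ideal.mem_span_insert.1 hr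
  obtain ⟨g1, t1, ht1, rfl⟩ := Ideal.mem_span_insert.1 ht0
  obtain ⟨g2, rfl⟩ := Ideal.mem_span_singleton.1 ht1
  let g : Fin 3 → MvPolynomial (Fin 3) ℂ := ![g0, g1, g2]
  -- The cofactors may be inhomogeneous; only their components of weight l - (d - wt i) contribute
  -- in weight l, and there are none if this is negative.
  let k : Fin 3 → MvPolynomial (Fin 3) ℂ := fun i => if l < S.d - S.wt i then 0 else
    MvPolynomial.weightedHomogeneousComponent S.wt (l - (S.d - S.wt i)) (g i)
  have hk : ∀ i, MvPolynomial.weightedHomogeneousComponent S.wt l (MvPolynomial.pderiv i S.Q * g i) =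
      MvPolynomial.pderiv i S.Q * k i := by
    intro i
    by_cases h : l < S.d - S.wt i
    · rw [MvPolynomial.weightedHomogeneousComponent_mul_of_lt (hhom i) h]
      simp only [k, if_pos h, mul_zero]
    · simp only [k, if_neg h]
      rw [← MvPolynomial.weightedHomogeneousComponent_mul (hhom i), add_tsub_cancel_of_le (by omega)]
  have hp' : p = ∑ i, r i • E l i + ∑ i, MvPolynomial.pderiv i S.Q * g i := by
    rw [Fin.sum_univ_three]
    simp only [g, Matrix.cons_val_zero, Matrix.cons_val_one, Matrix.cons_val]
    linear_combination hr
  have hE : (∑ i, r i • E l i).IsWeightedHomogeneous S.wt l :=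
    MvPolynomial.IsWeightedHomogeneous.sum _ _ _ fun i _ =>
      (MvPolynomial.weightedHomogeneousSubmodule ℂ S.wt l).smul_mem _ (h1 l i)
  have hp2 := congrArg (MvPolynomial.weightedHomogeneousComponent S.wt l) hp'
  have hsum : MvPolynomial.weightedHomogeneousComponent S.wt l
      (∑ i, MvPolynomial.pderiv i S.Q * g i) = ∑ i, MvPolynomial.pderiv i S.Q * k i := by
    rw [map_sum]
    exact Finset.sum_congr rfl fun i _ => hk i
  rw [map_add, hsum,
    MvPolynomial.weightedHomogeneousComponent_of_mem hp,
    MvPolynomial.weightedHomogeneousComponent_of_mem hE, if_pos rfl, if_pos rfl] at hp2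
  refine ⟨r, fun i => (k i : MvPolynomial (Fin 3) ℂ), ?_, fun i => ⟨fun h => ?_, fun h => ?_⟩⟩
  · have h4 := congrArg MvPolynomial.coeToMvPowerSeries.ringHom hp2
    simp only [map_add, map_sum, map_mul, MvPolynomial.coeToMvPowerSeries.ringHom_apply,
      MvPolynomial.coe_smul] at h4
    rw [h4]
    simp only [pderiv_coe]
  · simp [k, if_pos h]
  · simp only [k, if_neg (not_lt.2 h)]
    exact coe_mem_weightHom (MvPolynomial.weightedHomogeneousComponent_isWeightedHomogeneous _ _)

variable {S}

namespace Generators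

variable (G : S.Generators)

/-- The elements `A ^ r B ^ s e_j`, `Q_z x ^ i y ^ j` and `Q x ^ i y ^ j z ^ k`, the last of them
deformed by a multiple of the operator `zOp`. -/
def vec (n : ℕ) : WeightCount.BasisIndex G.e → MvPowerSeries (Fin 3) ℂ :=
  Sum.elim (fun k => (crossOp S.q 0 ^ k.1.1 * crossOp S.q 1 ^ k.1.2) (G.E k.2))
    (Sum.elim (fun k => pderiv ℂ 2 S.q * monomial (Finsupp.single 0 k.1 + Finsupp.single 1 k.2) 1)
      fun k => S.q * monomial k 1 + (n : ℂ) • zOp S.q (monomial k 1))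

theorem isHomOp_crossOp (hcd : S.c < S.d) (i : Fin 3) :
    IsHomOp S.wt (S.d - S.wt i : ℕ) (crossOp S.q i) :=
  MvPowerSeries.isHomOp_crossOp S.q_mem ((S.wt_le_c i).trans hcd.le) hcd.le

theorem isHomOp_zOp (hcd : S.c < S.d) : IsHomOp S.wt S.d (zOp S.q) :=
  MvPowerSeries.isHomOp_zOp S.q_mem hcd.le

theorem weight_xy (i j : ℕ) :
    Finsupp.weight S.wt (Finsupp.single 0 i + Finsupp.single 1 j) = i * S.a + j * S.b := by
  simp [Finsupp.weight_apply, Finsupp.sum_add_index', add_mul]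

theorem vec_mem (hcd : S.c < S.d) (n : ℕ) (k : WeightCount.BasisIndex G.e) :
    G.vec n k ∈ weightHom S.wt (WeightCount.basisWeight S.a S.b S.c S.d G.e k) := by
  rcases k with ⟨⟨r, s⟩, j⟩ | ⟨i, j⟩ | k
  · refine (((isHomOp_crossOp hcd 0).pow r).mul ((isHomOp_crossOp hcd 1).pow s)).map_weightHom ?_
      (G.mem j)
    simp [WeightCount.basisWeight]
    ring
  · refine (isHomOp_mulLeft (pderiv_mem_weightHom S.q_mem (i := 2) hcd.le)).map_weightHom ?_
      (monomial_mem_weightHom _ _)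
    rw [weight_xy]
    simp [WeightCount.basisWeight]
  · refine Submodule.add_mem _ ((isHomOp_mulLeft S.q_mem).map_weightHom ?_
      (monomial_mem_weightHom _ _)) (Submodule.smul_mem _ _ ((isHomOp_zOp hcd).map_weightHom ?_
      (monomial_mem_weightHom _ _))) <;> simp [WeightCount.basisWeight]

/-- The span of the adapted family. -/
def vecSpan (n : ℕ) : Submodule ℂ (MvPowerSeries (Fin 3) ℂ) := Submodule.span ℂ (Set.range (G.vec n))

theorem mul_zConst_mem (n : ℕ) {l : ℕ} {f : MvPowerSeries (Fin 3) ℂ} (hf : f ∈ weightHom S.wt l) :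
    pderiv ℂ 2 S.q * zConst f ∈ G.vecSpan n := by
  have h : Submodule.span ℂ (Set.range fun k : Fin 3 →₀ ℕ => (monomial k (1 : ℂ))) ≤
      (G.vecSpan n).comap (LinearMap.mulLeft ℂ (pderiv ℂ 2 S.q) * zConstLin) := by
    rw [Submodule.span_le]
    rintro _ ⟨k, rfl⟩
    change pderiv ℂ 2 S.q * zConst (monomial k (1 : ℂ)) ∈ G.vecSpan n
    rw [zConst_monomial]
    split_ifs with hk
    · refine Submodule.subset_span ⟨Sum.inr (Sum.inl (k 0, k 1)), ?_⟩
      have : k = Finsupp.single 0 (k 0) + Finsupp.single 1 (k 1) := by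
        ext i
        fin_cases i <;> simp [hk]
      simp only [vec, Sum.elim_inr, Sum.elim_inl, ← this]
    · rw [mul_zero]
      exact Submodule.zero_mem _
  exact h (weightHom_le_span_monomial S.wt_ne_zero l hf)

theorem mul_mem_of_pderiv_eq_zero (n : ℕ) {l : ℕ} {f : MvPowerSeries (Fin 3) ℂ}
    (hf : f ∈ weightHom S.wt l) (h0 : pderiv ℂ 2 f = 0) :
    pderiv ℂ 2 S.q * f ∈ G.vecSpan n := by
  have := G.mul_zConst_mem n hf
  rwa [zConst, h0, map_zero, sub_zero] at this

theorem mul_add_zOp_mem (n : ℕ) {l : ℕ} {f : MvPowerSeries (Fin 3) ℂ}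
    (hf : f ∈ weightHom S.wt l) : S.q * f + (n : ℂ) • zOp S.q f ∈ G.vecSpan n := by
  have h : Submodule.span ℂ (Set.range fun k : Fin 3 →₀ ℕ => (monomial k (1 : ℂ))) ≤
      (G.vecSpan n).comap (LinearMap.mulLeft ℂ S.q + (n : ℂ) • zOp S.q) := by
    rw [Submodule.span_le]
    rintro _ ⟨k, rfl⟩
    exact Submodule.subset_span ⟨Sum.inr (Sum.inr k), rfl⟩
  exact h (weightHom_le_span_monomial S.wt_ne_zero l hf)

/-- The operators A and B map the span with parameter n + 1 to the one with parameter n. For the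
deformed multiples of Q this is `crossOp_mul_add`; for Q_z x^j y^k a term Q Q_z g appears that has
to be recovered from the deformed element. -/
theorem crossOp_vec_mem (hcd : S.c < S.d) {i : Fin 3} (hi : i ≠ 2) (n : ℕ)
    (hinl : ∀ k, crossOp S.q i (G.vec (n + 1) (Sum.inl k)) ∈ G.vecSpan n)
    {f : MvPowerSeries (Fin 3) ℂ} (hf : f ∈ G.vecSpan (n + 1)) :
    crossOp S.q i f ∈ G.vecSpan n := by
  have h : G.vecSpan (n + 1) ≤ (G.vecSpan n).comap (crossOp S.q i) := by
    rw [vecSpan, Submodule.span_le]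
    rintro _ ⟨k | ⟨j, k⟩ | k, rfl⟩
    · exact hinl k
    · change crossOp S.q i (pderiv ℂ 2 S.q * monomial _ 1) ∈ G.vecSpan n
      set m : Fin 3 →₀ ℕ := Finsupp.single 0 j + Finsupp.single 1 k with hm
      have h0 : pderiv ℂ 2 (monomial m (1 : ℂ)) = 0 := pderiv_monomial_eq_zero (by simp [hm])
      have hmem := monomial_mem_weightHom (w := S.wt) m 1
      have hc : pderiv ℂ 2 (pderiv ℂ i (monomial m (1 : ℂ))) = 0 := pderiv_pderiv_eq_zero i h0
      have hq0 : zConst S.q ∈ weightHom S.wt S.d :=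
        isHomOp_zConstLin.map_weightHom (by simp) S.q_mem
      have hmul : ∀ {l l' : ℕ} {f g : MvPowerSeries (Fin 3) ℂ}, f ∈ weightHom S.wt l →
          g ∈ weightHom S.wt l' → f * g ∈ weightHom S.wt (l + l') := fun hf hg =>
        (isHomOp_mulLeft hf).map_weightHom (by push_cast; ring) hg
      rw [crossOp_pderiv_mul _ h0]
      refine Submodule.sub_mem _ (G.mul_mem_of_pderiv_eq_zero n
        (exists_pderiv_mem i (hmul hq0 hmem))
        (pderiv_pderiv_eq_zero i (pderiv_zConst_mul _ h0))) ?_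
      set g := pderiv ℂ i (monomial m (1 : ℂ)) with hg
      have hgm : g ∈ weightHom S.wt _ := exists_pderiv_mem i hmem
      have h1 := G.mul_add_zOp_mem n (hmul (pderiv_mem_weightHom S.q_mem (i := 2) hcd.le) hgm)
      have h2 := G.mul_mem_of_pderiv_eq_zero n (hmul hq0 hgm) (pderiv_zConst_mul _ hc)
      rw [zOp_pderiv_mul _ hc] at h1
      -- For g free of z, the deformed multiple of Q attached to Q_z g is (n + 1) Q Q_z g - n Q_z
      -- Q(x,y,0) g. Its last term lies in the span, so one can divide by n + 1.
      have h3 : ((n : ℂ) + 1)⁻¹ • ((S.q * (pderiv ℂ 2 S.q * g) + (n : ℂ) •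
          (S.q * (pderiv ℂ 2 S.q * g) - pderiv ℂ 2 S.q * (zConst S.q * g))) +
          (n : ℂ) • (pderiv ℂ 2 S.q * (zConst S.q * g))) = S.q * (pderiv ℂ 2 S.q * g) := by
        rw [inv_smul_eq_iff₀ (Nat.cast_add_one_ne_zero n)]
        module
      rw [← h3]
      exact Submodule.smul_mem _ _ (Submodule.add_mem _ h1 (Submodule.smul_mem _ _ h2))
    · change crossOp S.q i (S.q * monomial k 1 + ((n + 1 : ℕ) : ℂ) • zOp S.q (monomial k 1)) ∈ G.vecSpan n
      rw [Nat.cast_succ, crossOp_mul_add _ hi]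
      refine G.mul_add_zOp_mem n ((isHomOp_crossOp hcd i).map_weightHom (l :=
        Finsupp.weight S.wt k + (S.d - S.wt i)) (by push_cast; ring) (monomial_mem_weightHom k 1))
  exact h hf

theorem crossOp_zero_mem (hcd : S.c < S.d) (n : ℕ) {f : MvPowerSeries (Fin 3) ℂ}
    (hf : f ∈ G.vecSpan (n + 1)) : crossOp S.q 0 f ∈ G.vecSpan n := by
  refine G.crossOp_vec_mem hcd (by decide) n (fun k => Submodule.subset_span
    ⟨Sum.inl ((k.1.1 + 1, k.1.2), k.2), ?_⟩) hf
  simp only [vec, Sum.elim_inl, pow_succ', Module.End.mul_apply]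

theorem crossOp_one_mem (hcd : S.c < S.d) (n : ℕ) {f : MvPowerSeries (Fin 3) ℂ}
    (hf : f ∈ G.vecSpan (n + 1)) : crossOp S.q 1 f ∈ G.vecSpan n := by
  refine G.crossOp_vec_mem hcd (by decide) n (fun k => Submodule.subset_span
    ⟨Sum.inl ((k.1.1, k.1.2 + 1), k.2), ?_⟩) hf
  have h : crossOp S.q 0 ^ k.1.1 * crossOp S.q 1 ^ (k.1.2 + 1) =
      crossOp S.q 1 * (crossOp S.q 0 ^ k.1.1 * crossOp S.q 1 ^ k.1.2) := by
    rw [pow_succ', ← mul_assoc, ← mul_assoc,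
      ((crossOp_comm S.q (by decide) (by decide)).pow_left k.1.1).eq]
  exact LinearMap.congr_fun h (G.E k.2)

/-- Strong induction on the weight for all n at once, because A and B relate n + 1 to n. Modulo the
generators E an element is a combination of Q_x, Q_y, Q_z; the first two terms are traded for images
of A and B and a further multiple of Q_z, and Euler's formula deals with the multiples of Q_z. -/
theorem weightHom_le_vecSpan (hcd : S.c < S.d) (m n : ℕ) : weightHom S.wt m ≤ G.vecSpan n := by
  induction m using Nat.strong_induction_on generalizing n with
  | _ m ih =>
    intro f hf
    have ha := S.a_pos
    have hab := S.a_le_b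
    have hbc := S.b_le_c
    obtain ⟨r, g, rfl, hg⟩ := G.reduce m f hf
    -- Here Q_i g_i = A_i g_i + Q_z h with h = ∂_i∫g_i. Since wt i < d, the cofactor g_i has smaller
    -- weight, and the induction hypothesis with n + 1 applies to it.
    have hcross : ∀ i, i ≠ 2 → (∀ n {f}, f ∈ G.vecSpan (n + 1) → crossOp S.q i f ∈ G.vecSpan n) →
        ∃ h, (m < S.d - S.c → h = 0) ∧
          (S.d - S.c ≤ m → h ∈ weightHom S.wt (m - (S.d - S.c))) ∧
          pderiv ℂ i S.q * g i - pderiv ℂ 2 S.q * h ∈ G.vecSpan n := by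
      intro i hi hspan
      have hic := S.wt_le_c i
      have hpos := S.wt_ne_zero i
      refine ⟨pderiv ℂ i (zInt (g i)), fun h => ?_, fun h => ?_, ?_⟩
      · rw [(hg i).1 (by omega), map_zero, map_zero]
      · by_cases hm : m < S.d - S.wt i
        · rw [(hg i).1 hm, map_zero, map_zero]
          exact Submodule.zero_mem _
        · refine ((isHomOp_pderiv i).mul isHomOp_zInt).map_weightHom (w := S.wt) ?_
            ((hg i).2 (not_lt.1 hm))
          have : S.wt 2 = S.c := rfl
          rw [this]
          omega
      · rw [← crossOp_apply]
        by_cases hm : m < S.d - S.wt i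
        · rw [(hg i).1 hm, map_zero]
          exact Submodule.zero_mem _
        · exact hspan n (ih (m - (S.d - S.wt i)) (by omega) (n + 1) ((hg i).2 (not_lt.1 hm)))
    obtain ⟨h0, h0a, h0b, h0c⟩ := hcross 0 (by decide) (fun n f => G.crossOp_zero_mem hcd n)
    obtain ⟨h1, h1a, h1b, h1c⟩ := hcross 1 (by decide) (fun n f => G.crossOp_one_mem hcd n)
    have hz : pderiv ℂ 2 S.q * (g 2 + h0 + h1) ∈ G.vecSpan n := by
      by_cases hm : m < S.d - S.c
      · rw [(hg 2).1 hm, h0a hm, h1a hm, add_zero, add_zero, mul_zero]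
        exact Submodule.zero_mem _
      · rw [not_lt] at hm
        have hh : g 2 + h0 + h1 ∈ weightHom S.wt (m - (S.d - S.c)) :=
          Submodule.add_mem _ (Submodule.add_mem _ ((hg 2).2 hm) (h0b hm)) (h1b hm)
        set h := g 2 + h0 + h1
        -- Splitting h into ∫h_z and h(x,y,0): the second part yields generators Q_z x^i y^j, and
        -- the first is of the form treated by Euler's formula.
        have hdec : pderiv ℂ 2 S.q * h =
            zOp S.q (pderiv ℂ 2 h) + pderiv ℂ 2 S.q * zConst h := by
          rw [zOp_apply, zConst]
          ring
        rw [hdec]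
        refine Submodule.add_mem _ ?_ (G.mul_zConst_mem n hh)
        by_cases hmd : m < S.d
        · have : pderiv ℂ 2 h = 0 := (isHomOp_pderiv (w := S.wt) 2).map_weightHom_eq_zero (by
            have : S.wt 2 = S.c := rfl
            rw [this]
            omega) hh
          rw [this, map_zero]
          exact Submodule.zero_mem _
        · have hk : pderiv ℂ 2 h ∈ weightHom S.wt (m - S.d) :=
            (isHomOp_pderiv (w := S.wt) 2).map_weightHom (by
              have : S.wt 2 = S.c := rfl
              rw [this]
              omega) hh
          set k := pderiv ℂ 2 h
          have hX : ∀ i : Fin 3, X i * k ∈ weightHom S.wt (S.wt i + (m - S.d)) := by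
            intro i
            refine (isHomOp_mulLeft (s := S.wt i) ?_).map_weightHom (by push_cast; ring) hk
            have := monomial_mem_weightHom (w := S.wt) (Finsupp.single i 1) 1
            rwa [Finsupp.weight_single, one_smul] at this
          have e0 : crossOp S.q 0 ((S.wt 0 : ℂ) • (X 0 * k)) ∈ G.vecSpan n :=
            G.crossOp_zero_mem hcd n (Submodule.smul_mem _ _ (ih _ (by
              have : S.wt 0 = S.a := rfl
              rw [this]
              omega) _ (hX 0)))
          have e1 : crossOp S.q 1 ((S.wt 1 : ℂ) • (X 1 * k)) ∈ G.vecSpan n :=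
            G.crossOp_one_mem hcd n (Submodule.smul_mem _ _ (ih _ (by
              have : S.wt 1 = S.b := rfl
              rw [this]
              omega) _ (hX 1)))
          have e2 := G.mul_add_zOp_mem n hk
          have e3 := smul_mul_eq S.q_mem hk
          -- Replacing Qk by Qk + n `zOp` k in Euler's relation adds dn to the coefficient of `zOp`
          -- k. The total N is positive, so `zOp` k can be solved for; xk and yk have weight below m
          -- because the weights of x and y are less than d.
          set N : ℕ := m - S.d + S.wt 0 + S.wt 1 + S.wt 2 + S.d * n with hN
          have hN0 : (N : ℂ) ≠ 0 := by
            have := S.wt_ne_zero 0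
            exact_mod_cast (by omega : N ≠ 0)
          have e4 : (N : ℂ) • zOp S.q k = (S.d : ℂ) • (S.q * k + (n : ℂ) • zOp S.q k) -
              crossOp S.q 0 ((S.wt 0 : ℂ) • (X 0 * k)) - crossOp S.q 1 ((S.wt 1 : ℂ) • (X 1 * k)) := by
            rw [smul_add, e3, hN]
            push_cast
            module
          rw [← inv_smul_smul₀ hN0 (zOp S.q k), e4]
          exact Submodule.smul_mem _ _ (Submodule.sub_mem _ (Submodule.sub_mem _
            (Submodule.smul_mem _ _ e2) e0) e1)
    rw [Fin.sum_univ_three]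
    have hsplit : pderiv ℂ 0 S.q * g 0 + pderiv ℂ 1 S.q * g 1 + pderiv ℂ 2 S.q * g 2 =
        (pderiv ℂ 0 S.q * g 0 - pderiv ℂ 2 S.q * h0) +
        (pderiv ℂ 1 S.q * g 1 - pderiv ℂ 2 S.q * h1) + pderiv ℂ 2 S.q * (g 2 + h0 + h1) := by ring
    rw [hsplit]
    refine Submodule.add_mem _ (Submodule.sum_mem _ fun i _ => Submodule.smul_mem _ _
      (Submodule.subset_span ⟨Sum.inl ((0, 0), ⟨m, i⟩), ?_⟩))
      (Submodule.add_mem _ (Submodule.add_mem _ h0c h1c) hz)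
    simp [vec]

end Generators

end QHSurface

/-! ### The family of functionals that describes the quotient by brackets -/

namespace MvPowerSeries

variable {σ : Type*} {w : σ → ℕ}

variable (w) in
/-- The operator `T` raises the order by at least `k`. -/
def Raises (k : ℕ) (T : Module.End ℂ (MvPowerSeries σ ℂ)) : Prop :=
  ∀ M, ∀ f ∈ weightOrd w M, T f ∈ weightOrd w (M + k)

variable {k l : ℕ} {T U : Module.End ℂ (MvPowerSeries σ ℂ)}

theorem IsHomOp.raises {s : ℕ} (hT : IsHomOp w s T) (h : k ≤ s) : Raises w k T :=
  fun _ _ hf => hT.map_weightOrd (by push_cast; omega) hf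

theorem Raises.mul (hT : Raises w k T) (hU : Raises w l U) : Raises w (k + l) (T * U) :=
  fun M f hf => by
    have := hT _ _ (hU M f hf)
    rwa [add_assoc, add_comm l k] at this

theorem Raises.add (hT : Raises w k T) (hU : Raises w k U) : Raises w k (T + U) :=
  fun M f hf => Submodule.add_mem _ (hT M f hf) (hU M f hf)

theorem Raises.smul (r : ℂ) (hT : Raises w k T) : Raises w k (r • T) :=
  fun M f hf => Submodule.smul_mem _ _ (hT M f hf)

theorem Raises.mono (hT : Raises w k T) (h : l ≤ k) : Raises w l T :=
  fun M f hf => weightOrd_mono (by omega) (hT M f hf)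

theorem raises_one : Raises w 0 (1 : Module.End ℂ (MvPowerSeries σ ℂ)) := fun _ _ hf => hf

theorem Raises.pow (hT : Raises w 1 T) (n : ℕ) : Raises w n (T ^ n) := by
  induction n with
  | zero => exact raises_one
  | succ n ih =>
    rw [pow_succ]
    exact ih.mul hT

theorem Raises.weightContinuous (hT : Raises w k T) : WeightContinuous w T :=
  fun M => ⟨M, fun f hf => weightOrd_mono (by omega) (hT M f hf)⟩

theorem isHomOp_pderiv_weightContinuous (i : σ) :
    WeightContinuous w (pderiv ℂ i : Derivation ℂ _ (MvPowerSeries σ ℂ)).toLinearMap :=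
  (isHomOp_pderiv i).weightContinuous

theorem finite_weight_lt [Finite σ] (hw : ∀ i, w i ≠ 0) (M : ℕ) :
    {n : σ →₀ ℕ | Finsupp.weight w n < M}.Finite := by
  have : {n : σ →₀ ℕ | Finsupp.weight w n < M} =
      ⋃ m ∈ Finset.range M, {n : σ →₀ ℕ | Finsupp.weight w n = m} := by
    ext n
    simp
  rw [this]
  exact Set.Finite.biUnion (Finset.finite_toSet _) fun m _ => Finsupp.finite_of_nat_weight_eq w hw m

end MvPowerSeries

/-- If `λ₀ α + λ₁ β = 1` then `A ^ r B ^ s` agrees with `α ^ r β ^ s C ^ (r + s)`, where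
`C = λ₀ A + λ₁ B`, up to a multiple of `β A - α B`. -/
theorem MvPowerSeries.exists_pow_mul_pow_eq {σ : Type*} {w : σ → ℕ}
    {A B : Module.End ℂ (MvPowerSeries σ ℂ)} (hAB : Commute A B) (hA : Raises w 1 A)
    (hB : Raises w 1 B) {α β l₀ l₁ : ℂ} (h : l₀ * α + l₁ * β = 1) (r s : ℕ) :
    ∃ U, Raises w (r + s - 1) U ∧ A ^ r * B ^ s =
      (α ^ r * β ^ s) • (l₀ • A + l₁ • B) ^ (r + s) + (β • A - α • B) * U := by
  set C := l₀ • A + l₁ • B with hC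
  set T := β • A - α • B with hT
  have hCr : Raises w 1 C := (hA.smul _).add (hB.smul _)
  have hTA : Commute A T := ((Commute.refl A).smul_right β).sub_right (hAB.smul_right α)
  have hTB : Commute B T := (hAB.symm.smul_right β).sub_right ((Commute.refl B).smul_right α)
  -- By the normalization of l₀ and l₁, A and B are αC and βC modulo T = βA - αB, and all these
  -- operators commute.
  have hAC : A = α • C + l₁ • T := by
    rw [hC, hT]
    have : A = (l₀ * α + l₁ * β) • A := by rw [h, one_smul]
    nth_rw 1 [this]
    module
  have hBC : B = β • C + (-l₀) • T := by
    rw [hC, hT]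
    have : B = (l₀ * α + l₁ * β) • B := by rw [h, one_smul]
    nth_rw 1 [this]
    module
  have hTC : Commute T C := (hTA.symm.smul_right l₀).add_right (hTB.symm.smul_right l₁)
  -- Multiplication by one more factor X ≡ ξC modulo T. The bound on the order of the cofactor of T
  -- is carried along because infinitely many cofactors are summed later.
  have step : ∀ (X : Module.End ℂ (MvPowerSeries σ ℂ)) (ξ μ ρ : ℂ) (k : ℕ)
      (P U : Module.End ℂ (MvPowerSeries σ ℂ)), Raises w 1 X → Commute X T → X = ξ • C + μ • T →
      Raises w (k - 1) U → P = ρ • C ^ k + T * U →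
      ∃ U', Raises w k U' ∧ X * P = (ρ * ξ) • C ^ (k + 1) + T * U' := by
    intro X ξ μ ρ k P U hX hXT hXC hU hP
    refine ⟨(μ * ρ) • C ^ k + X * U, ((hCr.pow k).smul _).add ((hX.mul hU).mono (by omega)), ?_⟩
    rw [hP, mul_add, ← mul_assoc, hXT.eq, mul_add, mul_assoc T X U, ← add_assoc]
    congr 1
    nth_rw 1 [hXC]
    simp only [add_mul, mul_smul_comm, smul_mul_assoc, pow_succ']
    module
  induction r with
  | zero =>
    induction s with
    | zero =>
      refine ⟨0, fun M f _ => Submodule.zero_mem _, ?_⟩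
      simp
    | succ s ih =>
      obtain ⟨U, hU, hUe⟩ := ih
      obtain ⟨U', hU', hUe'⟩ := step B β (-l₀) _ _ _ U hB hTB hBC hU hUe
      refine ⟨U', by simpa using hU', ?_⟩
      rw [pow_zero, one_mul, pow_zero, one_mul] at hUe' ⊢
      rw [pow_succ' B, hUe', pow_succ β, show 0 + (s + 1) = 0 + s + 1 by omega]
  | succ r ih =>
    obtain ⟨U, hU, hUe⟩ := ih
    obtain ⟨U', hU', hUe'⟩ := step A α l₁ _ _ _ U hA hTA hAC hU hUe
    refine ⟨U', hU'.mono (by omega), ?_⟩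
    rw [pow_succ' A, mul_assoc, hUe', show r + 1 + s = r + s + 1 by omega]
    congr 2
    ring

/-! ### Coordinates in the adapted basis and the forms that cut out the brackets. -/

namespace QHSurface

open MvPowerSeries

variable {S : QHSurface} (hcd : S.c < S.d)
include hcd

theorem raises_crossOp (i : Fin 3) : Raises S.wt 1 (crossOp S.q i) :=
  (Generators.isHomOp_crossOp hcd i).raises (by have := S.wt_le_c i; omega)

namespace Generators

variable (G : S.Generators)

theorem exists_coord : ∃ L : WeightCount.BasisIndex G.e → MvPowerSeries (Fin 3) ℂ →ₗ[ℂ] ℂ,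
    (∀ k f, L k f = L k (weightComp S.wt (WeightCount.basisWeight S.a S.b S.c S.d G.e k) f)) ∧
    (∀ k, L k (G.vec 0 k) = 1) ∧ (∀ k k', k' ≠ k → L k (G.vec 0 k') = 0) ∧
      ∀ f, HasWeightSum S.wt (fun k => L k f • G.vec 0 k) f :=
  exists_coordinates S.wt_ne_zero (G.vec_mem hcd 0)
    (WeightCount.finiteFibers_basisWeight S.a_pos S.a_le_b S.b_le_c hcd G.e)
    (fun m => G.weightHom_le_vecSpan hcd m 0)
    (WeightCount.card_basisWeight S.a_pos S.a_le_b S.b_le_c hcd G.e G.series)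

/-- The coordinates with respect to the adapted basis. -/
def coord : WeightCount.BasisIndex G.e → MvPowerSeries (Fin 3) ℂ →ₗ[ℂ] ℂ :=
  Classical.choose (G.exists_coord hcd)

theorem coord_weightComp (k : WeightCount.BasisIndex G.e) (f : MvPowerSeries (Fin 3) ℂ) :
    G.coord hcd k f =
      G.coord hcd k (weightComp S.wt (WeightCount.basisWeight S.a S.b S.c S.d G.e k) f) :=
  (Classical.choose_spec (G.exists_coord hcd)).1 k f

theorem coord_vec (k k' : WeightCount.BasisIndex G.e) [Decidable (k' = k)] :
    G.coord hcd k (G.vec 0 k') = if k' = k then 1 else 0 := by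
  split_ifs with h
  · rw [h]
    exact (Classical.choose_spec (G.exists_coord hcd)).2.1 k
  · exact (Classical.choose_spec (G.exists_coord hcd)).2.2.1 k k' h

theorem hasWeightSum_coord (f : MvPowerSeries (Fin 3) ℂ) :
    HasWeightSum S.wt (fun k => G.coord hcd k f • G.vec 0 k) f :=
  (Classical.choose_spec (G.exists_coord hcd)).2.2.2 f

theorem coord_eq_zero (k : WeightCount.BasisIndex G.e) {f : MvPowerSeries (Fin 3) ℂ}
    (hf : f ∈ weightOrd S.wt (WeightCount.basisWeight S.a S.b S.c S.d G.e k + 1)) :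
    G.coord hcd k f = 0 := by
  rw [coord_weightComp, weightComp_of_mem_weightOrd hf (by omega), map_zero]

/-- The functional `∑_{r + s = k} α ^ r β ^ s L_{r s j}`. -/
def form (v : Fin 2 → ℂ) (k : ℕ) (j : Σ l, Fin (G.e l)) : MvPowerSeries (Fin 3) ℂ →ₗ[ℂ] ℂ :=
  ∑ x ∈ Finset.HasAntidiagonal.antidiagonal k, (v 0 ^ x.1 * v 1 ^ x.2) • G.coord hcd (Sum.inl (x, j))

theorem form_apply (v : Fin 2 → ℂ) (k : ℕ) (j : Σ l, Fin (G.e l)) (f : MvPowerSeries (Fin 3) ℂ) :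
    G.form hcd v k j f = ∑ x ∈ Finset.HasAntidiagonal.antidiagonal k,
      v 0 ^ x.1 * v 1 ^ x.2 * G.coord hcd (Sum.inl (x, j)) f := by
  simp [form]

theorem form_continuous (v : Fin 2 → ℂ) (k : ℕ) (j : Σ l, Fin (G.e l)) :
    WeightContinuousFunctional S.wt (G.form hcd v k j) := by
  refine ⟨∑ x ∈ Finset.HasAntidiagonal.antidiagonal k,
    (WeightCount.basisWeight S.a S.b S.c S.d G.e (Sum.inl (x, j)) + 1), fun f hf => ?_⟩
  rw [form_apply]
  refine Finset.sum_eq_zero fun x hx => ?_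
  rw [G.coord_eq_zero hcd _ (weightOrd_mono (Finset.single_le_sum
    (f := fun x => WeightCount.basisWeight S.a S.b S.c S.d G.e (Sum.inl (x, j)) + 1)
    (fun _ _ => Nat.zero_le _) hx) hf), mul_zero]

theorem form_vec_inl (v : Fin 2 → ℂ) (k : ℕ) (j j' : Σ l, Fin (G.e l)) (r s : ℕ) [Decidable (r + s = k ∧ j' = j)] :
    G.form hcd v k j ((crossOp S.q 0 ^ r * crossOp S.q 1 ^ s) (G.E j')) =
      if r + s = k ∧ j' = j then v 0 ^ r * v 1 ^ s else 0 := by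
  classical
  have h : ∀ x : ℕ × ℕ, G.coord hcd (Sum.inl (x, j)) ((crossOp S.q 0 ^ r * crossOp S.q 1 ^ s) (G.E j')) =
      if (Sum.inl ((r, s), j') : WeightCount.BasisIndex G.e) = Sum.inl (x, j) then 1 else 0 :=
    fun x => G.coord_vec hcd (Sum.inl (x, j)) (Sum.inl ((r, s), j'))
  rw [form_apply]
  simp only [h, Sum.inl.injEq, Prod.mk.injEq, mul_ite, mul_one, mul_zero]
  split_ifs with hrs
  · rw [Finset.sum_eq_single (r, s)]
    · simp [hrs.2]
    · intro x _ hx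
      rw [if_neg]
      rintro ⟨rfl, -⟩
      exact hx rfl
    · intro hn
      exact absurd (Finset.HasAntidiagonal.mem_antidiagonal.2 hrs.1) hn
  · refine Finset.sum_eq_zero fun x hx => ?_
    rw [if_neg]
    rintro ⟨rfl, hj⟩
    exact hrs ⟨Finset.HasAntidiagonal.mem_antidiagonal.1 hx, hj⟩

theorem form_vec_inr (v : Fin 2 → ℂ) (k : ℕ) (j : Σ l, Fin (G.e l)) (x) :
    G.form hcd v k j (G.vec 0 (Sum.inr x)) = 0 := by
  classical
  rw [form_apply]
  refine Finset.sum_eq_zero fun x hx => ?_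
  rw [coord_vec, if_neg (by simp), mul_zero]

theorem form_mul (v : Fin 2 → ℂ) (k : ℕ) (j : Σ l, Fin (G.e l)) (f : MvPowerSeries (Fin 3) ℂ) :
    G.form hcd v k j (S.q * f) = 0 := by
  refine LinearMap.congr_fun (((G.form_continuous hcd v k j).comp
    (isHomOp_mulLeft S.q_mem).weightContinuous).eq_zero
    (weightHom_le_span_monomial S.wt_ne_zero) fun n => ?_) f
  have := G.form_vec_inr hcd v k j (Sum.inr n)
  simpa [vec] using this

theorem form_pderiv_mul (v : Fin 2 → ℂ) (k : ℕ) (j : Σ l, Fin (G.e l))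
    {f : MvPowerSeries (Fin 3) ℂ} (hf : pderiv ℂ 2 f = 0) :
    G.form hcd v k j (pderiv ℂ 2 S.q * f) = 0 := by
  have h := LinearMap.congr_fun ((((G.form_continuous hcd v k j).comp
    (isHomOp_mulLeft (pderiv_mem_weightHom S.q_mem (i := 2) hcd.le)).weightContinuous).comp
    (isHomOp_zConstLin (w := S.wt)).weightContinuous).eq_zero
    (weightHom_le_span_monomial S.wt_ne_zero) fun n => ?_) f
  · change G.form hcd v k j (pderiv ℂ 2 S.q * zConst f) = 0 at h
    rwa [zConst, hf, map_zero, sub_zero] at h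
  · change G.form hcd v k j (pderiv ℂ 2 S.q * zConst (monomial n 1)) = 0
    rw [zConst_monomial]
    split_ifs with hn
    · have h1 : n = Finsupp.single 0 (n 0) + Finsupp.single 1 (n 1) := by
        ext i
        fin_cases i <;> simp [hn]
      rw [h1]
      exact G.form_vec_inr hcd v k j (Sum.inl (n 0, n 1))
    · rw [mul_zero, map_zero]

theorem form_crossOp_pderiv_mul (v : Fin 2 → ℂ) (k : ℕ) (j : Σ l, Fin (G.e l)) (i : Fin 3)
    {f : MvPowerSeries (Fin 3) ℂ} (hf : pderiv ℂ 2 f = 0) :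
    G.form hcd v k j (crossOp S.q i (pderiv ℂ 2 S.q * f)) = 0 := by
  rw [crossOp_pderiv_mul _ hf, map_sub, form_mul, form_pderiv_mul hcd G v k j
    (pderiv_pderiv_eq_zero i (pderiv_zConst_mul _ hf)), sub_zero]

/-- Checked on the spanning family with parameter 1, not on the basis with parameter 0: A and B map
Qf + Q_z∫f to Q(Af) and Q(Bf), which the form kills. On A^r B^s e_j the two terms cancel, since
replacing r by r + 1 multiplies the form by v₀ and replacing s by s + 1 multiplies it by v₁. -/
theorem form_crossOp (v : Fin 2 → ℂ) (k : ℕ) (j : Σ l, Fin (G.e l)) (f : MvPowerSeries (Fin 3) ℂ) :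
    G.form hcd v k j ((v 1 • crossOp S.q 0 - v 0 • crossOp S.q 1) f) = 0 := by
  classical
  have hcont : WeightContinuous S.wt (v 1 • crossOp S.q 0 - v 0 • crossOp S.q 1) :=
    ((raises_crossOp hcd 0).weightContinuous.smul _).sub
      ((raises_crossOp hcd 1).weightContinuous.smul _)
  refine LinearMap.congr_fun (((G.form_continuous hcd v k j).comp hcont).eq_zero
    (fun m => G.weightHom_le_vecSpan hcd m 1) fun x => ?_) f
  change G.form hcd v k j (v 1 • crossOp S.q 0 (G.vec 1 x) - v 0 • crossOp S.q 1 (G.vec 1 x)) = 0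
  rw [map_sub, map_smul, map_smul]
  rcases x with ⟨⟨r, s⟩, j'⟩ | ⟨m, n⟩ | n
  · have h0 : crossOp S.q 0 (G.vec 1 (Sum.inl ((r, s), j'))) =
        (crossOp S.q 0 ^ (r + 1) * crossOp S.q 1 ^ s) (G.E j') := by
      rw [pow_succ', mul_assoc]
      rfl
    have h1 : crossOp S.q 1 (G.vec 1 (Sum.inl ((r, s), j'))) =
        (crossOp S.q 0 ^ r * crossOp S.q 1 ^ (s + 1)) (G.E j') := by
      rw [pow_succ', ← mul_assoc,
        ((crossOp_comm S.q (by decide : (0 : Fin 3) ≠ 2) (by decide : (1 : Fin 3) ≠ 2)).pow_left r).eq]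
      rfl
    rw [h0, h1, form_vec_inl, form_vec_inl, show r + 1 + s = r + (s + 1) by omega]
    split_ifs
    · simp only [smul_eq_mul]
      ring
    · simp
  · have h : pderiv ℂ 2 (monomial (Finsupp.single (0 : Fin 3) m + Finsupp.single 1 n) (1 : ℂ)) = 0 :=
      pderiv_monomial_eq_zero (by simp)
    have h1 : G.vec 1 (Sum.inr (Sum.inl (m, n))) = pderiv ℂ 2 S.q *
      monomial (Finsupp.single (0 : Fin 3) m + Finsupp.single 1 n) (1 : ℂ) := rfl
    rw [h1, form_crossOp_pderiv_mul hcd G v k j 0 h, form_crossOp_pderiv_mul hcd G v k j 1 h]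
    simp
  · have h1 : G.vec 1 (Sum.inr (Sum.inr n)) = S.q * monomial n 1 + ((0 : ℂ) + 1) • zOp S.q (monomial n 1) := by
      simp [vec]
    rw [h1, crossOp_mul_add _ (by decide), crossOp_mul_add _ (by decide), zero_smul, zero_smul,
      add_zero, add_zero, form_mul, form_mul]
    simp

theorem form_pow (v l : Fin 2 → ℂ) (k m : ℕ) (j j' : Σ l, Fin (G.e l)) [Decidable (m = k ∧ j' = j)] :
    G.form hcd v k j (((l 0 • crossOp S.q 0 + l 1 • crossOp S.q 1) ^ m) (G.E j')) =
      if m = k ∧ j' = j then (l 0 * v 0 + l 1 * v 1) ^ m else 0 := by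
  classical
  -- The generality in r and s lets the induction expand one factor l₀A + l₁B into monomials; each
  -- factor multiplies the form by l₀v₀ + l₁v₁.
  have key : ∀ m r s : ℕ, G.form hcd v k j (((l 0 • crossOp S.q 0 + l 1 • crossOp S.q 1) ^ m)
      ((crossOp S.q 0 ^ r * crossOp S.q 1 ^ s) (G.E j'))) =
      if m + (r + s) = k ∧ j' = j then (l 0 * v 0 + l 1 * v 1) ^ m * (v 0 ^ r * v 1 ^ s) else 0 := by
    intro m
    induction m with
    | zero =>
      intro r s
      simp only [pow_zero, zero_add, one_mul, Module.End.one_apply]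
      exact G.form_vec_inl hcd v k j j' r s
    | succ m ih =>
      intro r s
      have h : (l 0 • crossOp S.q 0 + l 1 • crossOp S.q 1)
          ((crossOp S.q 0 ^ r * crossOp S.q 1 ^ s) (G.E j')) =
          l 0 • (crossOp S.q 0 ^ (r + 1) * crossOp S.q 1 ^ s) (G.E j') +
          l 1 • (crossOp S.q 0 ^ r * crossOp S.q 1 ^ (s + 1)) (G.E j') := by
        rw [pow_succ' (crossOp S.q 0), pow_succ' (crossOp S.q 1), ← mul_assoc (crossOp S.q 0 ^ r),
          ((crossOp_comm S.q (by decide : (0 : Fin 3) ≠ 2) (by decide : (1 : Fin 3) ≠ 2)).pow_left r).eq]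
        rfl
      rw [pow_succ, Module.End.mul_apply, h, map_add, map_smul, map_smul, map_add, map_smul, map_smul,
        ih, ih, show m + 1 + (r + s) = m + (r + 1 + s) by omega,
        show m + (r + (s + 1)) = m + (r + 1 + s) by omega]
      split_ifs
      · simp only [smul_eq_mul]
        ring
      · simp
  have := key m 0 0
  simp only [pow_zero, add_zero, mul_one, Module.End.one_apply] at this
  rw [this]

omit hcd in
theorem finite_index_lt (M : ℕ) : {x : ℕ × (Σ l, Fin (G.e l)) | x.1 + x.2.1 < M}.Finite := by
  refine Set.Finite.subset ((Finset.range M) ×ˢ (Finset.range M).sigma fun _ => Finset.univ).finite_toSet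
    fun x hx => ?_
  have hx' : x.1 + x.2.1 < M := hx
  simp only [Finset.coe_product, Set.mem_prod, Finset.mem_coe, Finset.mem_sigma, Finset.mem_range,
    Finset.mem_univ, and_true]
  omega

/-- The sum of the series `∑ c_{k j} C ^ k e_j` with `C = l₀ A + l₁ B`. -/
def sec (l : Fin 2 → ℂ) (c : ℕ × (Σ l, Fin (G.e l)) → ℂ) : MvPowerSeries (Fin 3) ℂ :=
  fun n => ∑ x ∈ (G.finite_index_lt (Finsupp.weight S.wt n + 1)).toFinset,
    c x * coeff n (((l 0 • crossOp S.q 0 + l 1 • crossOp S.q 1) ^ x.1) (G.E x.2))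

theorem pow_mem (l : Fin 2 → ℂ) (x : ℕ × (Σ l, Fin (G.e l))) :
    ((l 0 • crossOp S.q 0 + l 1 • crossOp S.q 1) ^ x.1) (G.E x.2) ∈ weightOrd S.wt (x.1 + x.2.1) := by
  have h : Raises S.wt 1 (l 0 • crossOp S.q 0 + l 1 • crossOp S.q 1) :=
    ((raises_crossOp hcd 0).smul _).add ((raises_crossOp hcd 1).smul _)
  rw [add_comm]
  exact h.pow x.1 _ _ (weightHom_le_weightOrd le_rfl (G.mem x.2))

theorem hasWeightSum_sec (l : Fin 2 → ℂ) (c : ℕ × (Σ l, Fin (G.e l)) → ℂ) :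
    HasWeightSum S.wt (fun x => c x •
      ((l 0 • crossOp S.q 0 + l 1 • crossOp S.q 1) ^ x.1) (G.E x.2)) (G.sec l c) := by
  refine fun M => ⟨(G.finite_index_lt M).toFinset, fun t ht n hn => ?_⟩
  rw [map_sub, map_sum, sub_eq_zero]
  change ∑ x ∈ (G.finite_index_lt (Finsupp.weight S.wt n + 1)).toFinset, _ = _
  simp only [map_smul, smul_eq_mul]
  refine Finset.sum_subset (Finset.Subset.trans (fun x hx => ?_) ht) fun x _ hx => ?_
  · rw [Set.Finite.mem_toFinset] at hx ⊢
    have hx' : x.1 + x.2.1 < Finsupp.weight S.wt n + 1 := hx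
    exact lt_of_lt_of_le hx' hn
  · rw [Set.Finite.mem_toFinset] at hx
    have hx' : ¬ (x.1 + x.2.1 < Finsupp.weight S.wt n + 1) := hx
    rw [G.pow_mem hcd l x n (by omega), mul_zero]

theorem form_sec (v l : Fin 2 → ℂ) (c : ℕ × (Σ l, Fin (G.e l)) → ℂ) (k : ℕ) (j : Σ l, Fin (G.e l)) :
    G.form hcd v k j (G.sec l c) = c (k, j) * (l 0 * v 0 + l 1 * v 1) ^ k := by
  classical
  rw [(G.hasWeightSum_sec hcd l c).functional_eq (G.form_continuous hcd v k j) (k, j) fun x hx => ?_]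
  · rw [map_smul, form_pow, if_pos ⟨rfl, rfl⟩, smul_eq_mul]
  · rw [map_smul, form_pow, if_neg, smul_zero]
    rintro ⟨h1, h2⟩
    exact hx (Prod.ext h1 h2)

/-- Expand f in the basis and replace each A^r B^s e_j by v₀^r v₁^s C^(r+s) e_j plus an element of
the image of T. The collected coefficient of C^k e_j is the form (k, j) of f, hence zero, and what
is left is T h, a multiple of Q_z by a series in x, y, and a multiple of Q. -/
theorem exists_eq_of_form_eq_zero {v : Fin 2 → ℂ} (hv : v ≠ 0) {f : MvPowerSeries (Fin 3) ℂ}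
    (hf : ∀ k j, G.form hcd v k j f = 0) :
    ∃ h c g : MvPowerSeries (Fin 3) ℂ, pderiv ℂ 2 c = 0 ∧
      f = (v 1 • crossOp S.q 0 - v 0 • crossOp S.q 1) h + pderiv ℂ 2 S.q * c + S.q * g := by
  classical
  obtain ⟨l, hl⟩ : ∃ l : Fin 2 → ℂ, l 0 * v 0 + l 1 * v 1 = 1 := by
    by_cases h0 : v 0 = 0
    · have h1 : v 1 ≠ 0 := fun h1 => hv (by ext i; fin_cases i <;> simp [h0, h1])
      exact ⟨![0, (v 1)⁻¹], by simp [h1]⟩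
    · exact ⟨![(v 0)⁻¹, 0], by simp [h0]⟩
  choose U hU hUe using fun r s => exists_pow_mul_pow_eq (w := S.wt)
    (crossOp_comm S.q (by decide : (0 : Fin 3) ≠ 2) (by decide : (1 : Fin 3) ≠ 2))
    (raises_crossOp hcd 0) (raises_crossOp hcd 1) hl r s
  set T := v 1 • crossOp S.q 0 - v 0 • crossOp S.q 1 with hT
  set C := l 0 • crossOp S.q 0 + l 1 • crossOp S.q 1 with hC
  have hTc : WeightContinuous S.wt T := ((raises_crossOp hcd 0).weightContinuous.smul _).sub
    ((raises_crossOp hcd 1).weightContinuous.smul _)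
  let Λ := fun x : (ℕ × ℕ) × (Σ l, Fin (G.e l)) => G.coord hcd (Sum.inl x) f
  -- The cofactors have order at least r + s - 1, so only finitely many terms have order below M and
  -- the sums over all r, s, j converge.
  have hfin : ∀ M, {x : (ℕ × ℕ) × (Σ l, Fin (G.e l)) | x.1.1 + x.1.2 - 1 + x.2.1 < M}.Finite := by
    intro M
    refine Set.Finite.subset ((Finset.range (M + 1) ×ˢ Finset.range (M + 1)) ×ˢ
      (Finset.range M).sigma fun _ => Finset.univ).finite_toSet fun x hx => ?_
    have hx' : x.1.1 + x.1.2 - 1 + x.2.1 < M := hx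
    simp only [Finset.coe_product, Set.mem_prod, Finset.mem_coe, Finset.mem_sigma,
      Finset.mem_range, Finset.mem_univ, and_true]
    omega
  obtain ⟨h, hh⟩ := exists_hasWeightSum (w := S.wt)
    (F := fun x : (ℕ × ℕ) × (Σ l, Fin (G.e l)) => Λ x • U x.1.1 x.1.2 (G.E x.2)) (by
      intro M
      refine (hfin M).subset fun x hx => ?_
      by_contra hx'
      have hx'' : ¬ (x.1.1 + x.1.2 - 1 + x.2.1 < M) := hx'
      refine hx (Submodule.smul_mem _ _ (weightOrd_mono ?_ (hU x.1.1 x.1.2 _ _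
        (weightHom_le_weightOrd le_rfl (G.mem x.2)))))
      omega)
  obtain ⟨g0, hg0⟩ := exists_hasWeightSum (w := S.wt)
    (F := fun x : (ℕ × ℕ) × (Σ l, Fin (G.e l)) =>
      Λ x • (v 0 ^ x.1.1 * v 1 ^ x.1.2) • (C ^ (x.1.1 + x.1.2)) (G.E x.2)) (by
      intro M
      refine (hfin M).subset fun x hx => ?_
      by_contra hx'
      have hx'' : ¬ (x.1.1 + x.1.2 - 1 + x.2.1 < M) := hx'
      refine hx (Submodule.smul_mem _ _ (Submodule.smul_mem _ _ (weightOrd_mono ?_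
        (G.pow_mem hcd l (x.1.1 + x.1.2, x.2)))))
      simp only
      omega)
  have hg00 : g0 = 0 := by
    refine eq_zero_of_forall_mem_weightOrd (w := S.wt) fun M => ?_
    obtain ⟨s, hs⟩ := hg0 M
    -- A finite set of indices is enlarged to a union of full antidiagonals r + s = k, over each of
    -- which the partial sum is a form of f times C^k e_j.
    let K : Finset (ℕ × (Σ l, Fin (G.e l))) := s.image fun x => (x.1.1 + x.1.2, x.2)
    let t : Finset ((ℕ × ℕ) × (Σ l, Fin (G.e l))) :=
      K.biUnion fun y => (Finset.HasAntidiagonal.antidiagonal y.1).map ⟨fun x => (x, y.2), Prod.mk_left_injective y.2⟩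
    have ht : s ⊆ t := fun x hx => Finset.mem_biUnion.2
      ⟨_, Finset.mem_image_of_mem _ hx, Finset.mem_map.2
        ⟨x.1, Finset.HasAntidiagonal.mem_antidiagonal.2 rfl, rfl⟩⟩
    have h1 := hs t ht
    have h2 : ∑ x ∈ t, Λ x • (v 0 ^ x.1.1 * v 1 ^ x.1.2) • (C ^ (x.1.1 + x.1.2)) (G.E x.2) = 0 := by
      rw [Finset.sum_biUnion]
      · refine Finset.sum_eq_zero fun y _ => ?_
        rw [Finset.sum_map]
        simp only [Function.Embedding.coeFn_mk]
        have h3 := hf y.1 y.2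
        rw [form_apply] at h3
        have h4 : ∀ x ∈ Finset.HasAntidiagonal.antidiagonal y.1,
            Λ (x, y.2) • (v 0 ^ x.1 * v 1 ^ x.2) • (C ^ (x.1 + x.2)) (G.E y.2) =
              (v 0 ^ x.1 * v 1 ^ x.2 * Λ (x, y.2)) • (C ^ y.1) (G.E y.2) := by
          intro x hx
          rw [Finset.HasAntidiagonal.mem_antidiagonal.1 hx, smul_smul, mul_comm]
        rw [Finset.sum_congr rfl h4, ← Finset.sum_smul, h3, zero_smul]
      · intro y _ y' _ hyy
        rw [Function.onFun, Finset.disjoint_left]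
        intro x hx hx'
        obtain ⟨z, hz, rfl⟩ := Finset.mem_map.1 hx
        obtain ⟨z', hz', hzz⟩ := Finset.mem_map.1 hx'
        obtain ⟨e1, e2⟩ := Prod.mk.inj hzz
        refine hyy (Prod.ext ?_ e2.symm)
        rw [← Finset.HasAntidiagonal.mem_antidiagonal.1 hz, ← Finset.HasAntidiagonal.mem_antidiagonal.1 hz', e1]
    rwa [h2, sub_zero] at h1
  have hpart1 := hg0.add (hh.map hTc)
  rw [hg00, zero_add] at hpart1
  obtain ⟨c, hc⟩ := exists_hasWeightSum (w := S.wt) (F := fun x : ℕ × ℕ =>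
    G.coord hcd (Sum.inr (Sum.inl x)) f •
      monomial (Finsupp.single (0 : Fin 3) x.1 + Finsupp.single 1 x.2) (1 : ℂ)) (by
      intro M
      refine Set.Finite.subset (Finset.range M ×ˢ Finset.range M).finite_toSet fun x hx => ?_
      by_contra hx'
      refine hx (Submodule.smul_mem _ _ (weightHom_le_weightOrd ?_ (monomial_mem_weightHom _ _)))
      rw [weight_xy]
      simp only [Finset.coe_product, Set.mem_prod, Finset.mem_coe, Finset.mem_range, not_and_or,
        not_lt] at hx'
      have ha := S.a_pos
      have hab := S.a_le_b
      rcases hx' with h1 | h1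
      · nlinarith [Nat.le_mul_of_pos_right x.1 ha]
      · nlinarith [Nat.le_mul_of_pos_right x.2 (ha.trans_le hab)])
  obtain ⟨g, hg⟩ := exists_hasWeightSum (w := S.wt) (F := fun n : Fin 3 →₀ ℕ =>
    G.coord hcd (Sum.inr (Sum.inr n)) f • monomial n (1 : ℂ)) (by
      intro M
      refine (finite_weight_lt S.wt_ne_zero M).subset fun x hx => ?_
      by_contra hx'
      exact hx (Submodule.smul_mem _ _ (weightHom_le_weightOrd (not_lt.1 hx')
        (monomial_mem_weightHom _ _))))
  refine ⟨h, c, g, ?_, ?_⟩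
  · have h1 := hc.map (isHomOp_pderiv_weightContinuous 2)
    refine h1.unique (g := 0) fun M => ⟨∅, fun t _ => ?_⟩
    rw [Finset.sum_eq_zero, sub_zero]
    · exact Submodule.zero_mem _
    · intro x _
      rw [map_smul]
      change _ • pderiv ℂ 2 _ = _
      rw [pderiv_monomial_eq_zero (by simp), smul_zero]
  · have h2 := hc.map (isHomOp_mulLeft
      (pderiv_mem_weightHom S.q_mem (i := 2) hcd.le)).weightContinuous
    have h3 := hg.map (isHomOp_mulLeft S.q_mem).weightContinuous
    have h4 := hpart1.sum_elim (h2.sum_elim h3)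
    rw [add_assoc]
    refine (G.hasWeightSum_coord hcd f).unique ?_
    refine (congrArg (fun F => HasWeightSum S.wt F _) ?_).mpr h4
    funext x
    rcases x with ⟨⟨r, s⟩, j⟩ | x | x
    · simp only [Sum.elim_inl, map_smul, ← smul_add]
      have := LinearMap.congr_fun (hUe r s) (G.E j)
      exact congrArg _ this
    · simp only [Sum.elim_inl, Sum.elim_inr, map_smul]
      rfl
    · simp only [Sum.elim_inr, map_smul]
      simp [vec]

end Generators

end QHSurface

/-! ### Functionals on the completed coordinate ring -/

theorem continuous_of_finite_dependence {N X : Type*} {K : N → Type*} [∀ n, TopologicalSpace (K n)]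
    [∀ n, DiscreteTopology (K n)] [TopologicalSpace X] {φ : (∀ n, K n) → X} (s : Finset N)
    (h : ∀ f g, (∀ n ∈ s, f n = g n) → φ f = φ g) : Continuous φ := by
  refine IsLocallyConstant.continuous ((IsLocallyConstant.iff_exists_open φ).2 fun f =>
    ⟨(s : Set N).pi fun n => {f n}, isOpen_set_pi s.finite_toSet fun _ _ => isOpen_discrete _,
      fun n _ => rfl, fun g hg => h g f fun n hn => hg n hn⟩)

namespace MvPowerSeries

/-- The topology of coefficientwise convergence, for discrete coefficients. -/
@[reducible] def topPS : TopologicalSpace (MvPowerSeries (Fin 3) ℂ) :=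
  @Pi.topologicalSpace (Fin 3 →₀ ℕ) (fun _ => ℂ) (fun _ => ⊥)

variable {w : Fin 3 → ℕ}

theorem WeightContinuousFunctional.continuous {l : MvPowerSeries (Fin 3) ℂ →ₗ[ℂ] ℂ}
    (hw : ∀ i, w i ≠ 0) (hl : WeightContinuousFunctional w l) : Continuous[topPS, ⊥] l := by
  obtain ⟨M, hM⟩ := hl
  refine @continuous_of_finite_dependence (Fin 3 →₀ ℕ) ℂ (fun _ => ℂ) (fun _ => ⊥)
    (fun _ => @DiscreteTopology.mk ℂ ⊥ rfl) ⊥ l (finite_weight_lt hw M).toFinset fun f g h => ?_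
  rw [← sub_eq_zero]
  refine (map_sub l f g).symm.trans (hM _ fun n hn => ?_)
  refine (map_sub (coeff n) (show MvPowerSeries (Fin 3) ℂ from f) g).trans (sub_eq_zero.2 ?_)
  exact h n ((Set.Finite.mem_toFinset _).2 hn)

theorem exists_weightOrd_subset (w : Fin 3 → ℕ) {U : Set (MvPowerSeries (Fin 3) ℂ)}
    (hU : IsOpen[topPS] U) {f : MvPowerSeries (Fin 3) ℂ} (hf : f ∈ U) :
    ∃ M, ∀ g, g - f ∈ weightOrd w M → g ∈ U := by
  let : TopologicalSpace ℂ := ⊥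
  obtain ⟨s, u, hu, hs⟩ := isOpen_pi_iff.1 hU f hf
  refine ⟨∑ n ∈ s, (Finsupp.weight w n + 1), fun g hg => hs fun n hn => ?_⟩
  have h1 := hg n (lt_of_lt_of_le (Nat.lt_succ_self _) (Finset.single_le_sum
    (f := fun n => Finsupp.weight w n + 1) (fun _ _ => Nat.zero_le _) hn))
  rw [map_sub, sub_eq_zero] at h1
  have h2 : g n = f n := h1
  rw [h2]
  exact (hu n hn).2

/-- As ℂ is discrete, the kernel is open and contains all series of sufficiently high order. -/
theorem weightContinuousFunctional_of_continuous (w : Fin 3 → ℕ)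
    {l : MvPowerSeries (Fin 3) ℂ →ₗ[ℂ] ℂ} (hl : Continuous[topPS, ⊥] l) :
    WeightContinuousFunctional w l := by
  have h1 : IsOpen[topPS] (l ⁻¹' {0}) :=
    @IsOpen.preimage _ _ topPS ⊥ l hl {0} (@isOpen_discrete ℂ ⊥ (@DiscreteTopology.mk ℂ ⊥ rfl) _)
  obtain ⟨M, hM⟩ := exists_weightOrd_subset w h1 (f := 0) (map_zero l)
  exact ⟨M, fun f hf => hM f (by rwa [sub_zero])⟩

end MvPowerSeries

namespace QHSurface

open MvPowerSeries EquivP1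

section Quotient

variable (S : QHSurface)

/-- The projection from the power series ring as a linear map. -/
def mkL : MvPowerSeries (Fin 3) ℂ →ₗ[ℂ] S.OX := (Ideal.Quotient.mkₐ ℂ S.I).toLinearMap

theorem mkL_apply (f : MvPowerSeries (Fin 3) ℂ) : S.mkL f = Ideal.Quotient.mk S.I f := rfl

theorem mkL_surjective : Function.Surjective S.mkL := Ideal.Quotient.mk_surjective

theorem mkL_q_mul (h : MvPowerSeries (Fin 3) ℂ) : S.mkL (S.q * h) = 0 := S.mk_Q_mul h

variable {S}

/-- A functional that vanishes on multiples of the equation, on the quotient. -/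
def descend (l : MvPowerSeries (Fin 3) ℂ →ₗ[ℂ] ℂ) (hl : ∀ h, l (S.q * h) = 0) : S.OX →ₗ[ℂ] ℂ where
  toFun F := l (Quotient.out F)
  map_add' F G := by
    obtain ⟨f, rfl⟩ := S.mkL_surjective F
    obtain ⟨g, rfl⟩ := S.mkL_surjective G
    obtain ⟨h1, e1⟩ := S.exists_out f
    obtain ⟨h2, e2⟩ := S.exists_out g
    obtain ⟨h3, e3⟩ := S.exists_out (f + g)
    rw [← map_add, mkL_apply, mkL_apply, mkL_apply, e1, e2, e3]
    simp only [map_add, hl, add_zero]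
  map_smul' r F := by
    obtain ⟨f, rfl⟩ := S.mkL_surjective F
    obtain ⟨h1, e1⟩ := S.exists_out f
    obtain ⟨h3, e3⟩ := S.exists_out (r • f)
    rw [← map_smul, mkL_apply, mkL_apply, e1, e3]
    simp only [map_add, map_smul, hl, add_zero, RingHom.id_apply]

theorem descend_mkL (l : MvPowerSeries (Fin 3) ℂ →ₗ[ℂ] ℂ) (hl : ∀ h, l (S.q * h) = 0)
    (f : MvPowerSeries (Fin 3) ℂ) : descend l hl (S.mkL f) = l f := by
  obtain ⟨h1, e1⟩ := S.exists_out f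
  change l (Quotient.out (Ideal.Quotient.mk S.I f)) = l f
  rw [e1, map_add, hl, add_zero]

theorem continuous_OX_iff {X : Type*} [TopologicalSpace X] {φ : S.OX → X} :
    Continuous[S.topOX, _] φ ↔ Continuous[topPS, _] (φ ∘ S.mkL) := continuous_coinduced_dom

theorem continuous_mkL : Continuous[topPS, S.topOX] S.mkL := continuous_coinduced_rng

theorem continuous_of_weightContinuous {l : S.OX →ₗ[ℂ] ℂ}
    (hl : WeightContinuousFunctional S.wt (l ∘ₗ S.mkL)) : Continuous[S.topOX, ⊥] l :=
  (@continuous_OX_iff S ℂ ⊥ l).2 (hl.continuous S.wt_ne_zero)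

end Quotient

variable {S : QHSurface} (hcd : S.c < S.d)

theorem weightComp_rescale (u : ℂˣ) (m : ℕ) (f : MvPowerSeries (Fin 3) ℂ) :
    weightComp S.wt m (rescale (S.scaleVec u) f) = ((u : ℂ) ^ m) • weightComp S.wt m f := by
  ext n
  rw [map_smul, coeff_weightComp, coeff_weightComp, coeff_rescale, scaleVec_prod]
  split_ifs with h
  · rw [h, smul_eq_mul]
  · simp

namespace Generators

variable (G : S.Generators)

theorem coord_inl_mul (x : (ℕ × ℕ) × (Σ l, Fin (G.e l))) (f : MvPowerSeries (Fin 3) ℂ) :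
    G.coord hcd (Sum.inl x) (S.q * f) = 0 := by
  classical
  refine LinearMap.congr_fun ((WeightContinuousFunctional.comp (w := S.wt)
    ⟨_, fun f hf => G.coord_eq_zero hcd (Sum.inl x) hf⟩
    (isHomOp_mulLeft S.q_mem).weightContinuous).eq_zero
    (weightHom_le_span_monomial S.wt_ne_zero) fun n => ?_) f
  have := G.coord_vec hcd (Sum.inl x) (Sum.inr (Sum.inr n))
  rw [if_neg (by simp)] at this
  simpa [vec] using this

/-- The functional `L_{r s j}` on the completed coordinate ring. -/
def lam (x : (ℕ × ℕ) × (Σ l, Fin (G.e l))) : S.OX →ₗ[ℂ] ℂ :=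
  descend (G.coord hcd (Sum.inl x)) (G.coord_inl_mul hcd x)

theorem lam_mkL (x : (ℕ × ℕ) × (Σ l, Fin (G.e l))) (f : MvPowerSeries (Fin 3) ℂ) :
    G.lam hcd x (S.mkL f) = G.coord hcd (Sum.inl x) f := descend_mkL _ _ f

theorem continuous_lam (x : (ℕ × ℕ) × (Σ l, Fin (G.e l))) :
    Continuous[S.topOX, ⊥] (G.lam hcd x) :=
  continuous_of_weightContinuous ⟨_, fun f hf => by
    rw [LinearMap.comp_apply, lam_mkL]
    exact G.coord_eq_zero hcd (Sum.inl x) hf⟩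

theorem lam_scale (u : ℂˣ) (x : (ℕ × ℕ) × (Σ l, Fin (G.e l))) (F : S.OX) :
    G.lam hcd x (S.scale u F) =
      (u : ℂ) ^ (x.1.1 * (S.d - S.a) + x.1.2 * (S.d - S.b) + x.2.1) * G.lam hcd x F := by
  obtain ⟨f, rfl⟩ := S.mkL_surjective F
  have h := S.scale_mk u f
  rw [← mkL_apply, ← mkL_apply] at h
  rw [h, lam_mkL, lam_mkL, coord_weightComp, weightComp_rescale, map_smul, ← coord_weightComp]
  rfl

/-- The functional `∑_{r + s = k} α ^ r β ^ s L_{r s j}` on the completed coordinate ring. -/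
def formX (v : Plane) (i : ℕ × (Σ l, Fin (G.e l))) : S.OX →ₗ[ℂ] ℂ :=
  ∑ x ∈ Finset.HasAntidiagonal.antidiagonal i.1, (v 0 ^ x.1 * v 1 ^ x.2) • G.lam hcd (x, i.2)

theorem formX_apply (v : Plane) (i : ℕ × (Σ l, Fin (G.e l))) (F : S.OX) :
    G.formX hcd v i F = ∑ x ∈ Finset.HasAntidiagonal.antidiagonal i.1,
      v 0 ^ x.1 * v 1 ^ x.2 * G.lam hcd (x, i.2) F := by
  simp [formX]

theorem formX_mkL (v : Plane) (i : ℕ × (Σ l, Fin (G.e l))) (f : MvPowerSeries (Fin 3) ℂ) :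
    G.formX hcd v i (S.mkL f) = G.form hcd v i.1 i.2 f := by
  rw [formX_apply, form_apply]
  simp only [lam_mkL]

theorem continuous_formX (v : Plane) (i : ℕ × (Σ l, Fin (G.e l))) :
    Continuous[S.topOX, ⊥] (G.formX hcd v i) := by
  refine continuous_of_weightContinuous ?_
  obtain ⟨M, hM⟩ := G.form_continuous hcd v i.1 i.2
  exact ⟨M, fun f hf => by rw [LinearMap.comp_apply, formX_mkL, hM f hf]⟩

theorem formX_smul (r : ℂ) (v : Plane) (i : ℕ × (Σ l, Fin (G.e l))) (F : S.OX) :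
    G.formX hcd (r • v) i F = r ^ i.1 * G.formX hcd v i F := by
  rw [formX_apply, formX_apply, Finset.mul_sum]
  refine Finset.sum_congr rfl fun x hx => ?_
  rw [← Finset.HasAntidiagonal.mem_antidiagonal.1 hx]
  simp only [Pi.smul_apply, smul_eq_mul]
  ring

include hcd in
-- With r + s = k, every summand has weight ra + sb + r(d - a) + s(d - b) + l = kd + l, whatever r
-- and s are. It is written as (k(d - a) + l) + ak to match the exponent m + an in `lineBundle`.
theorem formX_torus (u : ℂˣ) (v : Plane) (i : ℕ × (Σ l, Fin (G.e l))) (F : S.OX) :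
    G.formX hcd (torus S.a S.b u v) i (S.scale u F) =
      (u : ℂ) ^ (i.1 * (S.d - S.a) + i.2.1 + S.a * i.1) * G.formX hcd v i F := by
  rw [formX_apply, formX_apply, Finset.mul_sum]
  refine Finset.sum_congr rfl fun x hx => ?_
  have hx' := Finset.HasAntidiagonal.mem_antidiagonal.1 hx
  obtain ⟨a', ha'⟩ : ∃ a', S.d = S.a + a' := ⟨S.d - S.a, by
    have := S.a_le_b
    have := S.b_le_c
    omega⟩
  obtain ⟨b', hb'⟩ : ∃ b', S.d = S.b + b' := ⟨S.d - S.b, by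
    have := S.b_le_c
    omega⟩
  have h1 : S.d - S.a = a' := by omega
  have h2 : S.d - S.b = b' := by omega
  have h3 : i.1 * a' + i.2.1 + S.a * i.1 = S.a * x.1 + S.b * x.2 + (x.1 * a' + x.2 * b' + i.2.1) := by
    have h4 : S.a + a' = S.b + b' := by omega
    rw [← hx']
    calc _ = x.1 * (S.a + a') + x.2 * (S.a + a') + i.2.1 := by ring
      _ = x.1 * (S.a + a') + x.2 * (S.b + b') + i.2.1 := by rw [h4]
      _ = _ := by ring
  rw [lam_scale, h1, h2, h3, pow_add _ (S.a * x.1 + S.b * x.2), pow_add _ (S.a * x.1), pow_mul, pow_mul]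
  simp only [torus, LinearMap.coe_mk, AddHom.coe_mk, Matrix.cons_val_zero, Matrix.cons_val_one]
  ring

theorem bracket_lin (v : Plane) (g : MvPowerSeries (Fin 3) ℂ) :
    S.bracket (S.lin v) (S.mkL g) = S.mkL (S.bracketPS (v 0 • X 0 + v 1 • X 1) g) := by
  have : S.lin v = S.mkL (v 0 • X 0 + v 1 • X 1) := by
    rw [map_add, map_smul, map_smul]
    rfl
  rw [this]
  exact S.bracket_mk _ _

include hcd in
-- Forms kill brackets by `form_crossOp` and `form_pderiv_mul`. Conversely f = (v₁A - v₀B)h + Q_z c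
-- + Qg; solving v₀ ∂_y g₀ - v₁ ∂_x g₀ = c, the bracket with ∫h + g₀ is f modulo Q. In particular a
-- single bracket suffices.
theorem mem_brackets_iff {v : Plane} (hv : v ≠ 0) (F : S.OX) :
    F ∈ S.brackets (Projectivization.mk ℂ v hv) ↔ ∀ i, G.formX hcd v i F = 0 := by
  constructor
  · intro hF i
    induction hF using Submodule.span_induction with
    | mem F hF =>
      obtain ⟨u, hu, g, rfl⟩ := hF
      obtain ⟨g, rfl⟩ := S.mkL_surjective g
      rw [Projectivization.submodule_mk, Submodule.mem_span_singleton] at hu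
      obtain ⟨r, rfl⟩ := hu
      rw [bracket_lin, formX_mkL, bracketPS_linear, map_add,
        G.form_pderiv_mul hcd v i.1 i.2 (by
          rw [map_sub, Derivation.map_smul, Derivation.map_smul,
            pderiv_pderiv_eq_zero _ (pderiv_sub_zInt g), pderiv_pderiv_eq_zero _ (pderiv_sub_zInt g)]
          simp), add_zero]
      have := congrArg (r * ·) (G.form_crossOp hcd v i.1 i.2 (pderiv ℂ 2 g))
      simp only [LinearMap.sub_apply, LinearMap.smul_apply, map_sub, map_smul, smul_eq_mul,
        Pi.smul_apply, mul_zero] at this ⊢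
      rw [← this]
      ring
    | zero => rw [map_zero]
    | add F F' _ _ h1 h2 => rw [map_add, h1, h2, add_zero]
    | smul r F _ h => rw [map_smul, h, smul_zero]
  · intro hF
    obtain ⟨f, rfl⟩ := S.mkL_surjective F
    obtain ⟨h, c, g, hc, rfl⟩ := G.exists_eq_of_form_eq_zero hcd hv fun k j => by
      rw [← hF (k, j), formX_mkL]
    have hv' : v 0 ≠ 0 ∨ v 1 ≠ 0 := by
      by_contra! h
      exact hv (by ext i; fin_cases i; exacts [h.1, h.2])
    obtain ⟨g0, hg0, hg0c⟩ := exists_pderiv_sub_eq hv' hc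
    refine Submodule.subset_span ⟨v, ?_, S.mkL (zInt h + g0), ?_⟩
    · rw [Projectivization.submodule_mk]
      exact Submodule.mem_span_singleton_self _
    · rw [bracket_lin, bracketPS_linear, map_add (pderiv ℂ 2), hg0, pderiv_zInt, add_zero,
        add_sub_cancel_left, hg0c, map_add, mkL_q_mul, add_zero]
      rfl

include hcd in
theorem sec_sub_mem (l : Fin 2 → ℂ) (c : ℕ × (Σ l, Fin (G.e l)) → ℂ) (M : ℕ) :
    G.sec l c - ∑ x ∈ (G.finite_index_lt M).toFinset, c x •
      ((l 0 • crossOp S.q 0 + l 1 • crossOp S.q 1) ^ x.1) (G.E x.2) ∈ weightOrd S.wt M := by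
  intro n hn
  rw [map_sub, map_sum, sub_eq_zero]
  change ∑ x ∈ (G.finite_index_lt (Finsupp.weight S.wt n + 1)).toFinset, _ = _
  simp only [map_smul, smul_eq_mul]
  refine Finset.sum_subset (fun x hx => ?_) fun x _ hx => ?_
  · rw [Set.Finite.mem_toFinset] at hx ⊢
    have hx' : x.1 + x.2.1 < Finsupp.weight S.wt n + 1 := hx
    exact lt_of_lt_of_le hx' hn
  · rw [Set.Finite.mem_toFinset] at hx
    have hx' : ¬ (x.1 + x.2.1 < Finsupp.weight S.wt n + 1) := hx
    rw [G.pow_mem hcd l x n (by omega), mul_zero]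

include hcd in
-- A continuous functional sees only finitely many terms of the series, so its value is a finite
-- linear expression in c. Both the continuity and the regularity of the inverse of the comparison
-- map rest on this.
theorem exists_functional_sec {l' : MvPowerSeries (Fin 3) ℂ →ₗ[ℂ] ℂ}
    (hl' : WeightContinuousFunctional S.wt l') (l : Fin 2 → ℂ) :
    ∃ (s : Finset (ℕ × (Σ l, Fin (G.e l)))) (r : ℕ × (Σ l, Fin (G.e l)) → ℂ),
      ∀ c, l' (G.sec l c) = ∑ x ∈ s, c x * r x := by
  obtain ⟨M, hM⟩ := hl'
  refine ⟨(G.finite_index_lt M).toFinset, fun x =>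
    l' (((l 0 • crossOp S.q 0 + l 1 • crossOp S.q 1) ^ x.1) (G.E x.2)), fun c => ?_⟩
  have := hM _ (G.sec_sub_mem hcd l c M)
  rw [map_sub, sub_eq_zero, map_sum] at this
  rw [this]
  simp

theorem formX_sec (v l : Plane) (c : ℕ × (Σ l, Fin (G.e l)) → ℂ) (i : ℕ × (Σ l, Fin (G.e l))) :
    G.formX hcd v i (S.mkL (G.sec l c)) = c i * (l 0 * v 0 + l 1 * v 1) ^ i.1 := by
  rw [formX_mkL, form_sec]

end Generators

end QHSurface

/-! ### Graded complements -/

namespace QHSurface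

open MvPowerSeries EquivP1

variable {S : QHSurface}

/-- The series `αx + βy`. -/
def linPS (v : Plane) : MvPowerSeries (Fin 3) ℂ := v 0 • X 0 + v 1 • X 1

theorem mkL_linPS (v : Plane) : S.mkL (linPS v) = S.lin v := by
  rw [linPS, map_add, map_smul, map_smul]
  rfl

theorem lin_add (u v : Plane) : S.lin (u + v) = S.lin u + S.lin v := by
  simp only [lin, Pi.add_apply, add_smul]
  abel

theorem lin_smul (r : ℂ) (v : Plane) : S.lin (r • v) = r • S.lin v := by
  simp only [lin, Pi.smul_apply, smul_eq_mul, smul_add, smul_smul]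

theorem mem_V_iff {F : S.OX} : F ∈ S.V ↔ ∃ v, F = S.lin v := by
  rw [V, Submodule.mem_span_pair]
  constructor
  · rintro ⟨r, s, rfl⟩
    exact ⟨![r, s], rfl⟩
  · rintro ⟨v, rfl⟩
    exact ⟨v 0, v 1, rfl⟩

theorem coeff_linPS (v : Plane) :
    coeff (Finsupp.single 0 1) (linPS v) = v 0 ∧ coeff (Finsupp.single 1 1) (linPS v) = v 1 := by
  classical
  simp [linPS, coeff_X, Finsupp.single_left_inj]

theorem weight_single_lt (hcd : S.c < S.d) (i : Fin 3) :
    Finsupp.weight S.wt (Finsupp.single i 1) < S.d := by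
  rw [Finsupp.weight_single, one_smul]
  exact (S.wt_le_c i).trans_lt hcd

theorem coeff_single_q_mul (hcd : S.c < S.d) (i : Fin 3) (h : MvPowerSeries (Fin 3) ℂ) :
    coeff (Finsupp.single i 1) (S.q * h) = 0 :=
  (isHomOp_mulLeft S.q_mem).map_weightOrd (m := 0) (l := S.d) (by simp)
    (fun _ hn => absurd hn (by omega)) _ (weight_single_lt hcd i)

/-- The coefficient of a variable. -/
def linCoeff (hcd : S.c < S.d) (i : Fin 3) : S.OX →ₗ[ℂ] ℂ :=
  descend (coeff (Finsupp.single i 1)) (coeff_single_q_mul hcd i)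

theorem linCoeff_mkL (hcd : S.c < S.d) (i : Fin 3) (f : MvPowerSeries (Fin 3) ℂ) :
    linCoeff hcd i (S.mkL f) = coeff (Finsupp.single i 1) f := descend_mkL _ _ f

theorem linCoeff_lin (hcd : S.c < S.d) (v : Plane) :
    linCoeff hcd 0 (S.lin v) = v 0 ∧ linCoeff hcd 1 (S.lin v) = v 1 := by
  rw [← mkL_linPS, linCoeff_mkL, linCoeff_mkL]
  exact coeff_linPS v

theorem lin_injective (hcd : S.c < S.d) : Function.Injective S.lin := by
  intro u v h
  ext i
  fin_cases i
  · exact (linCoeff_lin hcd u).1.symm.trans ((congrArg _ h).trans (linCoeff_lin hcd v).1)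
  · exact (linCoeff_lin hcd u).2.symm.trans ((congrArg _ h).trans (linCoeff_lin hcd v).2)

theorem continuous_linCoeff (hcd : S.c < S.d) (i : Fin 3) :
    Continuous[S.topOX, ⊥] (linCoeff (S := S) hcd i) :=
  continuous_of_weightContinuous ⟨S.d, fun f hf => by
    rw [LinearMap.comp_apply, linCoeff_mkL]
    exact hf _ (weight_single_lt hcd i)⟩

/-- The complement consists of the classes without linear terms in x and y. Brackets have order at
least d - c > b ≥ a, so they contain no such terms; this is where d > b + c enters. -/
theorem exists_isGradedComplement (hbc : S.b + S.c < S.d) :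
    ∃ W : Submodule ℂ S.OX, S.IsGradedComplement W := by
  have hcd : S.c < S.d := by omega
  have hab := S.a_le_b
  refine ⟨LinearMap.ker (linCoeff hcd 0) ⊓ LinearMap.ker (linCoeff hcd 1), ?_, ?_, ?_, ?_⟩
  · constructor
    · rw [Submodule.disjoint_def]
      rintro F hF ⟨h0, h1⟩
      obtain ⟨v, rfl⟩ := mem_V_iff.1 hF
      have hv : v = 0 := by
        ext i
        fin_cases i
        · exact (linCoeff_lin hcd v).1.symm.trans h0
        · exact (linCoeff_lin hcd v).2.symm.trans h1
      rw [hv, lin]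
      simp
    · rw [codisjoint_iff, eq_top_iff]
      intro F _
      set v : Plane := ![linCoeff hcd 0 F, linCoeff hcd 1 F] with hv
      refine Submodule.mem_sup.2 ⟨S.lin v, mem_V_iff.2 ⟨v, rfl⟩, F - S.lin v, ⟨?_, ?_⟩,
        add_sub_cancel _ _⟩
      · change linCoeff hcd 0 _ = 0
        rw [map_sub, (linCoeff_lin hcd v).1, hv]
        simp
      · change linCoeff hcd 1 _ = 0
        rw [map_sub, (linCoeff_lin hcd v).2, hv]
        simp
  · rintro u F ⟨h0, h1⟩
    obtain ⟨f, rfl⟩ := S.mkL_surjective F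
    have h := S.scale_mk u f
    rw [← mkL_apply, ← mkL_apply] at h
    have key : ∀ i : Fin 3, linCoeff hcd i (S.mkL f) = 0 →
        linCoeff hcd i (S.scale u (S.mkL f)) = 0 := by
      intro i hi
      rw [h, linCoeff_mkL, coeff_rescale]
      rw [linCoeff_mkL] at hi
      rw [hi, mul_zero]
    exact ⟨key 0 h0, key 1 h1⟩
  · let := S.topOX
    let : TopologicalSpace ℂ := ⊥
    have : DiscreteTopology ℂ := ⟨rfl⟩
    exact IsClosed.inter ((isClosed_discrete {(0 : ℂ)}).preimage (continuous_linCoeff hcd 0))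
      ((isClosed_discrete {(0 : ℂ)}).preimage (continuous_linCoeff hcd 1))
  · intro F G
    obtain ⟨f, rfl⟩ := S.mkL_surjective F
    obtain ⟨g, rfl⟩ := S.mkL_surjective G
    have hb : S.bracket (S.mkL f) (S.mkL g) = S.mkL (S.bracketPS f g) := S.bracket_mk f g
    have hmem : S.bracketPS f g ∈ weightOrd S.wt (S.d - S.c) := by
      have key : ∀ (i : Fin 3) h, pderiv ℂ i S.q * h ∈ weightOrd S.wt (S.d - S.c) := by
        intro i h
        have := S.wt_le_c i
        exact (isHomOp_mulLeft (pderiv_mem_weightHom S.q_mem (i := i) (by omega))).map_weightOrd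
          (m := 0) (by omega) (fun _ hn => absurd hn (by omega))
      exact Submodule.add_mem _ (Submodule.add_mem _ (key _ _) (key _ _)) (key _ _)
    constructor
    · change linCoeff hcd 0 _ = 0
      rw [hb, linCoeff_mkL]
      refine hmem _ ?_
      rw [Finsupp.weight_single, one_smul]
      change S.a < _
      omega
    · change linCoeff hcd 1 _ = 0
      rw [hb, linCoeff_mkL]
      refine hmem _ ?_
      rw [Finsupp.weight_single, one_smul]
      change S.b < _
      omega

variable {W : Submodule ℂ S.OX} (hW : S.IsGradedComplement W) (hcd : S.c < S.d)
include hW hcd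

theorem IsGradedComplement.existsUnique (F : S.OX) : ∃! v, F - S.lin v ∈ W := by
  have h1 : F ∈ S.V ⊔ W := by
    rw [hW.isCompl.sup_eq_top]
    trivial
  obtain ⟨x, hx, y, hy, rfl⟩ := Submodule.mem_sup.1 h1
  obtain ⟨v, rfl⟩ := mem_V_iff.1 hx
  refine ⟨v, by simpa using hy, fun u hu => ?_⟩
  have h2 : S.lin v - S.lin u ∈ W := by
    have := W.sub_mem hu hy
    rwa [add_sub_right_comm, add_sub_cancel_right] at this
  have h3 := (Submodule.disjoint_def.1 hW.isCompl.disjoint) _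
    (S.V.sub_mem (mem_V_iff.2 ⟨v, rfl⟩) (mem_V_iff.2 ⟨u, rfl⟩)) h2
  exact (lin_injective hcd (sub_eq_zero.1 h3)).symm

/-- The projection to `V` along a graded complement, in coordinates. -/
def IsGradedComplement.proj : S.OX →ₗ[ℂ] Plane where
  toFun F := Classical.choose (hW.existsUnique hcd F)
  map_add' F G := by
    refine ((hW.existsUnique hcd (F + G)).unique (Classical.choose_spec
      (hW.existsUnique hcd (F + G))).1 ?_)
    have := W.add_mem (Classical.choose_spec (hW.existsUnique hcd F)).1
      (Classical.choose_spec (hW.existsUnique hcd G)).1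
    rwa [sub_add_sub_comm, ← lin_add] at this
  map_smul' r F := by
    refine ((hW.existsUnique hcd (r • F)).unique (Classical.choose_spec
      (hW.existsUnique hcd (r • F))).1 ?_)
    have := W.smul_mem r (Classical.choose_spec (hW.existsUnique hcd F)).1
    rwa [smul_sub, ← lin_smul] at this

theorem IsGradedComplement.sub_mem (F : S.OX) : F - S.lin (hW.proj hcd F) ∈ W :=
  (Classical.choose_spec (hW.existsUnique hcd F)).1

theorem IsGradedComplement.proj_eq {F : S.OX} {v : Plane} (h : F - S.lin v ∈ W) :
    hW.proj hcd F = v :=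
  (hW.existsUnique hcd F).unique (hW.sub_mem hcd F) h

theorem IsGradedComplement.proj_add_lin (F : W) (v : Plane) : hW.proj hcd (F + S.lin v) = v :=
  hW.proj_eq hcd (by rw [add_sub_cancel_right]; exact F.2)

theorem IsGradedComplement.proj_of_mem {F : S.OX} (hF : F ∈ W) : hW.proj hcd F = 0 := by
  refine hW.proj_eq hcd ?_
  have : S.lin 0 = 0 := by simp [lin]
  rwa [this, sub_zero]

/-- Continuity of the projection to V. The vectors v for which αx + βy lies in W plus the elements
of order M form a decreasing chain of subspaces of a plane, which becomes stationary. Since W is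
closed, the limit is V ∩ W = 0. -/
theorem IsGradedComplement.exists_proj_eq_zero :
    ∃ M, ∀ f ∈ weightOrd S.wt M, hW.proj hcd (S.mkL f) = 0 := by
  let linL : Plane →ₗ[ℂ] S.OX := ⟨⟨S.lin, lin_add⟩, lin_smul⟩
  let D : ℕ → Submodule ℂ Plane := fun M => (W ⊔ (weightOrd S.wt M).map S.mkL).comap linL
  have hD : Antitone D := fun M N h =>
    Submodule.comap_mono (sup_le_sup le_rfl (Submodule.map_mono (weightOrd_mono h)))
  obtain ⟨N, hN⟩ := IsArtinian.monotone_stabilizes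
    (⟨fun M => OrderDual.toDual (D M), fun M N h => hD h⟩ : ℕ →o (Submodule ℂ Plane)ᵒᵈ)
  have hN' : ∀ M, D N ≤ D M := by
    intro M
    by_cases h : N ≤ M
    · exact le_of_eq (hN M h)
    · exact hD (not_le.1 h).le
  have hzero : ∀ v ∈ D N, v = 0 := by
    intro v hv
    have h1 : S.lin v ∈ W := by
      by_contra hvW
      have hopen : IsOpen[topPS] (S.mkL ⁻¹' (W : Set S.OX)ᶜ) :=
        @IsOpen.preimage _ _ topPS S.topOX _ continuous_mkL _
          (@IsClosed.isOpen_compl _ S.topOX _ hW.isClosed)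
      obtain ⟨M, hM⟩ := exists_weightOrd_subset S.wt hopen (f := linPS v) (by
        rw [Set.mem_preimage, mkL_linPS]
        exact hvW)
      obtain ⟨x, hx, y, ⟨f, hf, rfl⟩, hxy⟩ := Submodule.mem_sup.1 (hN' M hv)
      have h2 := hM (linPS v - f) (by
        rw [sub_sub_cancel_left]
        exact Submodule.neg_mem _ hf)
      refine h2 ?_
      change S.mkL (linPS v - f) ∈ W
      rw [map_sub, mkL_linPS]
      have : S.lin v = x + S.mkL f := hxy.symm
      rwa [this, add_sub_cancel_right]
    have h2 := hW.proj_eq hcd (F := S.lin v) (v := v) (by rw [sub_self]; exact W.zero_mem)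
    rw [← h2]
    exact hW.proj_of_mem hcd h1
  refine ⟨N, fun f hf => hzero _ ?_⟩
  refine Submodule.mem_sup.2 ⟨-(S.mkL f - S.lin (hW.proj hcd (S.mkL f))),
    W.neg_mem (hW.sub_mem hcd _), S.mkL f, ⟨f, hf, rfl⟩, ?_⟩
  rw [neg_sub, sub_add_cancel]
  rfl

/-- The projection to `W` along `V`. -/
def IsGradedComplement.projW : S.OX →ₗ[ℂ] W where
  toFun F := ⟨F - S.lin (hW.proj hcd F), hW.sub_mem hcd F⟩
  map_add' F G := by
    apply Subtype.ext
    change F + G - S.lin (hW.proj hcd (F + G)) = _ - _ + (_ - _)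
    rw [map_add, lin_add]
    abel
  map_smul' r F := by
    apply Subtype.ext
    change r • F - S.lin (hW.proj hcd (r • F)) = r • (_ - _)
    rw [map_smul, lin_smul, smul_sub]

theorem IsGradedComplement.projW_add (F : S.OX) :
    (hW.projW hcd F : S.OX) + S.lin (hW.proj hcd F) = F := sub_add_cancel _ _

theorem IsGradedComplement.projW_of_mem {F : S.OX} (hF : F ∈ W) : hW.projW hcd F = ⟨F, hF⟩ := by
  apply Subtype.ext
  change F - S.lin (hW.proj hcd F) = F
  rw [hW.proj_of_mem hcd hF]
  simp [lin]

theorem IsGradedComplement.continuous_projW : Continuous[topPS, topSub W] (hW.projW hcd ∘ S.mkL) := by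
  refine continuous_induced_rng.2 ?_
  have h : (Subtype.val ∘ hW.projW hcd ∘ S.mkL : MvPowerSeries (Fin 3) ℂ → S.OX) =
      S.mkL ∘ fun f => f - linPS (hW.proj hcd (S.mkL f)) := by
    funext f
    change S.mkL f - S.lin _ = S.mkL (f - _)
    rw [map_sub, mkL_linPS]
  rw [h]
  refine @Continuous.comp _ _ _ topPS topPS S.topOX _ _ continuous_mkL ?_
  obtain ⟨M, hM⟩ := hW.exists_proj_eq_zero hcd
  refine @continuous_pi _ (Fin 3 →₀ ℕ) (fun _ => ℂ) topPS (fun _ => ⊥) _ fun n => ?_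
  refine @continuous_of_finite_dependence (Fin 3 →₀ ℕ) ℂ (fun _ => ℂ) (fun _ => ⊥)
    (fun _ => @DiscreteTopology.mk ℂ ⊥ rfl) ⊥ _
    (insert n (finite_weight_lt S.wt_ne_zero M).toFinset) fun f g hfg => ?_
  have h1 : hW.proj hcd (S.mkL f) = hW.proj hcd (S.mkL g) := by
    rw [← sub_eq_zero, ← map_sub]
    refine (congrArg _ (map_sub S.mkL (show MvPowerSeries (Fin 3) ℂ from f) g).symm).trans
      (hM _ fun m hm => ?_)
    refine (map_sub (coeff m) (show MvPowerSeries (Fin 3) ℂ from f) g).trans (sub_eq_zero.2 ?_)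
    exact hfg m (Finset.mem_insert_of_mem ((Set.Finite.mem_toFinset _).2 hm))
  change f n - linPS (hW.proj hcd (S.mkL f)) n = g n - linPS (hW.proj hcd (S.mkL g)) n
  rw [h1, hfg n (Finset.mem_insert_self _ _)]

end QHSurface

/-! ### Regular functions on the cone over the projective line -/

namespace EquivP1

open MvPolynomial

theorem mk_eq_mk_of_cross {u v : Plane} (hu : u ≠ 0) (hv : v ≠ 0) (h : u 0 * v 1 = u 1 * v 0) :
    Projectivization.mk ℂ u hu = Projectivization.mk ℂ v hv := by
  rw [Projectivization.mk_eq_mk_iff']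
  by_cases hv0 : v 0 = 0
  · have hv1 : v 1 ≠ 0 := fun h1 => hv (by ext i; fin_cases i; exacts [hv0, h1])
    have hu0 : u 0 = 0 := by
      rw [hv0, mul_zero] at h
      exact (mul_eq_zero.1 h).resolve_right hv1
    refine ⟨u 1 / v 1, ?_⟩
    ext i
    fin_cases i
    · simp [hv0, hu0]
    · simp [hv1]
  · refine ⟨u 0 / v 0, ?_⟩
    ext i
    fin_cases i
    · simp [hv0]
    · simp only [Fin.mk_one, Pi.smul_apply, smul_eq_mul]
      field_simp
      linear_combination h

theorem rep_mem (p : P1) : p.rep ∈ p.submodule :=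
  p.submodule_eq ▸ Submodule.mem_span_singleton_self _

theorem mem_submodule_mk' (v : {v : Plane // v ≠ 0}) : v.1 ∈ (Projectivization.mk' ℂ v).submodule := by
  change v.1 ∈ (Projectivization.mk ℂ v.1 v.2).submodule
  rw [Projectivization.submodule_mk]
  exact Submodule.mem_span_singleton_self _

theorem mk_eq_of_mem {p : P1} {v : Plane} (hv : v ∈ p.submodule) (h0 : v ≠ 0) :
    Projectivization.mk ℂ v h0 = p := by
  induction p using Projectivization.ind with
  | h u hu =>
    rw [Projectivization.submodule_mk, Submodule.mem_span_singleton] at hv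
    obtain ⟨r, rfl⟩ := hv
    exact (Projectivization.mk_eq_mk_iff' ℂ _ _ _ _).2 ⟨r, rfl⟩

/-- The linear form with coefficients `l`. -/
def linForm (l : Plane) : MvPolynomial (Fin 2) ℂ := C (l 0) * X 0 + C (l 1) * X 1

theorem eval_linForm (l v : Plane) : eval v (linForm l) = l 0 * v 0 + l 1 * v 1 := by
  simp [linForm]

theorem isHomogeneous_linForm (l : Plane) : (linForm l).IsHomogeneous 1 := by
  have h : ∀ i : Fin 2, (C (l i) * X i : MvPolynomial (Fin 2) ℂ).IsHomogeneous 1 := fun i => by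
    simpa using (isHomogeneous_C (Fin 2) (l i)).mul (isHomogeneous_X ℂ i)
  exact (h 0).add (h 1)

/-- The set of points at which a linear form does not vanish. -/
def chart (l : Plane) : Set P1 := {p | ∀ v ∈ p.submodule, v ≠ 0 → l 0 * v 0 + l 1 * v 1 ≠ 0}

theorem mk_mem_chart_iff {l v : Plane} (hv : v ≠ 0) :
    Projectivization.mk ℂ v hv ∈ chart l ↔ l 0 * v 0 + l 1 * v 1 ≠ 0 := by
  constructor
  · intro h
    exact h v (by rw [Projectivization.submodule_mk]; exact Submodule.mem_span_singleton_self _) hv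
  · intro h u hu hu0
    rw [Projectivization.submodule_mk, Submodule.mem_span_singleton] at hu
    obtain ⟨r, rfl⟩ := hu
    have hr : r ≠ 0 := by
      rintro rfl
      exact hu0 (zero_smul _ _)
    simp only [Pi.smul_apply, smul_eq_mul]
    have : l 0 * (r * v 0) + l 1 * (r * v 1) = r * (l 0 * v 0 + l 1 * v 1) := by ring
    rw [this]
    exact mul_ne_zero hr h

theorem compl_chart_subset {l : Plane} (hl : l ≠ 0) : ((chart l)ᶜ).Subsingleton := by
  intro p hp p' hp'
  induction p using Projectivization.ind with
  | h u hu =>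
    induction p' using Projectivization.ind with
    | h v hv =>
      rw [Set.mem_compl_iff, mk_mem_chart_iff, not_not] at hp hp'
      refine mk_eq_mk_of_cross hu hv ?_
      by_cases h0 : l 0 = 0
      · have h1 : l 1 ≠ 0 := fun h1 => hl (by ext i; fin_cases i; exacts [h0, h1])
        rw [h0, zero_mul, zero_add] at hp hp'
        rw [(mul_eq_zero.1 hp).resolve_left h1, (mul_eq_zero.1 hp').resolve_left h1]
        simp
      · refine mul_left_cancel₀ h0 ?_
        linear_combination v 1 * hp - u 1 * hp'

theorem isZariskiOpen_inter_chart {U : Set P1} (hU : IsZariskiOpen U) {l : Plane} (hl : l ≠ 0) :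
    IsZariskiOpen (U ∩ chart l) := by
  obtain rfl | hU := hU
  · left
    simp
  · right
    rw [Set.compl_inter]
    exact hU.union (compl_chart_subset hl).finite

theorem exists_mem_chart (p : P1) : ∃ l : Plane, l ≠ 0 ∧ p ∈ chart l := by
  induction p using Projectivization.ind with
  | h v hv =>
    by_cases h0 : v 0 = 0
    · have h1 : v 1 ≠ 0 := fun h1 => hv (by ext i; fin_cases i; exacts [h0, h1])
      refine ⟨![0, 1], by simp, (mk_mem_chart_iff hv).2 (by simpa using h1)⟩
    · exact ⟨![1, 0], by simp, (mk_mem_chart_iff hv).2 (by simpa using h0)⟩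

namespace IsRegularOfDegree

variable {n m : ℤ} {U : Set P1} {f g : {v : Plane // v ≠ 0} → ℂ}

theorem congr (hf : IsRegularOfDegree n U f)
    (h : ∀ v, Projectivization.mk' ℂ v ∈ U → f v = g v) : IsRegularOfDegree n U g := by
  intro p hp
  obtain ⟨i, j, P, D, hP, hD, hij, hDp, hv⟩ := hf p hp
  exact ⟨i, j, P, D, hP, hD, hij, hDp, fun v hvU hvD => (h v hvU).symm.trans (hv v hvU hvD)⟩

theorem mono {U' : Set P1} (hf : IsRegularOfDegree n U f) (h : U' ⊆ U) :
    IsRegularOfDegree n U' f := by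
  intro p hp
  obtain ⟨i, j, P, D, hP, hD, hij, hDp, hv⟩ := hf p (h hp)
  exact ⟨i, j, P, D, hP, hD, hij, hDp, fun v hvU hvD => hv v (h hvU) hvD⟩

theorem add (hf : IsRegularOfDegree n U f) (hg : IsRegularOfDegree n U g) :
    IsRegularOfDegree n U fun v => f v + g v := by
  intro p hp
  obtain ⟨i, j, P, D, hP, hD, hij, hDp, hv⟩ := hf p hp
  obtain ⟨i', j', P', D', hP', hD', hij', hDp', hv'⟩ := hg p hp
  have hd : j + i' = i + j' := by omega
  refine ⟨i + j', j + j', P * D' + D * P', D * D', (hP.mul hD').add (hd ▸ hD.mul hP'), hD.mul hD',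
    by push_cast; omega, fun v h h0 => ?_, fun v h h0 => ?_⟩
  · rw [map_mul]
    exact mul_ne_zero (hDp v h h0) (hDp' v h h0)
  · rw [map_mul] at h0
    change f v + g v = _
    rw [hv v h (left_ne_zero_of_mul h0), hv' v h (right_ne_zero_of_mul h0), map_add, map_mul,
      map_mul, map_mul, div_add_div _ _ (left_ne_zero_of_mul h0) (right_ne_zero_of_mul h0)]

theorem mul (hf : IsRegularOfDegree n U f) (hg : IsRegularOfDegree m U g) :
    IsRegularOfDegree (n + m) U fun v => f v * g v := by
  intro p hp
  obtain ⟨i, j, P, D, hP, hD, hij, hDp, hv⟩ := hf p hp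
  obtain ⟨i', j', P', D', hP', hD', hij', hDp', hv'⟩ := hg p hp
  refine ⟨i + i', j + j', P * P', D * D', hP.mul hP', hD.mul hD',
    by push_cast; omega, fun v h h0 => ?_, fun v h h0 => ?_⟩
  · rw [map_mul]
    exact mul_ne_zero (hDp v h h0) (hDp' v h h0)
  · rw [map_mul] at h0
    change f v * g v = _
    rw [hv v h (left_ne_zero_of_mul h0), hv' v h (right_ne_zero_of_mul h0), map_mul,
      map_mul, div_mul_div_comm]

theorem form {P : MvPolynomial (Fin 2) ℂ} {k : ℕ} (hP : P.IsHomogeneous k) (U : Set P1) :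
    IsRegularOfDegree k U fun v => eval v.1 P :=
  fun _ _ => ⟨k, 0, P, 1, hP, isHomogeneous_one _ _, by simp, by simp, by simp⟩

theorem zero (n : ℤ) (U : Set P1) : IsRegularOfDegree n U fun _ => 0 := by
  intro p _
  obtain ⟨l, hl, hp⟩ := exists_mem_chart p
  refine ⟨n.toNat, (-n).toNat, 0, linForm l ^ (-n).toNat, isHomogeneous_zero _ _ _, ?_, by omega,
    fun v hv h0 => ?_, by simp⟩
  · simpa using (isHomogeneous_linForm l).pow (-n).toNat
  · rw [map_pow, eval_linForm]
    exact pow_ne_zero _ (hp v hv h0)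

theorem const (r : ℂ) (U : Set P1) : IsRegularOfDegree 0 U fun _ => r := by
  simpa using form (isHomogeneous_C (Fin 2) r) U

theorem sum {ι : Type*} (s : Finset ι) {f : ι → {v : Plane // v ≠ 0} → ℂ}
    (hf : ∀ i ∈ s, IsRegularOfDegree n U (f i)) : IsRegularOfDegree n U fun v => ∑ i ∈ s, f i v := by
  classical
  induction s using Finset.induction_on with
  | empty => simpa using zero n U
  | insert i s hi ih =>
    simp only [Finset.sum_insert hi]
    exact (hf i (Finset.mem_insert_self _ _)).add
      (ih fun j hj => hf j (Finset.mem_insert_of_mem hj))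

theorem inv_pow (l : Plane) (k : ℕ) (h : U ⊆ chart l) :
    IsRegularOfDegree (-k) U fun v => ((l 0 * v.1 0 + l 1 * v.1 1) ^ k)⁻¹ := by
  intro p hp
  refine ⟨0, k, 1, linForm l ^ k, isHomogeneous_one _ _, ?_, by simp, fun v hv h0 => ?_,
    fun v _ _ => ?_⟩
  · simpa using (isHomogeneous_linForm l).pow k
  · rw [map_pow, eval_linForm]
    exact pow_ne_zero _ (h hp v hv h0)
  · rw [map_pow, eval_linForm, map_one, one_div]

/-- Regularity on U asks for a quotient valid at all points of U where the denominator is nonzero. A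
quotient valid only on U' is adapted by multiplying numerator and denominator with a form that
vanishes on the finite complement of U'. -/
theorem of_locally (h : ∀ p ∈ U, ∃ U', IsZariskiOpen U' ∧ p ∈ U' ∧ U' ⊆ U ∧
    IsRegularOfDegree n U' f) : IsRegularOfDegree n U f := by
  classical
  intro p hp
  obtain ⟨U', hU', hpU', hsub, hf⟩ := h p hp
  have hfin : U'ᶜ.Finite := hU'.resolve_left fun h => by simp [h] at hpU'
  obtain ⟨i, j, P, D, hP, hD, hij, hDp, hv⟩ := hf p hpU'
  -- The linear form that vanishes exactly on the line x.
  let L : P1 → MvPolynomial (Fin 2) ℂ := fun x => linForm ![x.rep 1, -x.rep 0]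
  let H := ∏ x ∈ hfin.toFinset, L x
  have hH : H.IsHomogeneous hfin.toFinset.card := by
    have := MvPolynomial.IsHomogeneous.prod hfin.toFinset L (fun _ => 1)
      fun x _ => isHomogeneous_linForm _
    simpa using this
  refine ⟨i + hfin.toFinset.card, j + hfin.toFinset.card, P * H, D * H, hP.mul hH, hD.mul hH,
    by push_cast; omega, fun v hvp h0 => ?_, fun v hvU hvD => ?_⟩
  · rw [map_mul]
    refine mul_ne_zero (hDp v hvp h0) ?_
    rw [map_prod, Finset.prod_ne_zero_iff]
    intro x hx hxv
    rw [Set.Finite.mem_toFinset] at hx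
    refine hx ?_
    have h1 : Projectivization.mk ℂ v h0 = x := by
      rw [← Projectivization.mk_rep x]
      refine mk_eq_mk_of_cross h0 x.rep_nonzero ?_
      rw [eval_linForm] at hxv
      simp only [Matrix.cons_val_zero, Matrix.cons_val_one] at hxv
      linear_combination hxv
    rw [← h1, mk_eq_of_mem hvp h0]
    exact hpU'
  · rw [map_mul] at hvD
    have h1 : Projectivization.mk' ℂ v ∈ U' := by
      by_contra hn
      refine right_ne_zero_of_mul hvD ?_
      rw [map_prod]
      refine Finset.prod_eq_zero ((Set.Finite.mem_toFinset _).2 hn) ?_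
      rw [eval_linForm]
      have h2 : (Projectivization.mk' ℂ v).rep ∈ (Projectivization.mk' ℂ v).submodule :=
        rep_mem _
      change (Projectivization.mk' ℂ v).rep ∈ (Projectivization.mk ℂ v.1 v.2).submodule at h2
      rw [Projectivization.submodule_mk, Submodule.mem_span_singleton] at h2
      obtain ⟨r, hr⟩ := h2
      simp only [Matrix.cons_val_zero, Matrix.cons_val_one, ← hr, Pi.smul_apply, smul_eq_mul]
      ring
    rw [hv v h1 (left_ne_zero_of_mul hvD), map_mul, map_mul,
      mul_div_mul_right _ _ (right_ne_zero_of_mul hvD)]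

end IsRegularOfDegree

/-! ### Elements of the fibres of line bundles -/

theorem lineFiber_eq_zero_of_notMem {n : ℤ} {p : P1} (φ : lineFiber n p) {v : Plane}
    (hv : ¬ (v ∈ p.submodule ∧ v ≠ 0)) : φ.1 v = 0 := by
  by_contra h
  exact hv (φ.2.1 v h)

theorem lineFiber_ext {n : ℤ} {p : P1} {φ ψ : lineFiber n p} {v : Plane} (hv : v ∈ p.submodule)
    (h0 : v ≠ 0) (h : φ.1 v = ψ.1 v) : φ = ψ := by
  ext u
  by_cases hu : u ∈ p.submodule ∧ u ≠ 0
  · rw [← mk_eq_of_mem hv h0, Projectivization.submodule_mk, Submodule.mem_span_singleton] at hu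
    obtain ⟨⟨r, rfl⟩, hr⟩ := hu
    have hr' : r ≠ 0 := by
      rintro rfl
      exact hr (zero_smul _ _)
    rw [φ.2.2 r hr', ψ.2.2 r hr', h]
  · rw [lineFiber_eq_zero_of_notMem φ hu, lineFiber_eq_zero_of_notMem ψ hu]

open Classical in
/-- The element of the fibre of `𝒪(n)` given by a homogeneous function on the plane. -/
def coneSection {n : ℤ} (f : Plane → ℂ) (hf : ∀ r : ℂ, r ≠ 0 → ∀ v, f (r • v) = r ^ n * f v)
    (p : P1) : lineFiber n p :=
  ⟨fun v => if v ∈ p.submodule ∧ v ≠ 0 then f v else 0, fun v hv => by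
    by_contra h
    exact hv (if_neg h), fun r hr v => by
    have h : r • v ∈ p.submodule ∧ r • v ≠ 0 ↔ v ∈ p.submodule ∧ v ≠ 0 := by
      rw [Submodule.smul_mem_iff _ hr, smul_ne_zero_iff_right hr]
    simp only [h, hf r hr]
    split_ifs <;> simp⟩

theorem coneSection_apply {n : ℤ} (f : Plane → ℂ) (hf : ∀ r : ℂ, r ≠ 0 → ∀ v, f (r • v) = r ^ n * f v)
    {p : P1} {v : Plane} (hv : v ∈ p.submodule) (h0 : v ≠ 0) : (coneSection f hf p).1 v = f v :=
  if_pos ⟨hv, h0⟩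

end EquivP1

/-! ### The comparison map on fibres -/

namespace EquivP1

theorem lineFiber_zero_apply_eq {p : P1} (φ : lineFiber 0 p) {u v : Plane} (hu : u ∈ p.submodule)
    (hu0 : u ≠ 0) (hv : v ∈ p.submodule) (hv0 : v ≠ 0) : φ.1 u = φ.1 v := by
  rw [← mk_eq_of_mem hv hv0, Projectivization.submodule_mk, Submodule.mem_span_singleton] at hu
  obtain ⟨r, rfl⟩ := hu
  have hr : r ≠ 0 := by
    rintro rfl
    exact hu0 (zero_smul _ _)
  rw [φ.2.2 r hr, zpow_zero, one_mul]

/-- Evaluation of an element of a fibre at the chosen representative. -/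
def evalRep (n : ℤ) (p : P1) : lineFiber n p →ₗ[ℂ] ℂ where
  toFun φ := φ.1 p.rep
  map_add' _ _ := rfl
  map_smul' _ _ := rfl

/-- The constant element of a fibre of `𝒪(0)`. -/
def constSection (r : ℂ) (p : P1) : lineFiber 0 p := coneSection (fun _ => r) (by simp) p

theorem constSection_apply (r : ℂ) {p : P1} {v : Plane} (hv : v ∈ p.submodule) (h0 : v ≠ 0) :
    (constSection r p).1 v = r := coneSection_apply _ _ hv h0

end EquivP1

namespace QHSurface

open MvPowerSeries EquivP1

variable {S : QHSurface} (hcd : S.c < S.d)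

namespace Generators

variable (G : S.Generators)

/-- The indices of the line bundles. -/
abbrev Index : Type := ℕ × (Σ l, Fin (G.e l))

/-- The element of the fibre of `𝒪(k)` given by the functionals `formX`. -/
def formLin (i : G.Index) (p : P1) : S.OX →ₗ[ℂ] lineFiber (i.1 : ℤ) p where
  toFun F := coneSection (fun v => G.formX hcd v i F) (fun r _ v => by
    rw [formX_smul, zpow_natCast]) p
  map_add' F F' := by
    refine lineFiber_ext (rep_mem p) p.rep_nonzero ?_
    change _ = (coneSection _ _ p).1 p.rep + (coneSection _ _ p).1 p.rep
    simp only [coneSection_apply _ _ (rep_mem p) p.rep_nonzero, map_add]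
  map_smul' r F := by
    refine lineFiber_ext (rep_mem p) p.rep_nonzero ?_
    change _ = r * (coneSection _ _ p).1 p.rep
    simp only [coneSection_apply _ _ (rep_mem p) p.rep_nonzero, map_smul, smul_eq_mul]

theorem formLin_apply (i : G.Index) {p : P1} (F : S.OX) {v : Plane} (hv : v ∈ p.submodule)
    (h0 : v ≠ 0) : (G.formLin hcd i p F).1 v = G.formX hcd v i F :=
  if_pos ⟨hv, h0⟩

include hcd in
theorem mem_brackets_iff_rep (p : P1) (F : S.OX) :
    F ∈ S.brackets p ↔ ∀ i, G.formX hcd p.rep i F = 0 := by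
  rw [← G.mem_brackets_iff hcd p.rep_nonzero, Projectivization.mk_rep]

theorem formLin_eq_zero {i : G.Index} {p : P1} {F : S.OX} (hF : F ∈ S.brackets p) :
    G.formLin hcd i p F = 0 := by
  refine lineFiber_ext (rep_mem p) p.rep_nonzero ?_
  rw [formLin_apply hcd G i F (rep_mem p) p.rep_nonzero]
  exact (G.mem_brackets_iff_rep hcd p F).1 hF i

variable (W : Submodule ℂ S.OX)

/-- The fibre of `Ytilde`. -/
abbrev FiberY (p : P1) : Type :=
  ((W ⧸ (S.brackets p).submoduleOf W) × lineFiber 0 p) × lineFiber 0 p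

/-- The comparison map from the fibre of `Ytilde` to the product of line bundles. -/
def theta (p : P1) : FiberY W p →ₗ[ℂ] ∀ i : G.Index, lineFiber (i.1 : ℤ) p :=
  LinearMap.pi fun i =>
    (Submodule.liftQ _ (G.formLin hcd i p ∘ₗ W.subtype)
      (fun _ hF => G.formLin_eq_zero hcd hF)) ∘ₗ LinearMap.fst ℂ _ _ ∘ₗ LinearMap.fst ℂ _ _ +
    (G.formLin hcd i p ∘ₗ LinearMap.toSpanSingleton ℂ S.OX (S.mkL (X 0)) ∘ₗ evalRep 0 p ∘ₗ
      LinearMap.snd ℂ _ _ ∘ₗ LinearMap.fst ℂ _ _ +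
    G.formLin hcd i p ∘ₗ LinearMap.toSpanSingleton ℂ S.OX (S.mkL (X 1)) ∘ₗ evalRep 0 p ∘ₗ
      LinearMap.snd ℂ _ _)

variable {W}

theorem theta_mk (p : P1) (F : W) (φ ψ : lineFiber 0 p) (i : G.Index) :
    G.theta hcd W p ((Submodule.Quotient.mk F, φ), ψ) i =
      G.formLin hcd i p (F + S.lin ![φ.1 p.rep, ψ.1 p.rep]) := by
  rw [map_add, lin, map_add]
  rfl

theorem theta_mk_apply {p : P1} (F : W) (φ ψ : lineFiber 0 p) (i : G.Index) {v : Plane}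
    (hv : v ∈ p.submodule) (h0 : v ≠ 0) :
    (G.theta hcd W p ((Submodule.Quotient.mk F, φ), ψ) i).1 v =
      G.formX hcd v i (F + S.lin ![φ.1 v, ψ.1 v]) := by
  rw [theta_mk, formLin_apply hcd G i _ hv h0,
    lineFiber_zero_apply_eq φ (rep_mem p) p.rep_nonzero hv h0,
    lineFiber_zero_apply_eq ψ (rep_mem p) p.rep_nonzero hv h0]

theorem brackets_le (hW : S.IsGradedComplement W) (p : P1) : S.brackets p ≤ W := by
  rw [brackets, Submodule.span_le]
  rintro _ ⟨v, _, f, rfl⟩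
  exact hW.bracket_mem _ _

variable (hW : S.IsGradedComplement W)
include hW

/-- If all forms of F + φx + ψy vanish, this element is in the span of brackets and hence in W. Its
V-component (φ, ψ) is then zero, and F represents zero in the quotient. -/
theorem theta_injective (p : P1) : Function.Injective (G.theta hcd W p) := by
  rw [← LinearMap.ker_eq_bot, LinearMap.ker_eq_bot']
  rintro ⟨⟨x, φ⟩, ψ⟩ h
  obtain ⟨F, rfl⟩ := Submodule.Quotient.mk_surjective _ x
  have h1 : (F : S.OX) + S.lin ![φ.1 p.rep, ψ.1 p.rep] ∈ S.brackets p := by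
    rw [G.mem_brackets_iff_rep hcd]
    intro i
    rw [← G.theta_mk_apply hcd F φ ψ i (rep_mem p) p.rep_nonzero, h]
    rfl
  have h2 := hW.proj_of_mem hcd (brackets_le hW p h1)
  rw [hW.proj_add_lin hcd] at h2
  have hφ : φ = 0 := lineFiber_ext (rep_mem p) p.rep_nonzero (congrFun h2 0)
  have hψ : ψ = 0 := lineFiber_ext (rep_mem p) p.rep_nonzero (congrFun h2 1)
  rw [h2] at h1
  have h3 : S.lin 0 = 0 := by simp [lin]
  rw [h3, add_zero] at h1
  have h4 : Submodule.Quotient.mk (p := (S.brackets p).submoduleOf W) F = 0 :=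
    (Submodule.Quotient.mk_eq_zero _).2 h1
  rw [hφ, hψ, h4]
  rfl

/-- The inverse of the comparison map. -/
def thetaInv (l : Plane) (p : P1) (c : ∀ i : G.Index, lineFiber (i.1 : ℤ) p) : FiberY W p :=
  ((Submodule.Quotient.mk (hW.projW hcd (S.mkL (G.sec l fun i => (c i).1 p.rep))),
    constSection (hW.proj hcd (S.mkL (G.sec l fun i => (c i).1 p.rep)) 0) p),
    constSection (hW.proj hcd (S.mkL (G.sec l fun i => (c i).1 p.rep)) 1) p)

/-- For l equal to 1 on the representative, the series ∑ c_{kj} C^k e_j has the prescribed forms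
c_{kj}; its components along W and V give the preimage. -/
theorem theta_thetaInv {l : Plane} {p : P1} (hl : l 0 * p.rep 0 + l 1 * p.rep 1 = 1)
    (c : ∀ i : G.Index, lineFiber (i.1 : ℤ) p) : G.theta hcd W p (G.thetaInv hcd hW l p c) = c := by
  funext i
  refine lineFiber_ext (rep_mem p) p.rep_nonzero ?_
  rw [thetaInv, theta_mk_apply hcd G _ _ _ i (rep_mem p) p.rep_nonzero,
    constSection_apply _ (rep_mem p) p.rep_nonzero, constSection_apply _ (rep_mem p) p.rep_nonzero]
  have h : ∀ v : Plane, ![v 0, v 1] = v := fun v => by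
    ext i
    fin_cases i <;> rfl
  rw [h, hW.projW_add, formX_sec, hl, one_pow, mul_one]

omit hW in
theorem exists_lin_rep_eq_one (p : P1) : ∃ l : Plane, l 0 * p.rep 0 + l 1 * p.rep 1 = 1 := by
  by_cases h0 : p.rep 0 = 0
  · have h1 : p.rep 1 ≠ 0 := fun h1 => p.rep_nonzero (by ext i; fin_cases i; exacts [h0, h1])
    exact ⟨![0, (p.rep 1)⁻¹], by simp [h1]⟩
  · exact ⟨![(p.rep 0)⁻¹, 0], by simp [h0]⟩

/-- The comparison map as a linear equivalence. -/
def thetaEquiv (p : P1) : FiberY W p ≃ₗ[ℂ] ∀ i : G.Index, lineFiber (i.1 : ℤ) p :=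
  LinearEquiv.ofBijective (G.theta hcd W p) ⟨G.theta_injective hcd hW p, fun c => by
    obtain ⟨l, hl⟩ := exists_lin_rep_eq_one p
    exact ⟨_, G.theta_thetaInv hcd hW hl c⟩⟩

theorem thetaEquiv_symm_eq {l : Plane} {p : P1} (hl : l 0 * p.rep 0 + l 1 * p.rep 1 = 1) :
    ((G.thetaEquiv hcd hW p).symm : _ → FiberY W p) = G.thetaInv hcd hW l p := by
  funext c
  rw [LinearEquiv.symm_apply_eq]
  exact (G.theta_thetaInv hcd hW hl c).symm

/-! ### Regular sections -/

/-- The form of index (k, j) is a polynomial of degree k in v whose coefficients are fixed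
continuous functionals. Applied to a regular local lift it is regular of degree k. -/
theorem regular_of_Y {U : Set P1} {s : ∀ p, FiberY W p}
    (h1 : (Y W hW).IsRegular U fun p => (s p).1.1)
    (h2 : IsRegularOfDegree 0 U fun v => (s (Projectivization.mk' ℂ v)).1.2.1 v.1)
    (h3 : IsRegularOfDegree 0 U fun v => (s (Projectivization.mk' ℂ v)).2.1 v.1) (i : G.Index) :
    IsRegularOfDegree i.1 U fun v => (G.theta hcd W _ (s (Projectivization.mk' ℂ v)) i).1 v.1 := by
  refine IsRegularOfDegree.of_locally fun p hp => ?_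
  obtain ⟨U', hU', hpU', hsub, g, hg, hgs⟩ := h1 p hp
  refine ⟨U', hU', hpU', hsub, ?_⟩
  have hlam : ∀ x : (ℕ × ℕ) × (Σ l, Fin (G.e l)), IsRegularOfDegree 0 U' fun v =>
      G.lam hcd x (g (Projectivization.mk' ℂ v)) := by
    intro x
    refine hg (G.lam hcd x ∘ₗ W.subtype) ?_
    exact @Continuous.comp _ _ _ (topSub W) S.topOX ⊥ _ _ (G.continuous_lam hcd x)
      continuous_induced_dom
  have hsum : IsRegularOfDegree i.1 U' fun v =>
      ∑ x ∈ Finset.HasAntidiagonal.antidiagonal i.1, v.1 0 ^ x.1 * v.1 1 ^ x.2 *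
        (G.lam hcd (x, i.2) (g (Projectivization.mk' ℂ v)) +
          ((s (Projectivization.mk' ℂ v)).1.2.1 v.1 * G.lam hcd (x, i.2) (S.mkL (X 0)) +
          (s (Projectivization.mk' ℂ v)).2.1 v.1 * G.lam hcd (x, i.2) (S.mkL (X 1)))) := by
    refine IsRegularOfDegree.sum _ fun x hx => ?_
    have hx' := Finset.HasAntidiagonal.mem_antidiagonal.1 hx
    have e1 : IsRegularOfDegree (i.1 : ℤ) U' fun v => v.1 0 ^ x.1 * v.1 1 ^ x.2 := by
      have := IsRegularOfDegree.form (((MvPolynomial.isHomogeneous_X ℂ (0 : Fin 2)).pow x.1).mul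
        ((MvPolynomial.isHomogeneous_X ℂ (1 : Fin 2)).pow x.2)) U'
      simpa [hx'] using this
    have e2 : ∀ r, IsRegularOfDegree 0 U' fun v =>
        (s (Projectivization.mk' ℂ v)).1.2.1 v.1 * r := fun r => by
      simpa using (h2.mono hsub).mul (IsRegularOfDegree.const r U')
    have e3 : ∀ r, IsRegularOfDegree 0 U' fun v =>
        (s (Projectivization.mk' ℂ v)).2.1 v.1 * r := fun r => by
      simpa using (h3.mono hsub).mul (IsRegularOfDegree.const r U')
    simpa using e1.mul ((hlam (x, i.2)).add ((e2 _).add (e3 _)))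
  refine hsum.congr fun v hv => ?_
  have hmem := mem_submodule_mk' v
  have hs : s (Projectivization.mk' ℂ v) = ((Submodule.Quotient.mk (g (Projectivization.mk' ℂ v)),
      (s (Projectivization.mk' ℂ v)).1.2), (s (Projectivization.mk' ℂ v)).2) :=
    Prod.ext (Prod.ext (hgs _ hv) rfl) rfl
  conv_rhs => rw [hs]
  rw [theta_mk_apply hcd G _ _ _ i hmem v.2, formX_apply]
  refine Finset.sum_congr rfl fun x _ => ?_
  congr 1
  rw [map_add, lin, map_add, map_smul, map_smul]
  rfl

/-- On the chart l ≠ 0 the series ∑ (θ_{kj}(v)/l(v)^k) C^k e_j is a regular family in the power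
series ring with the same forms as the given section. The difference is made of brackets, so it lies
in W, and projecting the series to V and W gives regular lifts. -/
theorem regular_of_theta {U : Set P1} (hU : IsZariskiOpen U) {s : ∀ p, FiberY W p}
    (h : ∀ i : G.Index, IsRegularOfDegree i.1 U fun v =>
      (G.theta hcd W _ (s (Projectivization.mk' ℂ v)) i).1 v.1) :
    (Y W hW).IsRegular U (fun p => (s p).1.1) ∧
    (IsRegularOfDegree 0 U fun v => (s (Projectivization.mk' ℂ v)).1.2.1 v.1) ∧
    (IsRegularOfDegree 0 U fun v => (s (Projectivization.mk' ℂ v)).2.1 v.1) := by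
  choose w hw using fun p => Submodule.Quotient.mk_surjective _ (s p).1.1
  let F : P1 → S.OX := fun p => w p + S.lin ![(s p).1.2.1 p.rep, (s p).2.1 p.rep]
  have hs : ∀ p, s p = ((Submodule.Quotient.mk (w p), (s p).1.2), (s p).2) := fun p =>
    Prod.ext (Prod.ext (hw p).symm rfl) rfl
  have hF : ∀ (v : {v : Plane // v ≠ 0}) i, G.formX hcd v.1 i (F (Projectivization.mk' ℂ v)) =
      (G.theta hcd W _ (s (Projectivization.mk' ℂ v)) i).1 v.1 := by
    intro v i
    conv_rhs => rw [hs]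
    rw [theta_mk_apply hcd G _ _ _ i (mem_submodule_mk' v) v.2]
    simp only [F]
    rw [lineFiber_zero_apply_eq _ (rep_mem _) (Projectivization.rep_nonzero _) (mem_submodule_mk' v) v.2,
      lineFiber_zero_apply_eq _ (rep_mem _) (Projectivization.rep_nonzero _) (mem_submodule_mk' v) v.2]
  have key : ∀ p ∈ U, ∃ U', IsZariskiOpen U' ∧ p ∈ U' ∧ U' ⊆ U ∧ ∃ f : P1 → MvPowerSeries (Fin 3) ℂ,
      (∀ l : MvPowerSeries (Fin 3) ℂ →ₗ[ℂ] ℂ, WeightContinuousFunctional S.wt l →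
        IsRegularOfDegree 0 U' fun v => l (f (Projectivization.mk' ℂ v))) ∧
      ∀ p ∈ U', F p - S.mkL (f p) ∈ S.brackets p := by
    intro p hp
    obtain ⟨l, hl, hpl⟩ := exists_mem_chart p
    -- Numerator and denominator are both homogeneous of degree k, so the value does not depend on
    -- the representative of p.
    let c : P1 → G.Index → ℂ := fun p i =>
      G.formX hcd p.rep i (F p) * ((l 0 * p.rep 0 + l 1 * p.rep 1) ^ i.1)⁻¹
    refine ⟨U ∩ chart l, isZariskiOpen_inter_chart hU hl, ⟨hp, hpl⟩, Set.inter_subset_left,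
      fun p => G.sec l (c p), fun l' hl' => ?_, fun p hp => ?_⟩
    · obtain ⟨t, r, htr⟩ := G.exists_functional_sec hcd hl' l
      simp only [htr]
      refine IsRegularOfDegree.sum _ fun i _ => ?_
      have hreg : IsRegularOfDegree 0 (U ∩ chart l) fun v =>
          (G.theta hcd W _ (s (Projectivization.mk' ℂ v)) i).1 v.1 *
            ((l 0 * v.1 0 + l 1 * v.1 1) ^ i.1)⁻¹ * r i := by
        simpa using (((h i).mono Set.inter_subset_left).mul
          (IsRegularOfDegree.inv_pow l i.1 Set.inter_subset_right)).mul
            (IsRegularOfDegree.const (r i) _)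
      refine hreg.congr fun v hv => ?_
      have h1 := rep_mem (Projectivization.mk' ℂ v)
      change _ ∈ (Projectivization.mk ℂ v.1 v.2).submodule at h1
      rw [Projectivization.submodule_mk, Submodule.mem_span_singleton] at h1
      obtain ⟨ρ, hρ⟩ := h1
      have hρ0 : ρ ≠ 0 := by
        rintro rfl
        rw [zero_smul] at hρ
        exact Projectivization.rep_nonzero _ hρ.symm
      have hl0 := hv.2 v.1 (mem_submodule_mk' v) v.2
      rw [← hF]
      simp only [c]
      rw [← hρ, formX_smul]
      simp only [Pi.smul_apply, smul_eq_mul]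
      rw [show l 0 * (ρ * v.1 0) + l 1 * (ρ * v.1 1) = ρ * (l 0 * v.1 0 + l 1 * v.1 1) by ring,
        mul_pow]
      field_simp
    · rw [G.mem_brackets_iff_rep hcd]
      intro i
      have hl0 := hp.2 _ (rep_mem p) p.rep_nonzero
      rw [map_sub, formX_sec]
      simp only [c]
      field_simp
      ring
  have hproj : ∀ p, hW.proj hcd (F p) = ![(s p).1.2.1 p.rep, (s p).2.1 p.rep] := fun p =>
    hW.proj_add_lin hcd (w p) _
  have hcont : ∀ i, WeightContinuousFunctional S.wt
      (LinearMap.proj i ∘ₗ hW.proj hcd ∘ₗ S.mkL : MvPowerSeries (Fin 3) ℂ →ₗ[ℂ] ℂ) := by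
    intro i
    obtain ⟨M, hM⟩ := hW.exists_proj_eq_zero hcd
    refine ⟨M, fun f hf => ?_⟩
    have := hM f hf
    simp [this]
  have hlines : ∀ i, IsRegularOfDegree 0 U fun v => hW.proj hcd (F (Projectivization.mk' ℂ v)) i := by
    intro i
    refine IsRegularOfDegree.of_locally fun p hp => ?_
    obtain ⟨U', hU', hpU', hsub, f, hf, hfF⟩ := key p hp
    refine ⟨U', hU', hpU', hsub, (hf _ (hcont i)).congr fun v hv => ?_⟩
    -- Elements that differ by brackets have the same V-component, because brackets lie in W.
    have := hW.proj_of_mem hcd (brackets_le hW _ (hfF _ hv))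
    rw [map_sub, sub_eq_zero] at this
    rw [this]
    rfl
  refine ⟨fun p hp => ?_, (hlines 0).congr fun v _ => ?_, (hlines 1).congr fun v _ => ?_⟩
  · obtain ⟨U', hU', hpU', hsub, f, hf, hfF⟩ := key p hp
    refine ⟨U', hU', hpU', hsub, fun p => hW.projW hcd (S.mkL (f p)), fun l hl => ?_, fun p' hp' => ?_⟩
    · refine hf (l ∘ₗ hW.projW hcd ∘ₗ S.mkL) (weightContinuousFunctional_of_continuous S.wt ?_)
      exact @Continuous.comp _ _ _ topPS (topSub W) ⊥ _ _ hl (hW.continuous_projW hcd)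
    · refine (hw p').symm.trans ((Submodule.Quotient.eq _).2 ?_)
      have h1 := hfF p' hp'
      have h2 : hW.projW hcd (F p') = w p' := by
        apply Subtype.ext
        change F p' - S.lin (hW.proj hcd (F p')) = w p'
        rw [hproj]
        exact add_sub_cancel_right _ _
      have h3 := hW.projW_of_mem hcd (brackets_le hW p' h1)
      rw [map_sub, h2] at h3
      change ((w p' - hW.projW hcd (S.mkL (f p')) : W) : S.OX) ∈ S.brackets p'
      rw [h3]
      exact h1
  · rw [hproj]
    exact lineFiber_zero_apply_eq _ (rep_mem _) (Projectivization.rep_nonzero _) (mem_submodule_mk' v) v.2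
  · rw [hproj]
    exact lineFiber_zero_apply_eq _ (rep_mem _) (Projectivization.rep_nonzero _) (mem_submodule_mk' v) v.2

end Generators

end QHSurface

/-! ### The isomorphism with a product of line bundles -/

theorem continuous_of_discrete_factors {A B C D E : Type*} [TopologicalSpace A]
    [TopologicalSpace B] [DiscreteTopology B] [TopologicalSpace C] [DiscreteTopology C]
    [TopologicalSpace D] [DiscreteTopology D] [TopologicalSpace E] {f : A → D} (hf : Continuous f)
    (g : D → B → C → E) : Continuous fun x : (A × B) × C => g (f x.1.1) x.1.2 x.2 :=
  (continuous_of_discreteTopology (f := fun t : (D × B) × C => g t.1.1 t.1.2 t.2)).comp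
    (((hf.comp (continuous_fst.comp continuous_fst)).prodMk
      (continuous_snd.comp continuous_fst)).prodMk continuous_snd)

theorem continuous_of_factors_discrete {A D E : Type*} [TopologicalSpace A] [TopologicalSpace D]
    [DiscreteTopology D] [TopologicalSpace E] {f : A → D} (hf : Continuous f) {g : A → E}
    (h : ∀ x y, f x = f y → g x = g y) : Continuous g :=
  IsLocallyConstant.continuous ((IsLocallyConstant.iff_exists_open g).2 fun x =>
    ⟨f ⁻¹' {f x}, (isOpen_discrete _).preimage hf, rfl, fun y hy => h y x hy⟩)

namespace QHSurface

open MvPowerSeries EquivP1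

variable {S : QHSurface} (hcd : S.c < S.d)

namespace Generators

variable (G : S.Generators)

/-- The weight of a line bundle. -/
def weight (i : G.Index) : ℕ := i.1 * (S.d - S.a) + i.2.1

/-- The product of line bundles to which `Ytilde` is isomorphic. -/
abbrev target : EquivFamily S.a S.b :=
  EquivFamily.prod fun i : G.Index => lineBundle S.a S.b i.1 (G.weight i)

variable {W : Submodule ℂ S.OX} (hW : S.IsGradedComplement W)
include hW

theorem continuous_theta (p : P1) :
    @Continuous ((Ytilde W hW).Fiber p) (G.target.Fiber p) _ _ (G.theta hcd W p) := by
  refine @continuous_pi _ G.Index (fun i => lineFiber (i.1 : ℤ) p) _ (fun _ => ⊥) _ fun i => ?_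
  have h1 : Continuous[(Y W hW).topology p, ⊥] (Submodule.liftQ _ (G.formLin hcd i p ∘ₗ W.subtype)
      (fun _ hF => G.formLin_eq_zero hcd hF)) := by
    change Continuous[TopologicalSpace.coinduced (Submodule.mkQ ((S.brackets p).submoduleOf W))
      (topSub W), ⊥] _
    refine continuous_coinduced_dom.2 ?_
    have h2 : Continuous[topSub W, ⊥] fun F : W => G.formX hcd p.rep i F :=
      @Continuous.comp _ _ _ (topSub W) S.topOX ⊥ _ _ (G.continuous_formX hcd p.rep i)
        continuous_induced_dom
    refine @continuous_of_factors_discrete _ _ _ (topSub W) ⊥ (@DiscreteTopology.mk _ ⊥ rfl) ⊥ _ h2 _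
      fun F F' h => ?_
    refine lineFiber_ext (rep_mem p) p.rep_nonzero ?_
    change (G.formLin hcd i p F).1 p.rep = (G.formLin hcd i p F').1 p.rep
    rw [formLin_apply hcd G i _ (rep_mem p) p.rep_nonzero,
      formLin_apply hcd G i _ (rep_mem p) p.rep_nonzero]
    exact h
  exact @continuous_of_discrete_factors _ _ _ _ _ ((Y W hW).topology p) ⊥
    (@DiscreteTopology.mk _ ⊥ rfl) ⊥ (@DiscreteTopology.mk _ ⊥ rfl) ⊥ (@DiscreteTopology.mk _ ⊥ rfl)
    ⊥ _ h1 fun (x : lineFiber (i.1 : ℤ) p) (φ ψ : lineFiber 0 p) => x +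
      (G.formLin hcd i p (φ.1 p.rep • S.mkL (X 0)) + G.formLin hcd i p (ψ.1 p.rep • S.mkL (X 1)))

omit hW in
include hcd in
theorem continuous_functional_sec {A : Type*} {l' : MvPowerSeries (Fin 3) ℂ →ₗ[ℂ] ℂ}
    (hl' : WeightContinuousFunctional S.wt l') (l : Plane) (p : P1) (f : ℂ → A) :
    @Continuous (∀ i : G.Index, lineFiber (i.1 : ℤ) p) A
      (@Pi.topologicalSpace G.Index (fun i => lineFiber (i.1 : ℤ) p) fun _ => ⊥) ⊥
      (fun c => f (l' (G.sec l fun i => (c i).1 p.rep))) := by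
  obtain ⟨s, r, h⟩ := G.exists_functional_sec hcd hl' l
  refine @continuous_of_finite_dependence G.Index A (fun i => lineFiber (i.1 : ℤ) p) (fun _ => ⊥)
    (fun _ => @DiscreteTopology.mk _ ⊥ rfl) ⊥ _ s fun c c' hc => ?_
  rw [h, h]
  exact congrArg f (Finset.sum_congr rfl fun i hi => by rw [hc i hi])

theorem continuous_thetaInv (l : Plane) (p : P1) :
    @Continuous (G.target.Fiber p) ((Ytilde W hW).Fiber p) _ _ (G.thetaInv hcd hW l p) := by
  have hcont : ∀ i, WeightContinuousFunctional S.wt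
      (LinearMap.proj i ∘ₗ hW.proj hcd ∘ₗ S.mkL : MvPowerSeries (Fin 3) ℂ →ₗ[ℂ] ℂ) := by
    intro i
    obtain ⟨M, hM⟩ := hW.exists_proj_eq_zero hcd
    refine ⟨M, fun f hf => ?_⟩
    have := hM f hf
    simp [this]
  have h1 : @Continuous (G.target.Fiber p) ((Y W hW).Fiber p) _ _ fun c => (G.thetaInv hcd hW l p c).1.1 := by
    refine @Continuous.comp (G.target.Fiber p) W ((Y W hW).Fiber p) (G.target.topology p) (topSub W)
      ((Y W hW).topology p) (fun c : ∀ i : G.Index, lineFiber (i.1 : ℤ) p =>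
        hW.projW hcd (S.mkL (G.sec l fun i => (c i).1 p.rep))) (Submodule.mkQ _)
      continuous_coinduced_rng ?_
    refine @Continuous.comp (G.target.Fiber p) _ _ (G.target.topology p) topPS (topSub W)
      (fun c : ∀ i : G.Index, lineFiber (i.1 : ℤ) p => G.sec l fun i => (c i).1 p.rep)
      (hW.projW hcd ∘ S.mkL) (hW.continuous_projW hcd) ?_
    refine @continuous_pi (G.target.Fiber p) (Fin 3 →₀ ℕ) (fun _ => ℂ) (G.target.topology p)
      (fun _ => ⊥) _ fun n => ?_
    exact continuous_functional_sec hcd G (l' := coeff n)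
      ⟨Finsupp.weight S.wt n + 1, fun f hf => hf n (by omega)⟩ l p id
  have h2 : ∀ i, @Continuous (G.target.Fiber p) ((lineBundle S.a S.b 0 S.a).Fiber p) _ _ fun c =>
      constSection (hW.proj hcd (S.mkL (G.sec l fun i => (c i).1 p.rep)) i) p := fun i =>
    continuous_functional_sec hcd G (hcont i) l p fun r => constSection r p
  exact @Continuous.prodMk ((Y W hW).Fiber p × lineFiber 0 p) (lineFiber 0 p) (G.target.Fiber p)
    (@instTopologicalSpaceProd _ _ ((Y W hW).topology p) ⊥) ⊥ (G.target.topology p) _ _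
    (@Continuous.prodMk ((Y W hW).Fiber p) (lineFiber 0 p) (G.target.Fiber p)
      ((Y W hW).topology p) ⊥ (G.target.topology p) _ _ h1 (h2 0)) (h2 1)

theorem theta_act (u : ℂˣ) (p : P1) (x : FiberY W p) :
    G.theta hcd W (actP S.a S.b u p) ((Ytilde W hW).act u p x) =
      G.target.act u p (G.theta hcd W p x) := by
  obtain ⟨⟨x, φ⟩, ψ⟩ := x
  obtain ⟨F, rfl⟩ := Submodule.Quotient.mk_surjective _ x
  funext i
  set v := p.rep with hv
  have hvp : v ∈ p.submodule := rep_mem p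
  have hv' := torus_mem_actP S.a S.b u p hvp
  have hv0 : torus S.a S.b u v ≠ 0 := fun h =>
    p.rep_nonzero (torus_injective S.a S.b u (by rw [← hv, h, map_zero]))
  refine lineFiber_ext hv' hv0 ?_
  have hu : (u : ℂ) ≠ 0 := u.ne_zero
  have e1 : (((lineBundle S.a S.b 0 S.a).act u p φ).1 (torus S.a S.b u v)) = (u : ℂ) ^ S.a * φ.1 v := by
    change (u : ℂ) ^ ((S.a : ℤ) + S.a * 0) * φ.1 (torus S.a S.b u⁻¹ (torus S.a S.b u v)) = _
    rw [torus_inv_torus, mul_zero, add_zero, zpow_natCast]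
  have e2 : (((lineBundle S.a S.b 0 S.b).act u p ψ).1 (torus S.a S.b u v)) = (u : ℂ) ^ S.b * ψ.1 v := by
    change (u : ℂ) ^ ((S.b : ℤ) + S.a * 0) * ψ.1 (torus S.a S.b u⁻¹ (torus S.a S.b u v)) = _
    rw [torus_inv_torus, mul_zero, add_zero, zpow_natCast]
  have e3 : (G.target.act u p (G.theta hcd W p ((Submodule.Quotient.mk F, φ), ψ)) i).1
      (torus S.a S.b u v) = (u : ℂ) ^ (i.1 * (S.d - S.a) + i.2.1 + S.a * i.1) *
        G.formX hcd v i (F + S.lin ![φ.1 v, ψ.1 v]) := by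
    change (u : ℂ) ^ ((G.weight i : ℤ) + S.a * i.1) *
      (G.theta hcd W p ((Submodule.Quotient.mk F, φ), ψ) i).1
        (torus S.a S.b u⁻¹ (torus S.a S.b u v)) = _
    rw [torus_inv_torus, theta_mk_apply hcd G F φ ψ i hvp p.rep_nonzero]
    congr 1
  rw [e3, ← formX_torus hcd]
  refine (G.theta_mk_apply hcd (W := W) ⟨S.scale u F, hW.scale_mem u F F.2⟩
    ((lineBundle S.a S.b 0 S.a).act u p φ) ((lineBundle S.a S.b 0 S.b).act u p ψ) i hv' hv0).trans ?_
  have hlin : ![(u : ℂ) ^ S.a * φ.1 v, (u : ℂ) ^ S.b * ψ.1 v] =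
      torus S.a S.b u ![φ.1 v, ψ.1 v] := by
    ext i
    fin_cases i <;> simp [torus]
  rw [e1, e2, hlin, map_add (S.scale u), scale_lin]

/-- The isomorphism of `Ytilde` with a product of line bundles. -/
def iso : (Ytilde W hW).Iso G.target where
  toEquiv := G.thetaEquiv hcd hW
  continuous_toFun := G.continuous_theta hcd hW
  continuous_invFun p := by
    obtain ⟨l, hl⟩ := exists_lin_rep_eq_one p
    have h : ⇑(G.thetaEquiv hcd hW p).symm = G.thetaInv hcd hW l p := G.thetaEquiv_symm_eq hcd hW hl
    exact h ▸ G.continuous_thetaInv hcd hW l p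
  equivariant := G.theta_act hcd hW
  regular_iff U hU s := ⟨fun h => G.regular_of_Y hcd hW h.1.1 h.1.2 h.2, fun h => by
    obtain ⟨h1, h2, h3⟩ := G.regular_of_theta hcd hW hU h
    exact ⟨⟨h1, h2⟩, h3⟩⟩

end Generators

end QHSurface

/-! ### Uniqueness of decompositions into line bundles -/

namespace EquivP1

open MvPolynomial Filter

theorem differentiable_eval_comp {σ : Type*} (P : MvPolynomial σ ℂ) {γ : ℂ → σ → ℂ}
    (hγ : ∀ j, Differentiable ℂ fun t => γ t j) : Differentiable ℂ fun t => eval (γ t) P := by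
  induction P using MvPolynomial.induction_on with
  | C r => simp
  | add P Q hP hQ =>
    simp only [map_add]
    fun_prop
  | mul_X P j hP =>
    simp only [map_mul, eval_X]
    exact Differentiable.fun_mul hP (hγ j)

/-- Near each parameter the function is a quotient of entire functions with nonvanishing
denominator. Holomorphy is all that is needed to apply Liouville's theorem to sections on ℙ¹. -/
theorem IsRegularOfDegree.differentiable_comp {n : ℤ} {U : Set P1} {f : {v : Plane // v ≠ 0} → ℂ}
    (hf : IsRegularOfDegree n U f) {γ : ℂ → {v : Plane // v ≠ 0}}
    (hγ : ∀ j, Differentiable ℂ fun t => (γ t).1 j) (hU : ∀ t, Projectivization.mk' ℂ (γ t) ∈ U) :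
    Differentiable ℂ fun t => f (γ t) := by
  intro t
  obtain ⟨i, j, P, D, -, -, -, hDp, hv⟩ := hf _ (hU t)
  have hD := differentiable_eval_comp D hγ
  have hDt := hDp _ (mem_submodule_mk' (γ t)) (γ t).2
  refine ((differentiable_eval_comp P hγ t).div (hD t) hDt).congr_of_eventuallyEq ?_
  filter_upwards [hD.continuous.continuousAt.eventually_ne hDt] with u hu
  exact hv _ (hU u) hu

/-- The point `[1 : 0]`. -/
def basePoint : P1 := Projectivization.mk ℂ ![1, 0] (by simp)

theorem mem_basePoint : ![1, 0] ∈ basePoint.submodule := by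
  rw [basePoint, Projectivization.submodule_mk]
  exact Submodule.mem_span_singleton_self _

theorem actP_basePoint (a b : ℕ) (w : ℂˣ) : actP a b w basePoint = basePoint := by
  rw [actP, basePoint, Projectivization.map_mk]
  exact mk_eq_mk_of_cross _ _ (by simp [torus])

theorem isZariskiOpen_chart {l : Plane} (hl : l ≠ 0) : IsZariskiOpen (chart l) :=
  Or.inr (compl_chart_subset hl).finite

theorem IsRegularOfDegree.zpow_form (l : Plane) (k : ℤ) :
    IsRegularOfDegree k (chart l) fun v => (l 0 * v.1 0 + l 1 * v.1 1) ^ k := by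
  obtain ⟨n, rfl | rfl⟩ := k.eq_nat_or_neg
  · have h := IsRegularOfDegree.form ((isHomogeneous_linForm l).pow n) (chart l)
    simpa [eval_linForm] using h
  · simpa using IsRegularOfDegree.inv_pow l n subset_rfl

namespace EquivFamily

variable {a b : ℕ}

/-- The element `e` of the fibre over `[1 : 0]` is the value of a global section of the twist of
`E` by `𝒪(-m)`, and it has weight `n`. -/
def IsGlobalValue (E : EquivFamily a b) (m n : ℤ) (e : E.Fiber basePoint) : Prop :=
  (∃ s₀ s₁ : ∀ p, E.Fiber p, E.IsRegular (chart ![1, 0]) s₀ ∧ E.IsRegular (chart ![0, 1]) s₁ ∧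
    (∀ v : {v : Plane // v ≠ 0}, v.1 0 ≠ 0 → v.1 1 ≠ 0 →
      s₁ (Projectivization.mk' ℂ v) = (v.1 1 / v.1 0) ^ m • s₀ (Projectivization.mk' ℂ v)) ∧
    s₀ basePoint = e) ∧
  -- The points w·[1:0] and [1:0] are equal but not definitionally so; a function s on all points
  -- with value e at [1:0] transports e to the fibre over w·[1:0].
  ∀ s : ∀ p, E.Fiber p, s basePoint = e → ∀ w : ℂˣ,
    E.act w basePoint e = (w : ℂ) ^ n • s (actP a b w basePoint)

theorem IsGlobalValue.map {E F : EquivFamily a b} {m n : ℤ} {e : E.Fiber basePoint}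
    (ψ : ∀ p, E.Fiber p ≃ₗ[ℂ] F.Fiber p)
    (hact : ∀ (w : ℂˣ) (p : P1) (x : E.Fiber p),
      ψ (actP a b w p) (E.act w p x) = F.act w p (ψ p x))
    (hreg : ∀ (U : Set P1), IsZariskiOpen U → ∀ s : ∀ p, E.Fiber p, E.IsRegular U s →
      F.IsRegular U (fun p => ψ p (s p)))
    (h : E.IsGlobalValue m n e) : F.IsGlobalValue m n (ψ _ e) := by
  obtain ⟨⟨s₀, s₁, h0, h1, h01, he⟩, hw⟩ := h
  refine ⟨⟨fun p => ψ p (s₀ p), fun p => ψ p (s₁ p), hreg _ (isZariskiOpen_chart (by simp)) _ h0,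
    hreg _ (isZariskiOpen_chart (by simp)) _ h1, fun v hv0 hv1 => ?_, congrArg (ψ _) he⟩, fun s hs w => ?_⟩
  · beta_reduce
    rw [h01 v hv0 hv1, map_smul]
  · rw [← hact, hw (fun p => (ψ p).symm (s p)) (by rw [hs, LinearEquiv.symm_apply_apply]) w, map_smul,
      LinearEquiv.apply_symm_apply]

theorem Iso.isGlobalValue_iff {E F : EquivFamily a b} (φ : E.Iso F) (m n : ℤ)
    (e : E.Fiber basePoint) :
    F.IsGlobalValue m n (φ.toEquiv _ e) ↔ E.IsGlobalValue m n e := by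
  refine ⟨fun h => ?_, fun h => h.map φ.toEquiv φ.equivariant fun U hU s hs =>
    (φ.regular_iff U hU s).1 hs⟩
  have := h.map (fun p => (φ.toEquiv p).symm) (fun w p x => by
    rw [LinearEquiv.symm_apply_eq, φ.equivariant, LinearEquiv.apply_symm_apply])
    (fun U hU s hs => (φ.regular_iff U hU _).2 (by simpa using hs))
  simpa using this

end EquivFamily

/-- The exponents `k ≥ m` are those for which `𝒪(k)` twisted by `𝒪(-m)` has nonzero sections. -/
theorem eq_zero_of_regular_of_lt {k m : ℤ} (hkm : k < m) {s₀ s₁ : ∀ p, lineFiber k p}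
    (h0 : IsRegularOfDegree k (chart ![1, 0]) fun v => (s₀ (Projectivization.mk' ℂ v)).1 v.1)
    (h1 : IsRegularOfDegree k (chart ![0, 1]) fun v => (s₁ (Projectivization.mk' ℂ v)).1 v.1)
    (h01 : ∀ v : {v : Plane // v ≠ 0}, v.1 0 ≠ 0 → v.1 1 ≠ 0 →
      s₁ (Projectivization.mk' ℂ v) = (v.1 1 / v.1 0) ^ m • s₀ (Projectivization.mk' ℂ v)) :
    (s₀ basePoint).1 ![1, 0] = 0 := by
  let γ : ℂ → {v : Plane // v ≠ 0} := fun t => ⟨![1, t], by simp⟩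
  let δ : ℂ → {v : Plane // v ≠ 0} := fun t => ⟨![t, 1], by simp⟩
  let f : ℂ → ℂ := fun t => (s₀ (Projectivization.mk' ℂ (γ t))).1 (γ t).1
  let g : ℂ → ℂ := fun t => (s₁ (Projectivization.mk' ℂ (δ t))).1 (δ t).1
  have hf : Differentiable ℂ f := h0.differentiable_comp (γ := γ)
    (fun j => by fin_cases j <;> simp [γ])
    (fun t => (mk_mem_chart_iff (γ t).2).2 (by simp [γ]))
  have hg : Differentiable ℂ g := h1.differentiable_comp (γ := δ)
    (fun j => by fin_cases j <;> simp [δ])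
    (fun t => (mk_mem_chart_iff (δ t).2).2 (by simp [δ]))
  -- Transition between the affine charts: the twist by 𝒪(-m) and the homogeneity of degree k
  -- combine to the exponent m - k > 0.
  have hfg : ∀ t, t ≠ 0 → f t = t⁻¹ ^ (m - k) * g t⁻¹ := by
    intro t ht
    have e1 : Projectivization.mk' ℂ (δ t⁻¹) = Projectivization.mk' ℂ (γ t) :=
      mk_eq_mk_of_cross _ _ (by simp [δ, γ, ht])
    have e2 : (δ t⁻¹).1 = t⁻¹ • (γ t).1 := by
      ext i
      fin_cases i <;> simp [γ, δ, ht]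
    have e3 := congrArg (fun x => x.1 (γ t).1) (h01 (γ t) (by simp [γ]) (by simpa [γ] using ht))
    change (s₁ (Projectivization.mk' ℂ (γ t))).1 (γ t).1 = (t / 1) ^ m * f t at e3
    have e4 : g t⁻¹ = t⁻¹ ^ k * (s₁ (Projectivization.mk' ℂ (γ t))).1 (γ t).1 := by
      simp only [g]
      rw [e1, e2, Subtype.prop (s₁ _) |>.2 _ (inv_ne_zero ht)]
    rw [e4, e3, ← mul_assoc, ← mul_assoc, ← zpow_add₀ (inv_ne_zero ht), sub_add_cancel, div_one,
      ← mul_zpow, inv_mul_cancel₀ ht, one_zpow, one_mul]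
  -- Since g is continuous at 0 and the exponent is positive, the entire function f tends to 0 at
  -- infinity and is therefore zero.
  have hlim : Tendsto f (cocompact ℂ) (𝓝 0) := by
    obtain ⟨r, hr⟩ : ∃ r : ℕ, m - k = (r + 1 : ℕ) := ⟨(m - k - 1).toNat, by omega⟩
    have hc : ContinuousAt (fun u => u ^ (r + 1) * g u) 0 := by
      exact (continuousAt_id.pow _).mul hg.continuous.continuousAt
    have h2 := hc.tendsto
    simp only [ne_eq, Nat.add_eq_zero_iff, one_ne_zero, and_false, not_false_eq_true, zero_pow,
      zero_mul] at h2
    refine (h2.comp (tendsto_inv₀_cobounded (α := ℂ))).mono_left (Metric.cobounded_eq_cocompact (α := ℂ)).ge |>.congr' ?_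
    have : ∀ᶠ t : ℂ in cocompact ℂ, t ≠ 0 := by
      have := (isCompact_singleton (x := (0 : ℂ))).compl_mem_cocompact
      filter_upwards [this] with t ht using ht
    filter_upwards [this] with t ht
    rw [hfg t ht, hr, zpow_natCast]
    rfl
  exact hf.apply_eq_of_tendsto_cocompact 0 hlim

theorem two_zpow_injective {m n : ℤ} (h : (2 : ℂ) ^ m = 2 ^ n) : m = n := by
  have := congrArg norm h
  simp only [norm_zpow, Complex.norm_ofNat] at this
  exact zpow_right_injective₀ (by norm_num) (by norm_num) this

variable {ι : Type} {a b : ℕ}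

/-- The direct product of the line bundles `𝒪(p i)_(q i)`. -/
abbrev lineProduct (a b : ℕ) (p q : ι → ℤ) : EquivFamily a b :=
  EquivFamily.prod fun i => lineBundle a b (p i) (q i)

theorem homogeneous_monomial (r : ℂ) (m k : ℤ) {t : ℂ} (ht : t ≠ 0) (v : Plane) :
    r * ((t • v) 1 ^ m * (t • v) 0 ^ (k - m)) = t ^ k * (r * (v 1 ^ m * v 0 ^ (k - m))) := by
  have h : t ^ k = t ^ m * t ^ (k - m) := by rw [← zpow_add₀ ht, add_sub_cancel]
  simp only [Pi.smul_apply, smul_eq_mul, mul_zpow, h]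
  ring

/-- The condition is tested in each factor. For p ≥ m a vector over [1:0] extends by the sections
α^p and β^m α^(p-m) on the two charts; for p < m no nonzero vector extends, by
`eq_zero_of_regular_of_lt`. -/
theorem isGlobalValue_lineProduct_iff (p q : ι → ℤ) (m n : ℤ)
    (e : (lineProduct a b p q).Fiber basePoint) :
    (lineProduct a b p q).IsGlobalValue m n e ↔
      ∀ i, (m ≤ p i ∧ q i = n) ∨ (e i).1 ![1, 0] = 0 := by
  have hact : ∀ (s : ∀ x, (lineProduct a b p q).Fiber x) (w : ℂˣ) i,
      (s (actP a b w basePoint) i).1 ![1, 0] = (s basePoint i).1 ![1, 0] := by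
    intro s w i
    rw [actP_basePoint]
  let σ : ∀ x, (lineProduct a b p q).Fiber x := fun x i =>
    coneSection (n := p i) (fun v => (e i).1 ![1, 0] * (v 1 ^ (0 : ℤ) * v 0 ^ (p i - 0)))
      (fun r hr v => homogeneous_monomial _ _ _ hr v) x
  have hσ : σ basePoint = e := by
    funext i
    refine lineFiber_ext mem_basePoint (by simp) ?_
    simp only [σ]
    rw [coneSection_apply _ _ mem_basePoint (by simp)]
    simp
  constructor
  · rintro ⟨⟨s₀, s₁, h0, h1, h01, he⟩, hw⟩ i
    by_contra hcon
    rw [not_or] at hcon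
    obtain ⟨hc1, hc2⟩ := hcon
    refine hc1 ⟨?_, ?_⟩
    · by_contra hlt
      refine hc2 ?_
      rw [← he]
      exact eq_zero_of_regular_of_lt (not_le.1 hlt) (s₀ := fun x => s₀ x i) (s₁ := fun x => s₁ x i)
        (h0 i) (h1 i) fun v hv0 hv1 => congrFun (h01 v hv0 hv1) i
    -- The single element w = 2 already determines the weight, since its integral powers are
    -- distinct.
    · have h2 := congrArg (fun x => (x i).1 ![1, 0]) (hw σ hσ (Units.mk0 2 two_ne_zero))
      have h3 := lineBundle_act_weight a b (p i) (q i) (Units.mk0 2 two_ne_zero) basePoint (e i)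
      have h4 := hact σ (Units.mk0 2 two_ne_zero) i
      rw [hσ] at h4
      change (((lineBundle a b (p i) (q i)).act _ basePoint (e i)).1 ![1, 0]) =
        (2 : ℂ) ^ n * (σ _ i).1 ![1, 0] at h2
      rw [h3, h4] at h2
      exact two_zpow_injective (mul_right_cancel₀ hc2 h2)
  · intro h
    refine ⟨⟨σ, fun x i => coneSection (n := p i)
      (fun v => (e i).1 ![1, 0] * (v 1 ^ m * v 0 ^ (p i - m)))
      (fun r hr v => homogeneous_monomial _ _ _ hr v) x, fun i => ?_, fun i => ?_,
      fun v hv0 hv1 => ?_, hσ⟩, fun s hs w => ?_⟩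
    · have := (IsRegularOfDegree.const ((e i).1 ![1, 0]) (chart ![1, 0])).mul
        (IsRegularOfDegree.zpow_form ![1, 0] (p i))
      rw [zero_add] at this
      refine this.congr fun v _ => ?_
      simp only [σ]
      refine Eq.trans ?_ (coneSection_apply _ _ (mem_submodule_mk' v) v.2).symm
      simp
    · obtain ⟨hm, -⟩ | h0 := h i
      · obtain ⟨r, hr⟩ := Int.eq_ofNat_of_zero_le (sub_nonneg.2 hm)
        have := (IsRegularOfDegree.const ((e i).1 ![1, 0]) (chart ![0, 1])).mul
          ((IsRegularOfDegree.zpow_form ![0, 1] m).mul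
            (IsRegularOfDegree.form ((isHomogeneous_X ℂ (0 : Fin 2)).pow r) _))
        have hdeg : 0 + (m + ((1 * r : ℕ) : ℤ)) = p i := by push_cast; omega
        rw [hdeg] at this
        refine this.congr fun v _ => ?_
        refine Eq.trans ?_ (coneSection_apply _ _ (mem_submodule_mk' v) v.2).symm
        simp [hr]
      · refine (IsRegularOfDegree.zero (p i) _).congr fun v _ => ?_
        refine Eq.trans ?_ (coneSection_apply _ _ (mem_submodule_mk' v) v.2).symm
        simp [h0]
    · funext i
      refine lineFiber_ext (mem_submodule_mk' v) v.2 ?_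
      change _ = (v.1 1 / v.1 0) ^ m * (σ _ i).1 v.1
      simp only [σ]
      rw [coneSection_apply _ _ (mem_submodule_mk' v) v.2,
        coneSection_apply _ _ (mem_submodule_mk' v) v.2, zpow_zero, sub_zero, zpow_sub₀ hv0,
        div_zpow]
      ring
    · funext i
      refine lineFiber_ext (v := ![1, 0]) (by rw [actP_basePoint]; exact mem_basePoint) (by simp) ?_
      have h3 := lineBundle_act_weight a b (p i) (q i) w basePoint (e i)
      refine h3.trans ?_
      change _ = (w : ℂ) ^ n * (s _ i).1 ![1, 0]
      rw [hact, hs]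
      obtain ⟨-, hq⟩ | h0 := h i
      · rw [hq]
      · rw [h0, mul_zero, mul_zero]

/-- The linear parametrization of the elements of weight `n` that are values of global sections of
the twist by `𝒪(-m)`. -/
def valueMap (p q : ι → ℤ) (m n : ℤ) :
    ({i | m ≤ p i ∧ q i = n} → ℂ) →ₗ[ℂ] ∀ i, lineFiber (p i) basePoint :=
  open Classical in
  LinearMap.pi fun i => if h : m ≤ p i ∧ q i = n then
    (LinearMap.proj ⟨i, h⟩ : ({i | m ≤ p i ∧ q i = n} → ℂ) →ₗ[ℂ] ℂ).smulRight
      (coneSection (n := p i) (fun v => v 0 ^ p i) (fun r _ v => by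
        simp [mul_zpow]) basePoint) else 0

theorem valueMap_apply (p q : ι → ℤ) (m n : ℤ) (c : {i | m ≤ p i ∧ q i = n} → ℂ)
    (i : {i | m ≤ p i ∧ q i = n}) : (valueMap p q m n c i.1).1 ![1, 0] = c i := by
  have h : m ≤ p i ∧ q i = n := i.2
  simp only [valueMap, LinearMap.pi_apply]
  rw [dif_pos h]
  change c i * (coneSection _ _ basePoint).1 ![1, 0] = _
  rw [coneSection_apply _ _ mem_basePoint (by simp)]
  simp

theorem valueMap_injective (p q : ι → ℤ) (m n : ℤ) :
    Function.Injective (valueMap p q m n) := fun c c' h => by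
  funext i
  rw [← valueMap_apply p q m n c i, h, valueMap_apply]

theorem mem_range_valueMap (p q : ι → ℤ) (m n : ℤ) (e : (lineProduct a b p q).Fiber basePoint) :
    e ∈ LinearMap.range (valueMap p q m n) ↔
      (lineProduct a b p q).IsGlobalValue m n e := by
  rw [isGlobalValue_lineProduct_iff]
  have h0 : ∀ (c : {i | m ≤ p i ∧ q i = n} → ℂ) i, ¬ (m ≤ p i ∧ q i = n) →
      valueMap p q m n c i = 0 := by
    intro c i h
    simp only [valueMap, LinearMap.pi_apply]
    rw [dif_neg h]
    rfl
  constructor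
  · rintro ⟨c, rfl⟩ i
    by_cases h : m ≤ p i ∧ q i = n
    · exact Or.inl h
    · right
      rw [h0 c i h]
      rfl
  · intro h
    refine ⟨fun i => (e i.1).1 ![1, 0], funext fun i => lineFiber_ext mem_basePoint (by simp) ?_⟩
    by_cases hi : m ≤ p i ∧ q i = n
    · exact valueMap_apply p q m n _ ⟨i, hi⟩
    · rw [h0 _ i hi, (h i).resolve_left hi]
      rfl

variable {ι' : Type}

/-- The space of global values is defined by data that isomorphisms preserve. In either
decomposition it is the space of functions on the indices with exponent at least m and weight n. -/
theorem exists_equiv_of_iso {E : EquivFamily a b} {p q : ι → ℤ} {p' q' : ι' → ℤ}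
    (φ : E.Iso (lineProduct a b p q)) (ψ : E.Iso (lineProduct a b p' q')) (m n : ℤ) :
    Nonempty (({i | m ≤ p i ∧ q i = n} → ℂ) ≃ₗ[ℂ] ({i | m ≤ p' i ∧ q' i = n} → ℂ)) := by
  let T : (∀ i, lineFiber (p i) basePoint) ≃ₗ[ℂ] ∀ i, lineFiber (p' i) basePoint :=
    (φ.toEquiv basePoint).symm.trans (ψ.toEquiv basePoint)
  have hT : (LinearMap.range (valueMap p q m n)).map T.toLinearMap =
      LinearMap.range (valueMap p' q' m n) := by
    ext e
    obtain ⟨x, hx⟩ : ∃ x, (φ.toEquiv basePoint x : ∀ i, lineFiber (p i) basePoint) = T.symm e :=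
      (φ.toEquiv basePoint).surjective _
    have he : (ψ.toEquiv basePoint x : ∀ i, lineFiber (p' i) basePoint) = e := by
      rw [← T.apply_symm_apply e, ← hx]
      exact (congrArg (ψ.toEquiv basePoint) (LinearEquiv.symm_apply_apply _ x)).symm
    rw [Submodule.mem_map_equiv, ← hx, ← he]
    exact ((mem_range_valueMap p q m n _).trans (φ.isGlobalValue_iff m n x)).trans
      ((mem_range_valueMap p' q' m n _).trans (ψ.isGlobalValue_iff m n x)).symm
  exact ⟨(LinearEquiv.ofInjective _ (valueMap_injective p q m n)).trans
    ((T.submoduleMap _).trans ((LinearEquiv.ofEq _ _ hT).trans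
      (LinearEquiv.ofInjective _ (valueMap_injective p' q' m n)).symm))⟩

theorem finite_of_linearEquiv_pi {α β : Type*} [Finite β] (f : (α → ℂ) ≃ₗ[ℂ] (β → ℂ)) : Finite α := by
  classical
  have : Module.Finite ℂ (α → ℂ) := Module.Finite.equiv f.symm
  exact (Pi.linearIndependent_single_one α ℂ).finite

/-- The factors with exponent exactly m are counted by the difference of the counts for m and m + 1;
finiteness passes from the second decomposition to the first through the isomorphism of function
spaces. -/
theorem finite_and_ncard_eq_of_iso {E : EquivFamily a b} {p q : ι → ℤ} {p' q' : ι' → ℤ}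
    (φ : E.Iso (lineProduct a b p q)) (ψ : E.Iso (lineProduct a b p' q'))
    (hfin : ∀ m n, {i | m ≤ p' i ∧ q' i = n}.Finite) (m n : ℤ) :
    {i | p i = m ∧ q i = n}.Finite ∧
      {i | p i = m ∧ q i = n}.ncard = {i | p' i = m ∧ q' i = n}.ncard := by
  have key : ∀ m, {i | m ≤ p i ∧ q i = n}.Finite ∧
      {i | m ≤ p i ∧ q i = n}.ncard = {i | m ≤ p' i ∧ q' i = n}.ncard := by
    intro m
    obtain ⟨f⟩ := exists_equiv_of_iso φ ψ m n
    have h' : Finite {i | m ≤ p' i ∧ q' i = n} := hfin m n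
    have h : Finite {i | m ≤ p i ∧ q i = n} := finite_of_linearEquiv_pi f
    refine ⟨h, ?_⟩
    have := Fintype.ofFinite {i | m ≤ p i ∧ q i = n}
    have := Fintype.ofFinite {i | m ≤ p' i ∧ q' i = n}
    have h2 := f.finrank_eq
    rw [Module.finrank_fintype_fun_eq_card, Module.finrank_fintype_fun_eq_card] at h2
    rwa [← Nat.card_coe_set_eq, ← Nat.card_coe_set_eq, Nat.card_eq_fintype_card,
      Nat.card_eq_fintype_card]
  have hdiff : ∀ {κ : Type} (p q : κ → ℤ), {i | p i = m ∧ q i = n} =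
      {i | m ≤ p i ∧ q i = n} \ {i | m + 1 ≤ p i ∧ q i = n} := by
    intro κ p q
    ext i
    simp only [Set.mem_ofPred_eq, Set.mem_sdiff]
    omega
  have hsub : ∀ {κ : Type} (p q : κ → ℤ), {i | m + 1 ≤ p i ∧ q i = n} ⊆
      {i | m ≤ p i ∧ q i = n} := fun p q i hi => ⟨by have := hi.1; omega, hi.2⟩
  rw [hdiff, hdiff]
  refine ⟨(key m).1.subset Set.sdiff_subset, ?_⟩
  rw [Set.ncard_sdiff (hsub p q) (key (m + 1)).1, Set.ncard_sdiff (hsub p' q') (hfin _ _),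
    (key m).2, (key (m + 1)).2]

end EquivP1

/-! ### The character -/

namespace QHSurface

open EquivP1

namespace Generators

variable {S : QHSurface} (G : S.Generators)

theorem setOf_index_eq (k l : ℕ) : {i : G.Index | i.1 = k ∧ i.2.1 = l} =
    Set.range fun j : Fin (G.e l) => ((k, ⟨l, j⟩) : G.Index) := by
  ext ⟨k', l', j⟩
  constructor
  · rintro ⟨rfl, rfl⟩
    exact ⟨j, rfl⟩
  · rintro ⟨j', h⟩
    rw [← h]
    exact ⟨rfl, rfl⟩

theorem ncard_index_eq (k l : ℕ) : {i : G.Index | i.1 = k ∧ i.2.1 = l}.ncard = G.e l := by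
  rw [setOf_index_eq, ← Set.image_univ, Set.ncard_image_of_injective, Set.ncard_univ,
    Nat.card_eq_fintype_card, Fintype.card_fin]
  intro j j' h
  simpa using h

/-- As d > a, an index (k, j) of weight n has k ≤ n and generator weight at most n. Finiteness for
all exponents at least m is what allows the counts to be subtracted. -/
theorem finite_setOf_weight_eq (hcd : S.c < S.d) (m n : ℤ) :
    {i : G.Index | m ≤ (i.1 : ℤ) ∧ (G.weight i : ℤ) = n}.Finite := by
  have hac : S.a ≤ S.c := S.a_le_b.trans S.b_le_c
  have h : (⋃ k ∈ Finset.range (n.toNat + 1), ⋃ l ∈ Finset.range (n.toNat + 1),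
      {i : G.Index | i.1 = k ∧ i.2.1 = l}).Finite :=
    Set.Finite.biUnion (Finset.finite_toSet _) fun k _ =>
      Set.Finite.biUnion (Finset.finite_toSet _) fun l _ => by
        rw [setOf_index_eq]
        exact Set.finite_range _
  refine h.subset fun i hi => ?_
  have hw : i.1 * (S.d - S.a) + i.2.1 = n.toNat := by
    have := hi.2
    rw [weight] at this
    omega
  have h1 : i.1 ≤ i.1 * (S.d - S.a) := Nat.le_mul_of_pos_right _ (by omega)
  simp only [Set.mem_iUnion]
  exact ⟨i.1, Finset.mem_range.2 (by omega), i.2.1, Finset.mem_range.2 (by omega), rfl, rfl⟩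

theorem ncard_weight_eq (m n : ℤ) :
    ({i : G.Index | (i.1 : ℤ) = m ∧ (G.weight i : ℤ) = n}.ncard : ℚ) =
      coeffST S.characterSeries m n := by
  rw [coeffST, S.characterSeries_eq _ G.series]
  split_ifs with h
  · obtain ⟨m, rfl⟩ := Int.eq_ofNat_of_zero_le h.1
    obtain ⟨n, rfl⟩ := Int.eq_ofNat_of_zero_le h.2
    rw [coeff_geometricSeries]
    simp only [Int.toNat_natCast, Finsupp.coe_add, Pi.add_apply, Finsupp.single_eq_same,
      PowerSeries.coeff_mk, Nat.cast_inj, weight]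
    have e0 : (Finsupp.single (0 : Fin 2) n) 1 = 0 := by simp
    have e1 : (Finsupp.single (1 : Fin 2) m) 0 = 0 := by simp
    rw [e0, e1, zero_add, add_zero]
    split_ifs with hmn
    · rw [← G.ncard_index_eq m (n - m * (S.d - S.a))]
      congr 2
      ext i
      simp only [Set.mem_ofPred_eq]
      constructor
      · rintro ⟨rfl, h2⟩
        exact ⟨rfl, by omega⟩
      · rintro ⟨rfl, h2⟩
        exact ⟨rfl, by omega⟩
    · rw [Nat.cast_eq_zero]
      convert Set.ncard_empty G.Index
      rw [Set.eq_empty_iff_forall_notMem]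
      rintro i ⟨rfl, h2⟩
      omega
  · rw [Nat.cast_eq_zero]
    convert Set.ncard_empty G.Index
    rw [Set.eq_empty_iff_forall_notMem]
    rintro i ⟨rfl, rfl⟩
    exact h ⟨Int.natCast_nonneg _, Int.natCast_nonneg _⟩

end Generators

end QHSurface

theorem mainTheorem2 (S : QHSurface) (hS : ¬ S.IsTypeA) :
    S.c < S.d ∧
    (∃ W : Submodule ℂ S.OX, S.IsGradedComplement W) ∧
    ∀ (W : Submodule ℂ S.OX) (hW : S.IsGradedComplement W),
      EquivP1.HasCharacter (QHSurface.Ytilde W hW) S.characterSeries := by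
  -- The exclusion of type A enters the proof only through this inequality.
  have hbc : S.b + S.c < S.d := by
    by_contra h
    exact hS (MvPolynomial.isKleinianA_of_degree_le S.a_pos S.a_le_b S.b_le_c S.homogeneous
      (not_lt.1 h) S.isolated)
  have hcd : S.c < S.d := by omega
  obtain ⟨G⟩ := S.nonempty_generators hcd
  refine ⟨hcd, S.exists_isGradedComplement hbc, fun W hW =>
    ⟨⟨G.Index, _, _, ⟨G.iso hcd hW⟩⟩, fun ι p q ⟨φ⟩ m n => ?_⟩⟩
  have h := EquivP1.finite_and_ncard_eq_of_iso φ (G.iso hcd hW)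
    (fun m n => G.finite_setOf_weight_eq hcd m n) m n
  exact ⟨h.1, by rw [h.2]; exact G.ncard_weight_eq m n⟩

end
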